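/- **Setting.** Fix sets of numbers $n$, addresses $a$, variables $x$, labels $\ell$ and primitive operators $o$; $s$ ranges over strings. *Expressions* are $$\begin{aligned}e::={}&x\mid s\mid n\mid a\mid\mathtt{true}\mid\mathtt{false}\mid\mathtt{undef}\mid\mathtt{null}\mid\mathtt{func}(\vec x)\{e\}\mid\{\overrightarrow{s{:}e}\}\mid\mathtt{let}(x=e)\,e\mid e(\vec e)\mid e[e]\mid e[e]=e\mid\mathtt{delete}\ e[e]\mid e=e\mid\mathtt{ref}\ e\mid\mathtt{deref}\ e\\&\mid\mathtt{if}(e)\{e\}\{e\}\mid e;e\mid\mathtt{while}(e)\{e\}\mid\ell{:}\{e\}\mid\mathtt{break}\ \ell\ e\mid\mathtt{try}\{e\}\mathtt{catch}(x)\{e\}\mid\mathtt{try}\{e\}\mathtt{finally}\{e\}\mid\mathtt{throw}\ e\mid o(\vec e).\end{aligned}$$ A *program* is a closed expression: no free variables and, being run in the empty store, no addresses. Stores $\sigma$ are finite maps from addresses to values; an *answer* is $\langle\sigma,v\rangle$ or $\langle\sigma,\mathtt{err}\ v\rangle$ (uncaught exception). A function $\delta$ maps an operator and argument values (functions being opaque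 to it) to a function-free value or an exception carrying one, and commutes with renaming of addresses. **$\lambda_{JS}$** (substitution-based). Values are constants, addresses, function terms and records of values. *Local* frames are those of left-to-right call-by-value evaluation of $\mathtt{let}(x=\bullet)e$, applications, records, operators, field lookup, update and deletion, $\mathtt{ref}$, $\mathtt{deref}$, assignment, the test of $\mathtt{if}$, the first part of a sequence, $\mathtt{throw}\,\bullet$ and $\mathtt{break}\ \ell\,\bullet$; *control* frames are $\ell{:}\{\bullet\}$, $\mathtt{try}\{\bullet\}\mathtt{catch}(x)\{e\}$ and $\mathtt{try}\{\bullet\}\mathtt{finally}\{e\}$. $\mathcal E$ ranges over all stacks of frames, $\mathcal C$ over stacks of local frames, $\mathcal F$ over stacks of local and label frames, $\mathcal G$ over stacks of local and catch frames. In any $\mathcal E$, with the store unchanged: $\mathtt{let}(x=v)e\to[v/x]e$; $\mathtt{func}(\vec x)\{e\}(\vec v)\to[\vec v/\vec x]e$ if $|\vec x|=|\vec v|$; $r[s]\to$ the field $s$ of the record $r$, or $\mathtt{undef}$ if absent; $r[s]=v\to$ $r$ with field $s$ updated to $v$, or extended by $s{:}v$ if absent; $\mathtt{delete}\ r[s]\to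 r$ without the field $s$; $\mathtt{if}(\mathtt{true})\{e\}\{f\}\to e$; $\mathtt{if}(\mathtt{false})\{e\}\{f\}\to f$; $v;e\to e$; $\mathtt{while}(e)\{f\}\to\mathtt{if}(e)\{f;\mathtt{while}(e)\{f\}\}\{\mathtt{undef}\}$; $\mathtt{try}\{v\}\mathtt{catch}(x)\{e\}\to v$; $\mathtt{try}\{v\}\mathtt{finally}\{e\}\to e;v$; $\ell{:}\{v\}\to v$; $o(\vec v)\to\delta(o,\vec v)$, or $\mathtt{throw}\ w$ if $\delta$ raises $w$; and redexes with a run-time error (applying a non-function or with the wrong number of arguments, field access on a non-record or with a non-string key, branching on a non-boolean, dereferencing or assigning to a non-address) reduce to $\mathtt{throw}$ of a string that depends only on the kind of error. With the store: $\langle\sigma,\mathcal E[\mathtt{ref}\ v]\rangle\to\langle\sigma[a\mapsto v],\mathcal E[a]\rangle$ for any $a\notin\mathrm{dom}\,\sigma$; $\langle\sigma,\mathcal E[\mathtt{deref}\ a]\rangle\to\langle\sigma,\mathcal E[\sigma(a)]\rangle$; $\langle\sigma,\mathcal E[a=v]\rangle\to\langle\sigma[a\mapsto v],\mathcal E[v]\rangle$.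 Control, with the store unchanged: $\mathcal F[\mathtt{throw}\ v]\to\mathtt{err}\ v$; $\mathcal E[\mathtt{try}\{\mathcal F[\mathtt{throw}\ v]\}\mathtt{catch}(x)\{e\}]\to\mathcal E[[v/x]e]$; $\mathcal E[\mathtt{try}\{\mathcal F[\mathtt{throw}\ v]\}\mathtt{finally}\{e\}]\to\mathcal E[e;\mathtt{throw}\ v]$; $\mathcal E[\mathtt{try}\{\mathcal G[\mathtt{break}\ \ell\ v]\}\mathtt{finally}\{e\}]\to\mathcal E[e;\mathtt{break}\ \ell\ v]$; $\mathcal E[\ell'{:}\{\mathcal G[\mathtt{break}\ \ell\ v]\}]\to\mathcal E[v]$ if $\ell'=\ell$ and $\to\mathcal E[\mathtt{break}\ \ell\ v]$ otherwise; a break with no enclosing label or finalizer, $\mathcal G[\mathtt{break}\ \ell\ v]$, is a run-time error. $\lambda_{JS}$ evaluation of $e$ starts from $\langle\emptyset,e\rangle$. **$\lambda\rho_{JS}$** is the variant with explicit substitutions. Closures are pairs $(e,\rho)$ of an expression and an environment (a finite map from variables to values), values, and the compound forms above built from closures; values are constants, addresses, pairs $(\mathtt{func}(\vec x)\{e\},\rho)$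 and records of values. The environment of a pair $(e,\rho)$ is propagated to the immediate subexpressions of $e$, $(x,\rho)\to\rho(x)$, and the other rules are as above with $\rho[x\mapsto v]$ in place of $[v/x]$, except that control effects pass one control frame at a time: $\mathcal F$ and $\mathcal G$ are replaced by $\mathcal C$, and $\mathcal E[\ell{:}\{\mathcal C[\mathtt{throw}\ v]\}]\to\mathcal E[\mathtt{throw}\ v]$ and $\mathcal E[\mathtt{try}\{\mathcal C[\mathtt{break}\ \ell\ v]\}\mathtt{catch}(x)\{c\}]\to\mathcal E[\mathtt{break}\ \ell\ v]$ are added. Evaluation of $e$ starts from $\mathrm{inj}_{JS}(e)=\langle\emptyset,(e,\emptyset)\rangle$. The map $\mathcal U$ carries out all delayed substitutions in the values of an answer (in its store, too), $\mathcal U(\mathtt{func}(\vec x)\{e\},\rho)=\mathtt{func}(\vec x)\{[\mathcal U(\rho(y))/y]_{y\in\mathrm{dom}\,\rho\setminus\vec x}\,e\}$. **The JAM** has closures and values as in $\lambda\rho_{JS}$, but its environments map variables to addresses and the values of variables live in the store. Its states are $\langle\sigma,c,E\rangle_{ev}$, $\langle\sigma,v,E\rangle_{co}$, $\langle\sigma,c,E\rangle_{ap}$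 ($E$ a stack of single frames) and answers. The $ev$ transitions propagate environments and push a frame for the next subterm to be evaluated, or go to $co$ with a value and to $ap$ with a redex; the $co$ transitions return a value to the top frame (to the empty stack: halt with $\langle\sigma,v\rangle$); the $ap$ transitions contract the redex by the rules above, where a variable is looked up through its address in the store; $\mathtt{let}$, application, $\mathtt{catch}$ and $\mathtt{ref}$ store the values concerned at addresses given by a function $\mathit{alloc}$ of the current state; and $\mathtt{throw}\ v$ and $\mathtt{break}\ \ell\ v$ discard local frames one at a time and treat the control frames as above ($\mathtt{throw}\ v$ on the empty stack: halt with $\langle\sigma,\mathtt{err}\ v\rangle$). Of $\mathit{alloc}$ it is only required that it returns the needed number of distinct addresses, none of them in the domain of the store. The initial state is $\mathrm{inj}_{JAM}(e)=\langle\emptyset,(e,\emptyset),\mathit{nil}\rangle_{ev}$. **Equality of answers.** A $\lambda\rho_{JS}$ answer with store $\sigma$ and a JAM answer with store $\tau$ *agree* if both are values or both are errors and, for some permutation $\pi$ of the addresses, their values agree and, for every $a\in\mathrm{dom}\,\sigma$, $\pi(a)\in\mathrm{dom}\,\tau$ and the values $\sigma(a)$ and $\tau(\pi(a))$ agree. Here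 equal constants agree, $a$ agrees with $\pi(a)$, records agree fieldwise, and $(f,\rho)$ agrees with $(f,\eta)$ if $\rho$ and $\eta$ have the same domain and $\rho(x)$ agrees with $\tau(\eta(x))$ for each $x$ in it. A $\lambda_{JS}$ answer $A$ agrees with a JAM answer if $A=\mathcal U(B)$ for some $\lambda\rho_{JS}$ answer $B$ that agrees with it. **Lemma (Correctness).** For every such $\delta$, every such $\mathit{alloc}$ and every program $e$: 1. $$\langle\emptyset,e\rangle\longmapsto^*_{\lambda_{JS}}A\iff\mathrm{inj}_{JAM}(e)\longmapsto^*_{JAM}A;$$ 2. $$\mathrm{inj}_{JS}(e)\longmapsto^*_{\lambda\rho_{JS}}A\iff\mathrm{inj}_{JAM}(e)\longmapsto^*_{JAM}A.$$ In both, answers are identified as above: for every answer reached on one side there is an answer reached on the other side that agrees with it. -/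

import Mathlib

namespace JSCalc

/-! ### Syntax -/

/-- The basic sets of the calculus: numbers, addresses, variables, labels, primitive operators. -/
structure Sig where
  Num : Type
  Addr : Type
  Var : Type
  Lab : Type
  Op : Type
  decAddr : DecidableEq Addr
  decVar : DecidableEq Var

attribute [instance] Sig.decAddr Sig.decVar

/-- Constants other than addresses. -/
inductive Const (S : Sig) : Type
  | str (s : String)
  | num (n : S.Num)
  | bool (b : Bool)
  | undef
  | null

/-- Expressions. -/
inductive Exp (S : Sig) : Type
  | var (x : S.Var)
  | const (k : Const S)
  | addr (a : S.Addr)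
  | func (xs : List S.Var) (e : Exp S)
  | record (fs : List (String × Exp S))
  | letE (x : S.Var) (e f : Exp S)
  | app (e : Exp S) (fs : List (Exp S))
  | get (e f : Exp S)
  | set (e f g : Exp S)
  | del (e f : Exp S)
  | assign (e f : Exp S)
  | ref (e : Exp S)
  | deref (e : Exp S)
  | ite (e f g : Exp S)
  | seq (e f : Exp S)
  | while (e f : Exp S)
  | label (l : S.Lab) (e : Exp S)
  | brk (l : S.Lab) (e : Exp S)
  | tryCatch (e : Exp S) (x : S.Var) (f : Exp S)
  | tryFinally (e f : Exp S)
  | throw (e : Exp S)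
  | op (o : S.Op) (es : List (Exp S))

section FreeNames
variable {S : Sig}

mutual
/-- Free variables. -/
def Exp.fv : Exp S → Set S.Var
  | .var x => {x}
  | .const _ => ∅
  | .addr _ => ∅
  | .func xs e => e.fv \ {x | x ∈ xs}
  | .record fs => Exp.fvFields fs
  | .letE x e f => e.fv ∪ (f.fv \ {x})
  | .app e fs => e.fv ∪ Exp.fvList fs
  | .get e f => e.fv ∪ f.fv
  | .set e f g => e.fv ∪ f.fv ∪ g.fv
  | .del e f => e.fv ∪ f.fv
  | .assign e f => e.fv ∪ f.fv
  | .ref e => e.fv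
  | .deref e => e.fv
  | .ite e f g => e.fv ∪ f.fv ∪ g.fv
  | .seq e f => e.fv ∪ f.fv
  | .while e f => e.fv ∪ f.fv
  | .label _ e => e.fv
  | .brk _ e => e.fv
  | .tryCatch e x f => e.fv ∪ (f.fv \ {x})
  | .tryFinally e f => e.fv ∪ f.fv
  | .throw e => e.fv
  | .op _ es => Exp.fvList es
def Exp.fvList : List (Exp S) → Set S.Var
  | [] => ∅
  | e :: es => e.fv ∪ Exp.fvList es
def Exp.fvFields : List (String × Exp S) → Set S.Var
  | [] => ∅
  | (_, e) :: fs => e.fv ∪ Exp.fvFields fs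
end

mutual
/-- Addresses that occur literally in an expression. -/
def Exp.addrs : Exp S → Set S.Addr
  | .var _ => ∅
  | .const _ => ∅
  | .addr a => {a}
  | .func _ e => e.addrs
  | .record fs => Exp.addrsFields fs
  | .letE _ e f => e.addrs ∪ f.addrs
  | .app e fs => e.addrs ∪ Exp.addrsList fs
  | .get e f => e.addrs ∪ f.addrs
  | .set e f g => e.addrs ∪ f.addrs ∪ g.addrs
  | .del e f => e.addrs ∪ f.addrs
  | .assign e f => e.addrs ∪ f.addrs
  | .ref e => e.addrs
  | .deref e => e.addrs
  | .ite e f g => e.addrs ∪ f.addrs ∪ g.addrs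
  | .seq e f => e.addrs ∪ f.addrs
  | .while e f => e.addrs ∪ f.addrs
  | .label _ e => e.addrs
  | .brk _ e => e.addrs
  | .tryCatch e _ f => e.addrs ∪ f.addrs
  | .tryFinally e f => e.addrs ∪ f.addrs
  | .throw e => e.addrs
  | .op _ es => Exp.addrsList es
def Exp.addrsList : List (Exp S) → Set S.Addr
  | [] => ∅
  | e :: es => e.addrs ∪ Exp.addrsList es
def Exp.addrsFields : List (String × Exp S) → Set S.Addr
  | [] => ∅
  | (_, e) :: fs => e.addrs ∪ Exp.addrsFields fs
end

/-- A program is a closed expression.  It is run in the empty store, so closedness also means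
that it mentions no address: addresses come into being only at run time. -/
def IsProgram (e : Exp S) : Prop := e.fv = ∅ ∧ e.addrs = ∅

end FreeNames

/-! ### Values, environments, closures, stores -/

/-- Values over a type `F` of function values. -/
inductive PVal (S : Sig) (F : Type) : Type
  | const (k : Const S)
  | addr (a : S.Addr)
  | fn (f : F)
  | record (fs : List (String × PVal S F))

mutual
/-- Rename the addresses of a value by `g` and replace its function values by `f`. -/
def PVal.map {S : Sig} {F G : Type} (g : S.Addr → S.Addr) (f : F → G) : PVal S F → PVal S G
  | .const k => .const k
  | .addr a => .addr (g a)
  | .fn p => .fn (f p)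
  | .record fs => .record (PVal.mapFields g f fs)
def PVal.mapFields {S : Sig} {F G : Type} (g : S.Addr → S.Addr) (f : F → G) :
    List (String × PVal S F) → List (String × PVal S G)
  | [] => []
  | (s, v) :: fs => (s, PVal.map g f v) :: PVal.mapFields g f fs
end

/-- A function term `func(xs) { e }`. -/
structure Fun (S : Sig) where
  params : List S.Var
  body : Exp S

/-- Syntactic values, the values of the substitution calculus. -/
abbrev SynVal (S : Sig) : Type := PVal S (Fun S)

/-- Values of a calculus with environments in `R`: a function value is a function term paired
with an environment. -/
abbrev Val (S : Sig) (R : Type) : Type := PVal S (Fun S × R)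

/-- Environments of the calculus of explicit substitutions: finite maps from variables to values,
as association lists in which the first entry for a variable counts. -/
inductive REnv (S : Sig) : Type
  | mk (l : List (S.Var × PVal S (Fun S × REnv S)))

/-- Environments of the machine: finite maps from variables to addresses, likewise. -/
abbrev JEnv (S : Sig) : Type := List (S.Var × S.Addr)

abbrev RVal (S : Sig) : Type := Val S (REnv S)
abbrev JVal (S : Sig) : Type := Val S (JEnv S)

def REnv.empty {S : Sig} : REnv S := .mk []

def REnv.lookup {S : Sig} : REnv S → S.Var → Option (RVal S)
  | .mk l, x => List.lookup x l

def REnv.extend {S : Sig} (b : List (S.Var × RVal S)) : REnv S → REnv S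
  | .mk l => .mk (b ++ l)

/-- Closures over environments in `R`.  The constructor `val` is the inclusion of the values. -/
inductive Clo (S : Sig) (R : Type) : Type
  | clos (e : Exp S) (ρ : R)
  | val (v : PVal S (Fun S × R))
  | record (fs : List (String × Clo S R))
  | letE (x : S.Var) (c d : Clo S R)
  | app (c : Clo S R) (ds : List (Clo S R))
  | get (c d : Clo S R)
  | set (c d d' : Clo S R)
  | del (c d : Clo S R)
  | assign (c d : Clo S R)
  | ref (c : Clo S R)
  | deref (c : Clo S R)
  | ite (c d d' : Clo S R)
  | seq (c d : Clo S R)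
  | while (c d : Clo S R)
  | label (l : S.Lab) (c : Clo S R)
  | brk (l : S.Lab) (c : Clo S R)
  | tryCatch (c : Clo S R) (x : S.Var) (d : Clo S R)
  | tryFinally (c d : Clo S R)
  | throw (c : Clo S R)
  | op (o : S.Op) (cs : List (Clo S R))

abbrev RClo (S : Sig) : Type := Clo S (REnv S)
abbrev JClo (S : Sig) : Type := Clo S (JEnv S)

/-- Stores are finite maps from addresses to values. -/
abbrev Store (S : Sig) (V : Type) : Type := Finmap (fun _ : S.Addr => V)

/-- Answers: a store with a value, or with an uncaught exception `err v`. -/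
inductive Answer (S : Sig) (V : Type) : Type
  | value (σ : Store S V) (v : V)
  | error (σ : Store S V) (v : V)

/-! ### Primitive operations and run-time errors -/

/-- The function `δ` interprets a primitive operator on argument values, in which it sees functions
only as opaque (hence `Unit`).  It returns a function-free value or raises one as an exception. -/
abbrev Delta (S : Sig) : Type := S.Op → List (PVal S Unit) → Except (PVal S Empty) (PVal S Empty)

/-- The function-free results of `δ`, and the arguments that it sees, in any kind of values. -/
def ofData {S : Sig} {F : Type} (r : PVal S Empty) : PVal S F := r.map id Empty.elim
def skeleton {S : Sig} {F : Type} (v : PVal S F) : PVal S Unit := v.map id (fun _ => ())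

/-- Addresses are abstract: `δ` commutes with every renaming of them (it may compare addresses, but
it cannot inspect or invent one). -/
def Delta.Equivariant {S : Sig} (δ : Delta S) : Prop :=
  ∀ (π : Equiv.Perm S.Addr) (o : S.Op) (vs : List (PVal S Unit)),
    δ o (vs.map (PVal.map π id)) =
      match δ o vs with
      | .ok r => .ok (r.map π id)
      | .error r => .error (r.map π id)

inductive RuntimeError : Type
  | notFunction
  | arity
  | notRecord
  | notString
  | notBoolean
  | notAddress
  | unmatchedBreak

/-- The exception value thrown for a run-time error; `msg` gives the message. -/
def errVal {S : Sig} {F : Type} (msg : RuntimeError → String) (k : RuntimeError) : PVal S F :=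
  .const (.str (msg k))

def PVal.IsFn {S : Sig} {F : Type} (v : PVal S F) : Prop := ∃ f, v = .fn f
def PVal.IsRecord {S : Sig} {F : Type} (v : PVal S F) : Prop := ∃ fs, v = .record fs
def PVal.IsStr {S : Sig} {F : Type} (v : PVal S F) : Prop := ∃ s, v = .const (.str s)
def PVal.IsBool {S : Sig} {F : Type} (v : PVal S F) : Prop := ∃ b, v = .const (.bool b)
def PVal.IsAddr {S : Sig} {F : Type} (v : PVal S F) : Prop := ∃ a, v = .addr a

/-- Redexes that raise a run-time error. -/
inductive Fault {S : Sig} {R : Type} : Clo S R → RuntimeError → Prop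
  | notFunction (v : Val S R) (vs : List (Val S R)) : ¬ v.IsFn →
      Fault (.app (.val v) (vs.map .val)) .notFunction
  | arity (xs : List S.Var) (e : Exp S) (ρ : R) (vs : List (Val S R)) : xs.length ≠ vs.length →
      Fault (.app (.val (.fn (⟨xs, e⟩, ρ))) (vs.map .val)) .arity
  | getRecord (v u : Val S R) : ¬ v.IsRecord → Fault (.get (.val v) (.val u)) .notRecord
  | getString (v u : Val S R) : v.IsRecord → ¬ u.IsStr → Fault (.get (.val v) (.val u)) .notString
  | setRecord (v u t : Val S R) : ¬ v.IsRecord →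
      Fault (.set (.val v) (.val u) (.val t)) .notRecord
  | setString (v u t : Val S R) : v.IsRecord → ¬ u.IsStr →
      Fault (.set (.val v) (.val u) (.val t)) .notString
  | delRecord (v u : Val S R) : ¬ v.IsRecord → Fault (.del (.val v) (.val u)) .notRecord
  | delString (v u : Val S R) : v.IsRecord → ¬ u.IsStr → Fault (.del (.val v) (.val u)) .notString
  | notBoolean (v : Val S R) (c d : Clo S R) : ¬ v.IsBool → Fault (.ite (.val v) c d) .notBoolean
  | deref (v : Val S R) : ¬ v.IsAddr → Fault (.deref (.val v)) .notAddress
  | assign (v u : Val S R) : ¬ v.IsAddr → Fault (.assign (.val v) (.val u)) .notAddress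

/-- Propagation of an environment to the immediate subexpressions. -/
inductive Propagate {S : Sig} {R : Type} (ρ : R) : Exp S → Clo S R → Prop
  | const (k : Const S) : Propagate ρ (.const k) (.val (.const k))
  | addr (a : S.Addr) : Propagate ρ (.addr a) (.val (.addr a))
  | func (xs : List S.Var) (e : Exp S) :
      Propagate ρ (.func xs e) (.val (.fn (⟨xs, e⟩, ρ)))
  | record (fs : List (String × Exp S)) :
      Propagate ρ (.record fs) (.record (fs.map fun p => (p.1, .clos p.2 ρ)))
  | letE (x : S.Var) (e f : Exp S) : Propagate ρ (.letE x e f) (.letE x (.clos e ρ) (.clos f ρ))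
  | app (e : Exp S) (fs : List (Exp S)) :
      Propagate ρ (.app e fs) (.app (.clos e ρ) (fs.map fun f => .clos f ρ))
  | get (e f : Exp S) : Propagate ρ (.get e f) (.get (.clos e ρ) (.clos f ρ))
  | set (e f g : Exp S) : Propagate ρ (.set e f g) (.set (.clos e ρ) (.clos f ρ) (.clos g ρ))
  | del (e f : Exp S) : Propagate ρ (.del e f) (.del (.clos e ρ) (.clos f ρ))
  | assign (e f : Exp S) : Propagate ρ (.assign e f) (.assign (.clos e ρ) (.clos f ρ))
  | ref (e : Exp S) : Propagate ρ (.ref e) (.ref (.clos e ρ))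
  | deref (e : Exp S) : Propagate ρ (.deref e) (.deref (.clos e ρ))
  | ite (e f g : Exp S) : Propagate ρ (.ite e f g) (.ite (.clos e ρ) (.clos f ρ) (.clos g ρ))
  | seq (e f : Exp S) : Propagate ρ (.seq e f) (.seq (.clos e ρ) (.clos f ρ))
  | while (e f : Exp S) : Propagate ρ (.while e f) (.while (.clos e ρ) (.clos f ρ))
  | label (l : S.Lab) (e : Exp S) : Propagate ρ (.label l e) (.label l (.clos e ρ))
  | brk (l : S.Lab) (e : Exp S) : Propagate ρ (.brk l e) (.brk l (.clos e ρ))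
  | tryCatch (e : Exp S) (x : S.Var) (f : Exp S) :
      Propagate ρ (.tryCatch e x f) (.tryCatch (.clos e ρ) x (.clos f ρ))
  | tryFinally (e f : Exp S) : Propagate ρ (.tryFinally e f) (.tryFinally (.clos e ρ) (.clos f ρ))
  | throw (e : Exp S) : Propagate ρ (.throw e) (.throw (.clos e ρ))
  | op (o : S.Op) (es : List (Exp S)) :
      Propagate ρ (.op o es) (.op o (es.map fun e => .clos e ρ))

/-! ### Evaluation contexts -/

/-- Single evaluation context frames over terms `T` and values `V`.  The last three are the control
frames; all others are local. -/
inductive Frame (S : Sig) (T V : Type) : Type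
  | letF (x : S.Var) (d : T)
  | appFun (ds : List T)
  | appArg (v : V) (vs : List V) (ds : List T)
  | recordF (vs : List (String × V)) (s : String) (ds : List (String × T))
  | opF (o : S.Op) (vs : List V) (ds : List T)
  | getL (d : T)
  | getR (v : V)
  | setL (d d' : T)
  | setM (v : V) (d' : T)
  | setR (v u : V)
  | delL (d : T)
  | delR (v : V)
  | refF
  | derefF
  | assignL (d : T)
  | assignR (v : V)
  | iteF (d d' : T)
  | seqF (d : T)
  | throwF
  | brkF (l : S.Lab)
  | catchF (x : S.Var) (d : T)
  | finallyF (d : T)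
  | labelF (l : S.Lab)

def Frame.IsLocal {S : Sig} {T V : Type} : Frame S T V → Prop
  | .catchF _ _ => False
  | .finallyF _ => False
  | .labelF _ => False
  | _ => True

def Frame.IsLabel {S : Sig} {T V : Type} : Frame S T V → Prop
  | .labelF _ => True
  | _ => False

def Frame.IsCatch {S : Sig} {T V : Type} : Frame S T V → Prop
  | .catchF _ _ => True
  | _ => False

/-- General evaluation contexts (also the stacks of the machine) are lists of frames, the innermost
frame first. -/
abbrev Ctx (S : Sig) (T V : Type) : Type := List (Frame S T V)

/-- Local contexts. -/
def Ctx.IsLocal {S : Sig} {T V : Type} (C : Ctx S T V) : Prop := ∀ F ∈ C, F.IsLocal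

abbrev RCtx (S : Sig) : Type := Ctx S (RClo S) (RVal S)
abbrev JCtx (S : Sig) : Type := Ctx S (JClo S) (JVal S)

/-- Configurations of the two calculi. -/
inductive Conf (S : Sig) (T V : Type) : Type
  | run (σ : Store S V) (t : T)
  | err (σ : Store S V) (v : V)

/-! ### The calculus of explicit substitutions -/

section Rho
variable {S : Sig}

def Frame.plugClo {R : Type} : Frame S (Clo S R) (Val S R) → Clo S R → Clo S R
  | .letF x d, c => .letE x c d
  | .appFun ds, c => .app c ds
  | .appArg v vs ds, c => .app (.val v) (vs.map .val ++ c :: ds)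
  | .recordF vs s ds, c => .record (vs.map (fun p => (p.1, .val p.2)) ++ (s, c) :: ds)
  | .opF o vs ds, c => .op o (vs.map .val ++ c :: ds)
  | .getL d, c => .get c d
  | .getR v, c => .get (.val v) c
  | .setL d d', c => .set c d d'
  | .setM v d', c => .set (.val v) c d'
  | .setR v u, c => .set (.val v) (.val u) c
  | .delL d, c => .del c d
  | .delR v, c => .del (.val v) c
  | .refF, c => .ref c
  | .derefF, c => .deref c
  | .assignL d, c => .assign c d
  | .assignR v, c => .assign (.val v) c
  | .iteF d d', c => .ite c d d'
  | .seqF d, c => .seq c d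
  | .throwF, c => .throw c
  | .brkF l, c => .brk l c
  | .catchF x d, c => .tryCatch c x d
  | .finallyF d, c => .tryFinally c d
  | .labelF l, c => .label l c

/-- `plug E c` is `E[c]`. -/
def plug : RCtx S → RClo S → RClo S
  | [], c => c
  | F :: E, c => plug E (F.plugClo c)

/-- Context-insensitive, store-insensitive reductions. -/
inductive RhoRed (δ : Delta S) (msg : RuntimeError → String) : RClo S → RClo S → Prop
  | propagate (e : Exp S) (ρ : REnv S) (c : RClo S) : Propagate ρ e c →
      RhoRed δ msg (.clos e ρ) c
  /- A record closure all of whose fields are values is a record value (the grammars of values and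
  closures overlap here; the step only switches to the constructor `val`). -/
  | record (fs : List (String × RVal S)) :
      RhoRed δ msg (.record (fs.map fun p => (p.1, .val p.2))) (.val (.record fs))
  | var (x : S.Var) (ρ : REnv S) (v : RVal S) : ρ.lookup x = some v →
      RhoRed δ msg (.clos (.var x) ρ) (.val v)
  | letE (x : S.Var) (v : RVal S) (e : Exp S) (ρ : REnv S) :
      RhoRed δ msg (.letE x (.val v) (.clos e ρ)) (.clos e (ρ.extend [(x, v)]))
  | app (xs : List S.Var) (e : Exp S) (ρ : REnv S) (vs : List (RVal S)) : xs.length = vs.length →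
      RhoRed δ msg (.app (.val (.fn (⟨xs, e⟩, ρ))) (vs.map .val))
        (.clos e (ρ.extend (xs.zip vs)))
  | get (fs fs' : List (String × RVal S)) (s : String) (v : RVal S) :
      RhoRed δ msg (.get (.val (.record (fs ++ (s, v) :: fs'))) (.val (.const (.str s)))) (.val v)
  | getNone (fs : List (String × RVal S)) (s : String) : s ∉ fs.map Prod.fst →
      RhoRed δ msg (.get (.val (.record fs)) (.val (.const (.str s)))) (.val (.const .undef))
  | set (fs fs' : List (String × RVal S)) (s : String) (u v : RVal S) :
      RhoRed δ msg
        (.set (.val (.record (fs ++ (s, u) :: fs'))) (.val (.const (.str s))) (.val v))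
        (.val (.record (fs ++ (s, v) :: fs')))
  | setNew (fs : List (String × RVal S)) (s : String) (v : RVal S) : s ∉ fs.map Prod.fst →
      RhoRed δ msg (.set (.val (.record fs)) (.val (.const (.str s))) (.val v))
        (.val (.record ((s, v) :: fs)))
  | del (fs fs' : List (String × RVal S)) (s : String) (u : RVal S) :
      RhoRed δ msg (.del (.val (.record (fs ++ (s, u) :: fs'))) (.val (.const (.str s))))
        (.val (.record (fs ++ fs')))
  | delNone (fs : List (String × RVal S)) (s : String) : s ∉ fs.map Prod.fst →
      RhoRed δ msg (.del (.val (.record fs)) (.val (.const (.str s)))) (.val (.record fs))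
  | iteTrue (c d : RClo S) : RhoRed δ msg (.ite (.val (.const (.bool true))) c d) c
  | iteFalse (c d : RClo S) : RhoRed δ msg (.ite (.val (.const (.bool false))) c d) d
  | seq (v : RVal S) (c : RClo S) : RhoRed δ msg (.seq (.val v) c) c
  | while (c d : RClo S) :
      RhoRed δ msg (.while c d) (.ite c (.seq d (.while c d)) (.val (.const .undef)))
  | tryCatch (v : RVal S) (x : S.Var) (c : RClo S) : RhoRed δ msg (.tryCatch (.val v) x c) (.val v)
  | tryFinally (v : RVal S) (c : RClo S) : RhoRed δ msg (.tryFinally (.val v) c) (.seq c (.val v))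
  | label (l : S.Lab) (v : RVal S) : RhoRed δ msg (.label l (.val v)) (.val v)
  | op (o : S.Op) (vs : List (RVal S)) (r : PVal S Empty) : δ o (vs.map skeleton) = .ok r →
      RhoRed δ msg (.op o (vs.map .val)) (.val (ofData r))
  | opError (o : S.Op) (vs : List (RVal S)) (r : PVal S Empty) : δ o (vs.map skeleton) = .error r →
      RhoRed δ msg (.op o (vs.map .val)) (.throw (.val (ofData r)))
  | fault (c : RClo S) (k : RuntimeError) : Fault c k →
      RhoRed δ msg c (.throw (.val (errVal msg k)))

/-- The one-step reduction relation on configurations. -/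
inductive RhoStep (δ : Delta S) (msg : RuntimeError → String) :
    Conf S (RClo S) (RVal S) → Conf S (RClo S) (RVal S) → Prop
  | red (σ : Store S (RVal S)) (E : RCtx S) (c c' : RClo S) : RhoRed δ msg c c' →
      RhoStep δ msg (.run σ (plug E c)) (.run σ (plug E c'))
  | ref (σ : Store S (RVal S)) (E : RCtx S) (v : RVal S) (a : S.Addr) : a ∉ σ →
      RhoStep δ msg (.run σ (plug E (.ref (.val v)))) (.run (σ.insert a v) (plug E (.val (.addr a))))
  | deref (σ : Store S (RVal S)) (E : RCtx S) (a : S.Addr) (v : RVal S) : σ.lookup a = some v →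
      RhoStep δ msg (.run σ (plug E (.deref (.val (.addr a))))) (.run σ (plug E (.val v)))
  | assign (σ : Store S (RVal S)) (E : RCtx S) (a : S.Addr) (v : RVal S) :
      RhoStep δ msg (.run σ (plug E (.assign (.val (.addr a)) (.val v))))
        (.run (σ.insert a v) (plug E (.val v)))
  | uncaught (σ : Store S (RVal S)) (C : RCtx S) (v : RVal S) : C.IsLocal →
      RhoStep δ msg (.run σ (plug C (.throw (.val v)))) (.err σ v)
  | throwCatch (σ : Store S (RVal S)) (E C : RCtx S) (v : RVal S) (x : S.Var) (e : Exp S)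
      (ρ : REnv S) : C.IsLocal →
      RhoStep δ msg (.run σ (plug E (.tryCatch (plug C (.throw (.val v))) x (.clos e ρ))))
        (.run σ (plug E (.clos e (ρ.extend [(x, v)]))))
  | throwFinally (σ : Store S (RVal S)) (E C : RCtx S) (v : RVal S) (c : RClo S) : C.IsLocal →
      RhoStep δ msg (.run σ (plug E (.tryFinally (plug C (.throw (.val v))) c)))
        (.run σ (plug E (.seq c (.throw (.val v)))))
  | throwLabel (σ : Store S (RVal S)) (E C : RCtx S) (v : RVal S) (l : S.Lab) : C.IsLocal →
      RhoStep δ msg (.run σ (plug E (.label l (plug C (.throw (.val v))))))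
        (.run σ (plug E (.throw (.val v))))
  | brkCatch (σ : Store S (RVal S)) (E C : RCtx S) (l : S.Lab) (v : RVal S) (x : S.Var)
      (c : RClo S) : C.IsLocal →
      RhoStep δ msg (.run σ (plug E (.tryCatch (plug C (.brk l (.val v))) x c)))
        (.run σ (plug E (.brk l (.val v))))
  | brkFinally (σ : Store S (RVal S)) (E C : RCtx S) (l : S.Lab) (v : RVal S)
      (c : RClo S) : C.IsLocal →
      RhoStep δ msg (.run σ (plug E (.tryFinally (plug C (.brk l (.val v))) c)))
        (.run σ (plug E (.seq c (.brk l (.val v)))))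
  | brkLabel (σ : Store S (RVal S)) (E C : RCtx S) (l : S.Lab) (v : RVal S) : C.IsLocal →
      RhoStep δ msg (.run σ (plug E (.label l (plug C (.brk l (.val v))))))
        (.run σ (plug E (.val v)))
  | brkOther (σ : Store S (RVal S)) (E C : RCtx S) (l l' : S.Lab) (v : RVal S) : C.IsLocal →
      l' ≠ l →
      RhoStep δ msg (.run σ (plug E (.label l' (plug C (.brk l (.val v))))))
        (.run σ (plug E (.brk l (.val v))))
  | brkUnmatched (σ : Store S (RVal S)) (C : RCtx S) (l : S.Lab) (v : RVal S) : C.IsLocal →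
      RhoStep δ msg (.run σ (plug C (.brk l (.val v))))
        (.run σ (.throw (.val (errVal msg .unmatchedBreak))))

/-- The initial configuration: empty store, and the program closed by the empty environment. -/
def injJS (e : Exp S) : Conf S (RClo S) (RVal S) := .run ∅ (.clos e .empty)

/-- Answers as configurations. -/
def Answer.toRho : Answer S (RVal S) → Conf S (RClo S) (RVal S)
  | .value σ v => .run σ (.val v)
  | .error σ v => .err σ v

/-- The program `e` evaluates to the answer `A` in the calculus of explicit substitutions. -/
def RhoEval (δ : Delta S) (msg : RuntimeError → String) (e : Exp S) (A : Answer S (RVal S)) : Prop :=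
  Relation.ReflTransGen (RhoStep δ msg) (injJS e) A.toRho

end Rho

/-! ### The substitution calculus -/

section Subst
variable {S : Sig}

mutual
/-- The inclusion of the syntactic values in the expressions. -/
def PVal.toExp : PVal S (Fun S) → Exp S
  | .const k => .const k
  | .addr a => .addr a
  | .fn f => .func f.params f.body
  | .record fs => .record (PVal.toExpFields fs)
def PVal.toExpFields : List (String × PVal S (Fun S)) → List (String × Exp S)
  | [] => []
  | (s, v) :: fs => (s, v.toExp) :: PVal.toExpFields fs
end

/-- Simultaneous substitutions of syntactic values for variables. -/
abbrev Sub (S : Sig) : Type := S.Var → Option (SynVal S)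

def Sub.ofList (l : List (S.Var × SynVal S)) : Sub S := fun x => List.lookup x l

def Sub.hide (θ : Sub S) (xs : List S.Var) : Sub S := fun x => if x ∈ xs then none else θ x

mutual
/-- Substitution for the free variables.  The values that are substituted are closed in every run of
a program, so no capture can occur. -/
def Exp.subst (θ : Sub S) : Exp S → Exp S
  | .var x => match θ x with
    | some v => v.toExp
    | none => .var x
  | .const k => .const k
  | .addr a => .addr a
  | .func xs e => .func xs (e.subst (θ.hide xs))
  | .record fs => .record (Exp.substFields θ fs)
  | .letE x e f => .letE x (e.subst θ) (f.subst (θ.hide [x]))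
  | .app e fs => .app (e.subst θ) (Exp.substList θ fs)
  | .get e f => .get (e.subst θ) (f.subst θ)
  | .set e f g => .set (e.subst θ) (f.subst θ) (g.subst θ)
  | .del e f => .del (e.subst θ) (f.subst θ)
  | .assign e f => .assign (e.subst θ) (f.subst θ)
  | .ref e => .ref (e.subst θ)
  | .deref e => .deref (e.subst θ)
  | .ite e f g => .ite (e.subst θ) (f.subst θ) (g.subst θ)
  | .seq e f => .seq (e.subst θ) (f.subst θ)
  | .while e f => .while (e.subst θ) (f.subst θ)
  | .label l e => .label l (e.subst θ)
  | .brk l e => .brk l (e.subst θ)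
  | .tryCatch e x f => .tryCatch (e.subst θ) x (f.subst (θ.hide [x]))
  | .tryFinally e f => .tryFinally (e.subst θ) (f.subst θ)
  | .throw e => .throw (e.subst θ)
  | .op o es => .op o (Exp.substList θ es)
def Exp.substList (θ : Sub S) : List (Exp S) → List (Exp S)
  | [] => []
  | e :: es => e.subst θ :: Exp.substList θ es
def Exp.substFields (θ : Sub S) : List (String × Exp S) → List (String × Exp S)
  | [] => []
  | (s, e) :: fs => (s, e.subst θ) :: Exp.substFields θ fs
end

abbrev SCtx (S : Sig) : Type := Ctx S (Exp S) (SynVal S)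

def Frame.plugExp : Frame S (Exp S) (SynVal S) → Exp S → Exp S
  | .letF x d, e => .letE x e d
  | .appFun ds, e => .app e ds
  | .appArg v vs ds, e => .app v.toExp (vs.map PVal.toExp ++ e :: ds)
  | .recordF vs s ds, e => .record (PVal.toExpFields vs ++ (s, e) :: ds)
  | .opF o vs ds, e => .op o (vs.map PVal.toExp ++ e :: ds)
  | .getL d, e => .get e d
  | .getR v, e => .get v.toExp e
  | .setL d d', e => .set e d d'
  | .setM v d', e => .set v.toExp e d'
  | .setR v u, e => .set v.toExp u.toExp e
  | .delL d, e => .del e d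
  | .delR v, e => .del v.toExp e
  | .refF, e => .ref e
  | .derefF, e => .deref e
  | .assignL d, e => .assign e d
  | .assignR v, e => .assign v.toExp e
  | .iteF d d', e => .ite e d d'
  | .seqF d, e => .seq e d
  | .throwF, e => .throw e
  | .brkF l, e => .brk l e
  | .catchF x d, e => .tryCatch e x d
  | .finallyF d, e => .tryFinally e d
  | .labelF l, e => .label l e

def plugE : SCtx S → Exp S → Exp S
  | [], e => e
  | F :: E, e => plugE E (F.plugExp e)

/-- Local contexts with labels, over which exceptions jump. -/
def IsThrowCtx (C : SCtx S) : Prop := ∀ F ∈ C, F.IsLocal ∨ F.IsLabel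

/-- Local contexts with exception handlers, over which breaks jump. -/
def IsBreakCtx (C : SCtx S) : Prop := ∀ F ∈ C, F.IsLocal ∨ F.IsCatch

/-- Redexes that raise a run-time error. -/
inductive SubFault : Exp S → RuntimeError → Prop
  | notFunction (v : SynVal S) (vs : List (SynVal S)) : ¬ v.IsFn →
      SubFault (.app v.toExp (vs.map PVal.toExp)) .notFunction
  | arity (xs : List S.Var) (e : Exp S) (vs : List (SynVal S)) : xs.length ≠ vs.length →
      SubFault (.app (.func xs e) (vs.map PVal.toExp)) .arity
  | getRecord (v u : SynVal S) : ¬ v.IsRecord → SubFault (.get v.toExp u.toExp) .notRecord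
  | getString (v u : SynVal S) : v.IsRecord → ¬ u.IsStr →
      SubFault (.get v.toExp u.toExp) .notString
  | setRecord (v u t : SynVal S) : ¬ v.IsRecord →
      SubFault (.set v.toExp u.toExp t.toExp) .notRecord
  | setString (v u t : SynVal S) : v.IsRecord → ¬ u.IsStr →
      SubFault (.set v.toExp u.toExp t.toExp) .notString
  | delRecord (v u : SynVal S) : ¬ v.IsRecord → SubFault (.del v.toExp u.toExp) .notRecord
  | delString (v u : SynVal S) : v.IsRecord → ¬ u.IsStr →
      SubFault (.del v.toExp u.toExp) .notString
  | notBoolean (v : SynVal S) (e f : Exp S) : ¬ v.IsBool → SubFault (.ite v.toExp e f) .notBoolean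
  | deref (v : SynVal S) : ¬ v.IsAddr → SubFault (.deref v.toExp) .notAddress
  | assign (v u : SynVal S) : ¬ v.IsAddr → SubFault (.assign v.toExp u.toExp) .notAddress

/-- Context-insensitive, store-insensitive reductions. -/
inductive SubRed (δ : Delta S) (msg : RuntimeError → String) : Exp S → Exp S → Prop
  | letE (x : S.Var) (v : SynVal S) (e : Exp S) :
      SubRed δ msg (.letE x v.toExp e) (e.subst (Sub.ofList [(x, v)]))
  | app (xs : List S.Var) (e : Exp S) (vs : List (SynVal S)) : xs.length = vs.length →
      SubRed δ msg (.app (.func xs e) (vs.map PVal.toExp)) (e.subst (Sub.ofList (xs.zip vs)))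
  | get (fs fs' : List (String × SynVal S)) (s : String) (v : SynVal S) :
      SubRed δ msg (.get (PVal.record (fs ++ (s, v) :: fs')).toExp (.const (.str s))) v.toExp
  | getNone (fs : List (String × SynVal S)) (s : String) : s ∉ fs.map Prod.fst →
      SubRed δ msg (.get (PVal.record fs).toExp (.const (.str s))) (.const .undef)
  | set (fs fs' : List (String × SynVal S)) (s : String) (u v : SynVal S) :
      SubRed δ msg (.set (PVal.record (fs ++ (s, u) :: fs')).toExp (.const (.str s)) v.toExp)
        (PVal.record (fs ++ (s, v) :: fs')).toExp
  | setNew (fs : List (String × SynVal S)) (s : String) (v : SynVal S) : s ∉ fs.map Prod.fst →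
      SubRed δ msg (.set (PVal.record fs).toExp (.const (.str s)) v.toExp)
        (PVal.record ((s, v) :: fs)).toExp
  | del (fs fs' : List (String × SynVal S)) (s : String) (u : SynVal S) :
      SubRed δ msg (.del (PVal.record (fs ++ (s, u) :: fs')).toExp (.const (.str s)))
        (PVal.record (fs ++ fs')).toExp
  | delNone (fs : List (String × SynVal S)) (s : String) : s ∉ fs.map Prod.fst →
      SubRed δ msg (.del (PVal.record fs).toExp (.const (.str s))) (PVal.record fs).toExp
  | iteTrue (e f : Exp S) : SubRed δ msg (.ite (.const (.bool true)) e f) e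
  | iteFalse (e f : Exp S) : SubRed δ msg (.ite (.const (.bool false)) e f) f
  | seq (v : SynVal S) (e : Exp S) : SubRed δ msg (.seq v.toExp e) e
  | while (e f : Exp S) :
      SubRed δ msg (.while e f) (.ite e (.seq f (.while e f)) (.const .undef))
  | tryCatch (v : SynVal S) (x : S.Var) (e : Exp S) :
      SubRed δ msg (.tryCatch v.toExp x e) v.toExp
  | tryFinally (v : SynVal S) (e : Exp S) : SubRed δ msg (.tryFinally v.toExp e) (.seq e v.toExp)
  | label (l : S.Lab) (v : SynVal S) : SubRed δ msg (.label l v.toExp) v.toExp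
  | op (o : S.Op) (vs : List (SynVal S)) (r : PVal S Empty) : δ o (vs.map skeleton) = .ok r →
      SubRed δ msg (.op o (vs.map PVal.toExp)) (ofData r : SynVal S).toExp
  | opError (o : S.Op) (vs : List (SynVal S)) (r : PVal S Empty) :
      δ o (vs.map skeleton) = .error r →
      SubRed δ msg (.op o (vs.map PVal.toExp)) (.throw (ofData r : SynVal S).toExp)
  | fault (e : Exp S) (k : RuntimeError) : SubFault e k →
      SubRed δ msg e (.throw (errVal msg k : SynVal S).toExp)

/-- The one-step reduction relation on configurations. -/
inductive SubStep (δ : Delta S) (msg : RuntimeError → String) :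
    Conf S (Exp S) (SynVal S) → Conf S (Exp S) (SynVal S) → Prop
  | red (σ : Store S (SynVal S)) (E : SCtx S) (e e' : Exp S) : SubRed δ msg e e' →
      SubStep δ msg (.run σ (plugE E e)) (.run σ (plugE E e'))
  | ref (σ : Store S (SynVal S)) (E : SCtx S) (v : SynVal S) (a : S.Addr) : a ∉ σ →
      SubStep δ msg (.run σ (plugE E (.ref v.toExp))) (.run (σ.insert a v) (plugE E (.addr a)))
  | deref (σ : Store S (SynVal S)) (E : SCtx S) (a : S.Addr) (v : SynVal S) :
      σ.lookup a = some v →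
      SubStep δ msg (.run σ (plugE E (.deref (.addr a)))) (.run σ (plugE E v.toExp))
  | assign (σ : Store S (SynVal S)) (E : SCtx S) (a : S.Addr) (v : SynVal S) :
      SubStep δ msg (.run σ (plugE E (.assign (.addr a) v.toExp)))
        (.run (σ.insert a v) (plugE E v.toExp))
  | uncaught (σ : Store S (SynVal S)) (C : SCtx S) (v : SynVal S) : IsThrowCtx C →
      SubStep δ msg (.run σ (plugE C (.throw v.toExp))) (.err σ v)
  | throwCatch (σ : Store S (SynVal S)) (E C : SCtx S) (v : SynVal S) (x : S.Var) (e : Exp S) :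
      IsThrowCtx C →
      SubStep δ msg (.run σ (plugE E (.tryCatch (plugE C (.throw v.toExp)) x e)))
        (.run σ (plugE E (e.subst (Sub.ofList [(x, v)]))))
  | throwFinally (σ : Store S (SynVal S)) (E C : SCtx S) (v : SynVal S) (e : Exp S) :
      IsThrowCtx C →
      SubStep δ msg (.run σ (plugE E (.tryFinally (plugE C (.throw v.toExp)) e)))
        (.run σ (plugE E (.seq e (.throw v.toExp))))
  | brkFinally (σ : Store S (SynVal S)) (E C : SCtx S) (l : S.Lab) (v : SynVal S) (e : Exp S) :
      IsBreakCtx C →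
      SubStep δ msg (.run σ (plugE E (.tryFinally (plugE C (.brk l v.toExp)) e)))
        (.run σ (plugE E (.seq e (.brk l v.toExp))))
  | brkLabel (σ : Store S (SynVal S)) (E C : SCtx S) (l : S.Lab) (v : SynVal S) :
      IsBreakCtx C →
      SubStep δ msg (.run σ (plugE E (.label l (plugE C (.brk l v.toExp)))))
        (.run σ (plugE E v.toExp))
  | brkOther (σ : Store S (SynVal S)) (E C : SCtx S) (l l' : S.Lab) (v : SynVal S) :
      IsBreakCtx C → l' ≠ l →
      SubStep δ msg (.run σ (plugE E (.label l' (plugE C (.brk l v.toExp)))))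
        (.run σ (plugE E (.brk l v.toExp)))
  | brkUnmatched (σ : Store S (SynVal S)) (C : SCtx S) (l : S.Lab) (v : SynVal S) :
      IsBreakCtx C →
      SubStep δ msg (.run σ (plugE C (.brk l v.toExp)))
        (.run σ (.throw (errVal msg .unmatchedBreak : SynVal S).toExp))

/-- Answers as configurations. -/
def Answer.toSub : Answer S (SynVal S) → Conf S (Exp S) (SynVal S)
  | .value σ v => .run σ v.toExp
  | .error σ v => .err σ v

/-- The program `e` evaluates to the answer `A` in the substitution calculus. -/
def SubEval (δ : Delta S) (msg : RuntimeError → String) (e : Exp S) (A : Answer S (SynVal S)) :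
    Prop :=
  Relation.ReflTransGen (SubStep δ msg) (.run ∅ e) A.toSub

end Subst

/-! ### The abstract machine -/

section Machine
variable {S : Sig}

/-- Machine states: evaluate, continue, apply, and final states. -/
inductive JState (S : Sig) : Type
  | ev (σ : Store S (JVal S)) (c : JClo S) (E : JCtx S)
  | co (σ : Store S (JVal S)) (v : JVal S) (E : JCtx S)
  | ap (σ : Store S (JVal S)) (c : JClo S) (E : JCtx S)
  | ans (A : Answer S (JVal S))

def Answer.store {V : Type} : Answer S V → Store S V
  | .value σ _ => σ
  | .error σ _ => σ

def JState.store : JState S → Store S (JVal S)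
  | .ev σ _ _ => σ
  | .co σ _ _ => σ
  | .ap σ _ _ => σ
  | .ans A => A.store

/-- Allocation functions: `alloc ς n` is the vector of addresses for a transition from the state `ς`
that needs `n` of them. -/
abbrev Alloc (S : Sig) : Type := JState S → ℕ → List S.Addr

/-- The requirement on allocation: a suitable number of (distinct) addresses, none of which is in
use in the store. -/
def Alloc.Valid (alloc : Alloc S) : Prop :=
  ∀ (ς : JState S) (n : ℕ),
    (alloc ς n).length = n ∧ (alloc ς n).Nodup ∧ ∀ a ∈ alloc ς n, a ∉ ς.store

/-- `put σ as vs` is `σ[as ↦ vs]`. -/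
def put (σ : Store S (JVal S)) (as : List S.Addr) (vs : List (JVal S)) : Store S (JVal S) :=
  (as.zip vs).foldl (fun τ p => τ.insert p.1 p.2) σ

/-- The values at an address of the store. -/
def fetch (σ : Store S (JVal S)) (a : S.Addr) : Set (JVal S) := {v | σ.lookup a = some v}

/-- The transitions of the machine. -/
inductive JStep (δ : Delta S) (msg : RuntimeError → String) (alloc : Alloc S) :
    JState S → JState S → Prop
  -- evaluate
  | evPropagate (σ : Store S (JVal S)) (e : Exp S) (ρ : JEnv S) (c : JClo S) (E : JCtx S) :
      Propagate ρ e c → JStep δ msg alloc (.ev σ (.clos e ρ) E) (.ev σ c E)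
  | evVar (σ : Store S (JVal S)) (x : S.Var) (ρ : JEnv S) (E : JCtx S) :
      JStep δ msg alloc (.ev σ (.clos (.var x) ρ) E) (.ap σ (.clos (.var x) ρ) E)
  | evVal (σ : Store S (JVal S)) (v : JVal S) (E : JCtx S) :
      JStep δ msg alloc (.ev σ (.val v) E) (.co σ v E)
  | evRecordNil (σ : Store S (JVal S)) (E : JCtx S) :
      JStep δ msg alloc (.ev σ (.record []) E) (.co σ (.record []) E)
  | evRecord (σ : Store S (JVal S)) (s : String) (c : JClo S) (ds : List (String × JClo S))
      (E : JCtx S) :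
      JStep δ msg alloc (.ev σ (.record ((s, c) :: ds)) E) (.ev σ c (.recordF [] s ds :: E))
  | evLet (σ : Store S (JVal S)) (x : S.Var) (c d : JClo S) (E : JCtx S) :
      JStep δ msg alloc (.ev σ (.letE x c d) E) (.ev σ c (.letF x d :: E))
  | evApp (σ : Store S (JVal S)) (c : JClo S) (ds : List (JClo S)) (E : JCtx S) :
      JStep δ msg alloc (.ev σ (.app c ds) E) (.ev σ c (.appFun ds :: E))
  | evGet (σ : Store S (JVal S)) (c d : JClo S) (E : JCtx S) :
      JStep δ msg alloc (.ev σ (.get c d) E) (.ev σ c (.getL d :: E))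
  | evSet (σ : Store S (JVal S)) (c d d' : JClo S) (E : JCtx S) :
      JStep δ msg alloc (.ev σ (.set c d d') E) (.ev σ c (.setL d d' :: E))
  | evDel (σ : Store S (JVal S)) (c d : JClo S) (E : JCtx S) :
      JStep δ msg alloc (.ev σ (.del c d) E) (.ev σ c (.delL d :: E))
  | evAssign (σ : Store S (JVal S)) (c d : JClo S) (E : JCtx S) :
      JStep δ msg alloc (.ev σ (.assign c d) E) (.ev σ c (.assignL d :: E))
  | evRef (σ : Store S (JVal S)) (c : JClo S) (E : JCtx S) :
      JStep δ msg alloc (.ev σ (.ref c) E) (.ev σ c (.refF :: E))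
  | evDeref (σ : Store S (JVal S)) (c : JClo S) (E : JCtx S) :
      JStep δ msg alloc (.ev σ (.deref c) E) (.ev σ c (.derefF :: E))
  | evIte (σ : Store S (JVal S)) (c d d' : JClo S) (E : JCtx S) :
      JStep δ msg alloc (.ev σ (.ite c d d') E) (.ev σ c (.iteF d d' :: E))
  | evSeq (σ : Store S (JVal S)) (c d : JClo S) (E : JCtx S) :
      JStep δ msg alloc (.ev σ (.seq c d) E) (.ev σ c (.seqF d :: E))
  | evWhile (σ : Store S (JVal S)) (c d : JClo S) (E : JCtx S) :
      JStep δ msg alloc (.ev σ (.while c d) E)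
        (.ev σ c (.iteF (.seq d (.while c d)) (.val (.const .undef)) :: E))
  | evLabel (σ : Store S (JVal S)) (l : S.Lab) (c : JClo S) (E : JCtx S) :
      JStep δ msg alloc (.ev σ (.label l c) E) (.ev σ c (.labelF l :: E))
  | evBrk (σ : Store S (JVal S)) (l : S.Lab) (c : JClo S) (E : JCtx S) :
      JStep δ msg alloc (.ev σ (.brk l c) E) (.ev σ c (.brkF l :: E))
  | evCatch (σ : Store S (JVal S)) (c : JClo S) (x : S.Var) (d : JClo S) (E : JCtx S) :
      JStep δ msg alloc (.ev σ (.tryCatch c x d) E) (.ev σ c (.catchF x d :: E))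
  | evFinally (σ : Store S (JVal S)) (c d : JClo S) (E : JCtx S) :
      JStep δ msg alloc (.ev σ (.tryFinally c d) E) (.ev σ c (.finallyF d :: E))
  | evThrow (σ : Store S (JVal S)) (c : JClo S) (E : JCtx S) :
      JStep δ msg alloc (.ev σ (.throw c) E) (.ev σ c (.throwF :: E))
  | evOpNil (σ : Store S (JVal S)) (o : S.Op) (E : JCtx S) :
      JStep δ msg alloc (.ev σ (.op o []) E) (.ap σ (.op o []) E)
  | evOp (σ : Store S (JVal S)) (o : S.Op) (c : JClo S) (ds : List (JClo S)) (E : JCtx S) :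
      JStep δ msg alloc (.ev σ (.op o (c :: ds)) E) (.ev σ c (.opF o [] ds :: E))
  -- continue
  | coNil (σ : Store S (JVal S)) (v : JVal S) :
      JStep δ msg alloc (.co σ v []) (.ans (.value σ v))
  | coLet (σ : Store S (JVal S)) (v : JVal S) (x : S.Var) (c : JClo S) (E : JCtx S) :
      JStep δ msg alloc (.co σ v (.letF x c :: E)) (.ap σ (.letE x (.val v) c) E)
  | coAppNil (σ : Store S (JVal S)) (v : JVal S) (E : JCtx S) :
      JStep δ msg alloc (.co σ v (.appFun [] :: E)) (.ap σ (.app (.val v) []) E)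
  | coApp (σ : Store S (JVal S)) (v : JVal S) (c : JClo S) (ds : List (JClo S)) (E : JCtx S) :
      JStep δ msg alloc (.co σ v (.appFun (c :: ds) :: E)) (.ev σ c (.appArg v [] ds :: E))
  | coArgLast (σ : Store S (JVal S)) (v t : JVal S) (us : List (JVal S)) (E : JCtx S) :
      JStep δ msg alloc (.co σ v (.appArg t us [] :: E))
        (.ap σ (.app (.val t) ((us ++ [v]).map .val)) E)
  | coArg (σ : Store S (JVal S)) (v t : JVal S) (us : List (JVal S)) (c : JClo S)
      (ds : List (JClo S)) (E : JCtx S) :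
      JStep δ msg alloc (.co σ v (.appArg t us (c :: ds) :: E))
        (.ev σ c (.appArg t (us ++ [v]) ds :: E))
  | coRecordLast (σ : Store S (JVal S)) (v : JVal S) (us : List (String × JVal S)) (s : String)
      (E : JCtx S) :
      JStep δ msg alloc (.co σ v (.recordF us s [] :: E)) (.co σ (.record (us ++ [(s, v)])) E)
  | coRecord (σ : Store S (JVal S)) (v : JVal S) (us : List (String × JVal S)) (s s' : String)
      (c : JClo S) (ds : List (String × JClo S)) (E : JCtx S) :
      JStep δ msg alloc (.co σ v (.recordF us s ((s', c) :: ds) :: E))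
        (.ev σ c (.recordF (us ++ [(s, v)]) s' ds :: E))
  | coGetL (σ : Store S (JVal S)) (v : JVal S) (c : JClo S) (E : JCtx S) :
      JStep δ msg alloc (.co σ v (.getL c :: E)) (.ev σ c (.getR v :: E))
  | coGetR (σ : Store S (JVal S)) (v u : JVal S) (E : JCtx S) :
      JStep δ msg alloc (.co σ v (.getR u :: E)) (.ap σ (.get (.val u) (.val v)) E)
  | coSetL (σ : Store S (JVal S)) (v : JVal S) (c d : JClo S) (E : JCtx S) :
      JStep δ msg alloc (.co σ v (.setL c d :: E)) (.ev σ c (.setM v d :: E))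
  | coSetM (σ : Store S (JVal S)) (v u : JVal S) (c : JClo S) (E : JCtx S) :
      JStep δ msg alloc (.co σ v (.setM u c :: E)) (.ev σ c (.setR u v :: E))
  | coSetR (σ : Store S (JVal S)) (v u t : JVal S) (E : JCtx S) :
      JStep δ msg alloc (.co σ v (.setR u t :: E)) (.ap σ (.set (.val u) (.val t) (.val v)) E)
  | coDelL (σ : Store S (JVal S)) (v : JVal S) (c : JClo S) (E : JCtx S) :
      JStep δ msg alloc (.co σ v (.delL c :: E)) (.ev σ c (.delR v :: E))
  | coDelR (σ : Store S (JVal S)) (v u : JVal S) (E : JCtx S) :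
      JStep δ msg alloc (.co σ v (.delR u :: E)) (.ap σ (.del (.val u) (.val v)) E)
  | coRef (σ : Store S (JVal S)) (v : JVal S) (E : JCtx S) :
      JStep δ msg alloc (.co σ v (.refF :: E)) (.ap σ (.ref (.val v)) E)
  | coDeref (σ : Store S (JVal S)) (v : JVal S) (E : JCtx S) :
      JStep δ msg alloc (.co σ v (.derefF :: E)) (.ap σ (.deref (.val v)) E)
  | coAssignL (σ : Store S (JVal S)) (v : JVal S) (c : JClo S) (E : JCtx S) :
      JStep δ msg alloc (.co σ v (.assignL c :: E)) (.ev σ c (.assignR v :: E))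
  | coAssignR (σ : Store S (JVal S)) (v u : JVal S) (E : JCtx S) :
      JStep δ msg alloc (.co σ v (.assignR u :: E)) (.ap σ (.assign (.val u) (.val v)) E)
  | coIte (σ : Store S (JVal S)) (v : JVal S) (c d : JClo S) (E : JCtx S) :
      JStep δ msg alloc (.co σ v (.iteF c d :: E)) (.ap σ (.ite (.val v) c d) E)
  | coSeq (σ : Store S (JVal S)) (v : JVal S) (c : JClo S) (E : JCtx S) :
      JStep δ msg alloc (.co σ v (.seqF c :: E)) (.ev σ c E)
  | coThrow (σ : Store S (JVal S)) (v : JVal S) (E : JCtx S) :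
      JStep δ msg alloc (.co σ v (.throwF :: E)) (.ap σ (.throw (.val v)) E)
  | coBrk (σ : Store S (JVal S)) (v : JVal S) (l : S.Lab) (E : JCtx S) :
      JStep δ msg alloc (.co σ v (.brkF l :: E)) (.ap σ (.brk l (.val v)) E)
  | coOpLast (σ : Store S (JVal S)) (v : JVal S) (o : S.Op) (us : List (JVal S)) (E : JCtx S) :
      JStep δ msg alloc (.co σ v (.opF o us [] :: E)) (.ap σ (.op o ((us ++ [v]).map .val)) E)
  | coOp (σ : Store S (JVal S)) (v : JVal S) (o : S.Op) (us : List (JVal S)) (c : JClo S)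
      (ds : List (JClo S)) (E : JCtx S) :
      JStep δ msg alloc (.co σ v (.opF o us (c :: ds) :: E)) (.ev σ c (.opF o (us ++ [v]) ds :: E))
  | coCatch (σ : Store S (JVal S)) (v : JVal S) (x : S.Var) (c : JClo S) (E : JCtx S) :
      JStep δ msg alloc (.co σ v (.catchF x c :: E)) (.co σ v E)
  | coFinally (σ : Store S (JVal S)) (v : JVal S) (c : JClo S) (E : JCtx S) :
      JStep δ msg alloc (.co σ v (.finallyF c :: E)) (.ev σ (.seq c (.val v)) E)
  | coLabel (σ : Store S (JVal S)) (v : JVal S) (l : S.Lab) (E : JCtx S) :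
      JStep δ msg alloc (.co σ v (.labelF l :: E)) (.co σ v E)
  -- apply
  | apVar (σ : Store S (JVal S)) (x : S.Var) (ρ : JEnv S) (E : JCtx S) (a : S.Addr) (v : JVal S) :
      List.lookup x ρ = some a → v ∈ fetch σ a →
      JStep δ msg alloc (.ap σ (.clos (.var x) ρ) E) (.co σ v E)
  | apLet (σ : Store S (JVal S)) (x : S.Var) (v : JVal S) (e : Exp S) (ρ : JEnv S) (E : JCtx S)
      (a : S.Addr) : alloc (.ap σ (.letE x (.val v) (.clos e ρ)) E) 1 = [a] →
      JStep δ msg alloc (.ap σ (.letE x (.val v) (.clos e ρ)) E)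
        (.ev (put σ [a] [v]) (.clos e ((x, a) :: ρ)) E)
  | apApp (σ : Store S (JVal S)) (xs : List S.Var) (e : Exp S) (ρ : JEnv S) (vs : List (JVal S))
      (E : JCtx S) (as : List S.Addr) : xs.length = vs.length →
      alloc (.ap σ (.app (.val (.fn (⟨xs, e⟩, ρ))) (vs.map .val)) E) xs.length = as →
      JStep δ msg alloc (.ap σ (.app (.val (.fn (⟨xs, e⟩, ρ))) (vs.map .val)) E)
        (.ev (put σ as vs) (.clos e (xs.zip as ++ ρ)) E)
  | apGet (σ : Store S (JVal S)) (fs fs' : List (String × JVal S)) (s : String) (v : JVal S)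
      (E : JCtx S) :
      JStep δ msg alloc
        (.ap σ (.get (.val (.record (fs ++ (s, v) :: fs'))) (.val (.const (.str s)))) E)
        (.co σ v E)
  | apGetNone (σ : Store S (JVal S)) (fs : List (String × JVal S)) (s : String) (E : JCtx S) :
      s ∉ fs.map Prod.fst →
      JStep δ msg alloc (.ap σ (.get (.val (.record fs)) (.val (.const (.str s)))) E)
        (.co σ (.const .undef) E)
  | apSet (σ : Store S (JVal S)) (fs fs' : List (String × JVal S)) (s : String) (u v : JVal S)
      (E : JCtx S) :
      JStep δ msg alloc
        (.ap σ (.set (.val (.record (fs ++ (s, u) :: fs'))) (.val (.const (.str s))) (.val v)) E)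
        (.co σ (.record (fs ++ (s, v) :: fs')) E)
  | apSetNew (σ : Store S (JVal S)) (fs : List (String × JVal S)) (s : String) (v : JVal S)
      (E : JCtx S) : s ∉ fs.map Prod.fst →
      JStep δ msg alloc (.ap σ (.set (.val (.record fs)) (.val (.const (.str s))) (.val v)) E)
        (.co σ (.record ((s, v) :: fs)) E)
  | apDel (σ : Store S (JVal S)) (fs fs' : List (String × JVal S)) (s : String) (u : JVal S)
      (E : JCtx S) :
      JStep δ msg alloc
        (.ap σ (.del (.val (.record (fs ++ (s, u) :: fs'))) (.val (.const (.str s)))) E)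
        (.co σ (.record (fs ++ fs')) E)
  | apDelNone (σ : Store S (JVal S)) (fs : List (String × JVal S)) (s : String) (E : JCtx S) :
      s ∉ fs.map Prod.fst →
      JStep δ msg alloc (.ap σ (.del (.val (.record fs)) (.val (.const (.str s)))) E)
        (.co σ (.record fs) E)
  | apIteTrue (σ : Store S (JVal S)) (c d : JClo S) (E : JCtx S) :
      JStep δ msg alloc (.ap σ (.ite (.val (.const (.bool true))) c d) E) (.ev σ c E)
  | apIteFalse (σ : Store S (JVal S)) (c d : JClo S) (E : JCtx S) :
      JStep δ msg alloc (.ap σ (.ite (.val (.const (.bool false))) c d) E) (.ev σ d E)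
  | apOp (σ : Store S (JVal S)) (o : S.Op) (vs : List (JVal S)) (E : JCtx S) (r : PVal S Empty) :
      δ o (vs.map skeleton) = .ok r →
      JStep δ msg alloc (.ap σ (.op o (vs.map .val)) E) (.co σ (ofData r) E)
  | apOpError (σ : Store S (JVal S)) (o : S.Op) (vs : List (JVal S)) (E : JCtx S)
      (r : PVal S Empty) : δ o (vs.map skeleton) = .error r →
      JStep δ msg alloc (.ap σ (.op o (vs.map .val)) E) (.ap σ (.throw (.val (ofData r))) E)
  | apRef (σ : Store S (JVal S)) (v : JVal S) (E : JCtx S) (a : S.Addr) :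
      alloc (.ap σ (.ref (.val v)) E) 1 = [a] →
      JStep δ msg alloc (.ap σ (.ref (.val v)) E) (.co (put σ [a] [v]) (.addr a) E)
  | apDeref (σ : Store S (JVal S)) (a : S.Addr) (E : JCtx S) (v : JVal S) : v ∈ fetch σ a →
      JStep δ msg alloc (.ap σ (.deref (.val (.addr a))) E) (.co σ v E)
  | apAssign (σ : Store S (JVal S)) (a : S.Addr) (v : JVal S) (E : JCtx S) :
      JStep δ msg alloc (.ap σ (.assign (.val (.addr a)) (.val v)) E) (.co (put σ [a] [v]) v E)
  | apFault (σ : Store S (JVal S)) (c : JClo S) (k : RuntimeError) (E : JCtx S) : Fault c k →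
      JStep δ msg alloc (.ap σ c E) (.ap σ (.throw (.val (errVal msg k))) E)
  | apThrowNil (σ : Store S (JVal S)) (v : JVal S) :
      JStep δ msg alloc (.ap σ (.throw (.val v)) []) (.ans (.error σ v))
  | apThrowCatch (σ : Store S (JVal S)) (v : JVal S) (x : S.Var) (e : Exp S) (ρ : JEnv S)
      (E : JCtx S) (a : S.Addr) :
      alloc (.ap σ (.throw (.val v)) (.catchF x (.clos e ρ) :: E)) 1 = [a] →
      JStep δ msg alloc (.ap σ (.throw (.val v)) (.catchF x (.clos e ρ) :: E))
        (.ev (put σ [a] [v]) (.clos e ((x, a) :: ρ)) E)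
  | apThrowFinally (σ : Store S (JVal S)) (v : JVal S) (c : JClo S) (E : JCtx S) :
      JStep δ msg alloc (.ap σ (.throw (.val v)) (.finallyF c :: E))
        (.ev σ (.seq c (.throw (.val v))) E)
  | apThrowLabel (σ : Store S (JVal S)) (v : JVal S) (l : S.Lab) (E : JCtx S) :
      JStep δ msg alloc (.ap σ (.throw (.val v)) (.labelF l :: E)) (.ap σ (.throw (.val v)) E)
  | apThrowLocal (σ : Store S (JVal S)) (v : JVal S) (F : Frame S (JClo S) (JVal S)) (E : JCtx S) :
      F.IsLocal →
      JStep δ msg alloc (.ap σ (.throw (.val v)) (F :: E)) (.ap σ (.throw (.val v)) E)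
  | apBrkNil (σ : Store S (JVal S)) (l : S.Lab) (v : JVal S) :
      JStep δ msg alloc (.ap σ (.brk l (.val v)) [])
        (.ap σ (.throw (.val (errVal msg .unmatchedBreak))) [])
  | apBrkCatch (σ : Store S (JVal S)) (l : S.Lab) (v : JVal S) (x : S.Var) (c : JClo S)
      (E : JCtx S) :
      JStep δ msg alloc (.ap σ (.brk l (.val v)) (.catchF x c :: E)) (.ev σ (.brk l (.val v)) E)
  | apBrkFinally (σ : Store S (JVal S)) (l : S.Lab) (v : JVal S) (c : JClo S) (E : JCtx S) :
      JStep δ msg alloc (.ap σ (.brk l (.val v)) (.finallyF c :: E))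
        (.ev σ (.seq c (.brk l (.val v))) E)
  | apBrkLabel (σ : Store S (JVal S)) (l : S.Lab) (v : JVal S) (E : JCtx S) :
      JStep δ msg alloc (.ap σ (.brk l (.val v)) (.labelF l :: E)) (.co σ v E)
  | apBrkOther (σ : Store S (JVal S)) (l l' : S.Lab) (v : JVal S) (E : JCtx S) : l' ≠ l →
      JStep δ msg alloc (.ap σ (.brk l (.val v)) (.labelF l' :: E)) (.ap σ (.brk l (.val v)) E)
  | apBrkLocal (σ : Store S (JVal S)) (l : S.Lab) (v : JVal S) (F : Frame S (JClo S) (JVal S))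
      (E : JCtx S) : F.IsLocal →
      JStep δ msg alloc (.ap σ (.brk l (.val v)) (F :: E)) (.ap σ (.brk l (.val v)) E)

/-- The initial state: empty store, the program with the empty environment, empty stack. -/
def injJAM (e : Exp S) : JState S := .ev ∅ (.clos e []) []

/-- The machine, started on the program `e`, reaches the answer `A`. -/
def JAMEval (δ : Delta S) (msg : RuntimeError → String) (alloc : Alloc S) (e : Exp S)
    (A : Answer S (JVal S)) : Prop :=
  Relation.ReflTransGen (JStep δ msg alloc) (injJAM e) (.ans A)

end Machine

/-! ### Comparing answers -/

section Compare
variable {S : Sig}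

mutual
/-- The function `U`, which forces all delayed substitutions of a value. -/
def forceVal : PVal S (Fun S × REnv S) → SynVal S
  | .const k => .const k
  | .addr a => .addr a
  | .fn (f, ρ) => .fn ⟨f.params, f.body.subst ((Sub.ofList (forceEnv ρ)).hide f.params)⟩
  | .record fs => .record (forceFields fs)
def forceFields : List (String × PVal S (Fun S × REnv S)) → List (String × SynVal S)
  | [] => []
  | (s, v) :: fs => (s, forceVal v) :: forceFields fs
def forceEnv : REnv S → List (S.Var × SynVal S)
  | .mk l => forceBindings l
def forceBindings : List (S.Var × PVal S (Fun S × REnv S)) → List (S.Var × SynVal S)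
  | [] => []
  | (x, v) :: l => (x, forceVal v) :: forceBindings l
end

/-- `U` on stores, as a relation. -/
def ForcesStore (σ : Store S (RVal S)) (τ : Store S (SynVal S)) : Prop :=
  ∀ a, τ.lookup a = (σ.lookup a).map forceVal

/-- `Forces B A` says `A = U(B)`. -/
inductive Forces : Answer S (RVal S) → Answer S (SynVal S) → Prop
  | value (σ : Store S (RVal S)) (τ : Store S (SynVal S)) (v : RVal S) :
      ForcesStore σ τ → Forces (.value σ v) (.value τ (forceVal v))
  | error (σ : Store S (RVal S)) (τ : Store S (SynVal S)) (v : RVal S) :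
      ForcesStore σ τ → Forces (.error σ v) (.error τ (forceVal v))

mutual
/-- `SameVal π τ v w`: the value `v` of the calculus and the machine value `w` in the store `τ` are the
same, up to the renaming `π` of addresses and the store indirection in machine environments: where
the environment of `v` holds a value, that of `w` holds an address at which `τ` has this value. -/
inductive SameVal (π : Equiv.Perm S.Addr) (τ : Store S (JVal S)) : RVal S → JVal S → Prop
  | const (k : Const S) : SameVal π τ (.const k) (.const k)
  | addr (a : S.Addr) : SameVal π τ (.addr a) (.addr (π a))
  | fn (f : Fun S) (ρ : REnv S) (η : JEnv S) :
      (∀ x, (ρ.lookup x).isSome ↔ (List.lookup x η).isSome) →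
      (∀ x a, List.lookup x η = some a → (τ.lookup a).isSome) →
      (∀ x v a w, ρ.lookup x = some v → List.lookup x η = some a → τ.lookup a = some w →
        SameVal π τ v w) →
      SameVal π τ (.fn (f, ρ)) (.fn (f, η))
  | record (fs : List (String × RVal S)) (gs : List (String × JVal S)) :
      SameFields π τ fs gs → SameVal π τ (.record fs) (.record gs)
inductive SameFields (π : Equiv.Perm S.Addr) (τ : Store S (JVal S)) :
    List (String × RVal S) → List (String × JVal S) → Prop
  | nil : SameFields π τ [] []
  | cons (s : String) (v : RVal S) (w : JVal S) (fs : List (String × RVal S))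
      (gs : List (String × JVal S)) :
      SameVal π τ v w → SameFields π τ fs gs → SameFields π τ ((s, v) :: fs) ((s, w) :: gs)
end

/-- Every cell of `σ` is present, under its new name, in the machine store `τ` with the same contents.
(The machine store also holds the variable bindings.) -/
def SameStore (π : Equiv.Perm S.Addr) (σ : Store S (RVal S)) (τ : Store S (JVal S)) : Prop :=
  ∀ a v, σ.lookup a = some v → ∃ w, τ.lookup (π a) = some w ∧ SameVal π τ v w

/-- An answer of the calculus of explicit substitutions and a machine answer are the same, up to the
names of addresses and the representation of environments. -/
inductive SameAnswer : Answer S (RVal S) → Answer S (JVal S) → Prop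
  | value (π : Equiv.Perm S.Addr) (σ : Store S (RVal S)) (τ : Store S (JVal S)) (v : RVal S)
      (w : JVal S) : SameStore π σ τ → SameVal π τ v w → SameAnswer (.value σ v) (.value τ w)
  | error (π : Equiv.Perm S.Addr) (σ : Store S (RVal S)) (τ : Store S (JVal S)) (v : RVal S)
      (w : JVal S) : SameStore π σ τ → SameVal π τ v w → SameAnswer (.error σ v) (.error τ w)

/-- The same for an answer of the substitution calculus: it is `U(B)` for an answer `B` that is the
same as the machine answer. -/
def SameSubAnswer (A : Answer S (SynVal S)) (C : Answer S (JVal S)) : Prop :=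
  ∃ B : Answer S (RVal S), Forces B A ∧ SameAnswer B C

end Compare

end JSCalc

-- The calculus of explicit substitutions lies between the other two systems. The proof consists of
-- four simulations, one in each direction on either side of it: `jamEval_of_rhoEval` and
-- `rhoEval_of_jamEval` towards the machine, `subEval_of_rhoEval` and `rhoEval_of_subEval` towards
-- the substitution calculus. The claim about the substitution calculus and the machine follows by
-- composing them.
--
-- Closures and the machine. Addresses cannot be compared literally: both sides choose names freely,
-- and the machine spends addresses on variables as well. A growing `World` records which machine
-- address stands for which reference cell and which one holds the value of a variable. Relative to
-- a world, closures correspond structurally, and environments correspond when the address of each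
-- variable is recorded with its value. The invariant `StoreRel` says that the cells are matched one
-- to one, that recorded addresses hold related contents, and that cells and variables are disjoint.
-- It survives binding, allocation and assignment; in particular an assignment can only name a cell,
-- so variables never change. The program mentions no address, so code is literally the same on both
-- sides. For primitive operators, the finite matching of cells extends to a permutation,
-- equivariance transports the result, and a freshness argument (`Delta.Equivariant.addrs_subset`)
-- shows that the result mentions no address that the arguments do not. That argument needs
-- infinitely many addresses, which a valid allocator forces.
--
-- The transitions that only move the focus of the machine form a deterministic partial function
-- `nav`, and they do not change the term obtained by plugging the focus into the stack. The other
-- transitions contract a redex, halt, or treat a control effect. Towards the machine, a state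
-- represents a term if it lies on the navigation path that starts with the evaluation of that term.
-- Whatever decomposition a step of the calculus uses, its redex is an end point of this path
-- (`nav_plug`, `NavStar.to_normal`), so no unique decomposition theorem is needed. In the other
-- direction the term is read back from the state; the one discrepancy is that during a control
-- effect the machine has already dropped local frames that the calculus still has (`LoadRel`).
--
-- Closures and substitution. A closure corresponds to the expression in which its delayed
-- substitutions have been carried out (`ForceRel`), with the same names of addresses on both sides.
-- All substituted values are closed, so substitutions compose, and binding parameters in an
-- environment amounts to substituting for them (`Scoped.subst_extend`). Propagation, variable
-- lookup and the completion of record values are invisible after forcing. Conversely, a closure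
-- related to an expression with a redex in a context can be reduced until it shows a related
-- context and redex (`exists_cstar_plug`). Control effects pass one control frame at a time in one
-- calculus and jump in the other. Towards the substitution calculus the expression is allowed to
-- lag behind, keeping the frames already passed (`ForceRel True`); in the other direction a jump is
-- unrolled into several steps and the relation needs no slack (`ForceRel False`).

namespace JSCalc

/-! ### Induction principles -/

section Induction
variable {S : Sig}

mutual
-- Values nest themselves inside lists of fields, so the generated recursor has auxiliary motives.
-- This form has a single motive and treats function values as leaves.
theorem PVal.ind {F : Type} {P : PVal S F → Prop} (const : ∀ k, P (.const k))
    (addr : ∀ a, P (.addr a)) (fn : ∀ f, P (.fn f))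
    (record : ∀ fs, (∀ p ∈ fs, P p.2) → P (.record fs)) : ∀ v, P v
  | .const k => const k
  | .addr a => addr a
  | .fn f => fn f
  | .record fs => record fs (PVal.indFields const addr fn record fs)
theorem PVal.indFields {F : Type} {P : PVal S F → Prop} (const : ∀ k, P (.const k))
    (addr : ∀ a, P (.addr a)) (fn : ∀ f, P (.fn f))
    (record : ∀ fs, (∀ p ∈ fs, P p.2) → P (.record fs)) : ∀ fs : List (String × PVal S F),
    ∀ p ∈ fs, P p.2
  | [], _, h => by cases h
  | (s, v) :: fs, p, h => by
    rcases List.mem_cons.1 h with rfl | h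
    · exact PVal.ind const addr fn record v
    · exact PVal.indFields const addr fn record fs p h
end

theorem mem_of_lookup {α β : Type} [DecidableEq α] {x : α} {v : β} :
    ∀ {l : List (α × β)}, List.lookup x l = some v → (x, v) ∈ l
  | [], h => by simp at h
  | (y, w) :: l, h => by
    rw [List.lookup_cons] at h
    split at h
    · rename_i e
      simp only [beq_iff_eq] at e
      cases h; subst e; simp
    · exact List.mem_cons_of_mem _ (mem_of_lookup h)

mutual
/-- Induction on values with environments that descends into the environments. -/
theorem RVal.ind {P : RVal S → Prop} (const : ∀ k, P (.const k))
    (addr : ∀ a, P (.addr a))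
    (fn : ∀ f (ρ : REnv S), (∀ x v, ρ.lookup x = some v → P v) → P (.fn (f, ρ)))
    (record : ∀ fs, (∀ p ∈ fs, P p.2) → P (.record fs)) : ∀ v, P v
  | .const k => const k
  | .addr a => addr a
  | .fn (f, .mk l) => fn f (.mk l) fun x v h =>
      RVal.indBindings const addr fn record l (x, v) (mem_of_lookup h)
  | .record fs => record fs (RVal.indFields const addr fn record fs)
theorem RVal.indFields {P : RVal S → Prop} (const : ∀ k, P (.const k))
    (addr : ∀ a, P (.addr a))
    (fn : ∀ f (ρ : REnv S), (∀ x v, ρ.lookup x = some v → P v) → P (.fn (f, ρ)))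
    (record : ∀ fs, (∀ p ∈ fs, P p.2) → P (.record fs)) :
    ∀ fs : List (String × PVal S (Fun S × REnv S)), ∀ p ∈ fs, P p.2
  | [], _, h => by cases h
  | (s, v) :: fs, p, h => by
    rcases List.mem_cons.1 h with rfl | h
    · exact RVal.ind const addr fn record v
    · exact RVal.indFields const addr fn record fs p h
theorem RVal.indBindings {P : RVal S → Prop} (const : ∀ k, P (.const k))
    (addr : ∀ a, P (.addr a))
    (fn : ∀ f (ρ : REnv S), (∀ x v, ρ.lookup x = some v → P v) → P (.fn (f, ρ)))
    (record : ∀ fs, (∀ p ∈ fs, P p.2) → P (.record fs)) :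
    ∀ l : List (S.Var × PVal S (Fun S × REnv S)), ∀ p ∈ l, P p.2
  | [], _, h => by cases h
  | (s, v) :: fs, p, h => by
    rcases List.mem_cons.1 h with rfl | h
    · exact RVal.ind const addr fn record v
    · exact RVal.indBindings const addr fn record fs p h
end

end Induction

/-! ### Renaming of values -/

section Renaming
variable {S : Sig} {F G : Type}

theorem PVal.mapFields_eq (g : S.Addr → S.Addr) (f : F → G) (fs : List (String × PVal S F)) :
    PVal.mapFields g f fs = fs.map fun p => (p.1, p.2.map g f) := by
  induction fs with
  | nil => simp [PVal.mapFields]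
  | cons p fs ih => obtain ⟨s, v⟩ := p; simp [PVal.mapFields, ih]

mutual
/-- The addresses of a value outside its function values. -/
def PVal.addrList : PVal S F → List S.Addr
  | .const _ => []
  | .addr a => [a]
  | .fn _ => []
  | .record fs => PVal.addrListFields fs
def PVal.addrListFields : List (String × PVal S F) → List S.Addr
  | [] => []
  | (_, v) :: fs => v.addrList ++ PVal.addrListFields fs
end

theorem PVal.addrListFields_eq (fs : List (String × PVal S F)) :
    PVal.addrListFields fs = fs.flatMap fun p => p.2.addrList := by
  induction fs with
  | nil => simp [PVal.addrListFields]
  | cons p fs ih => obtain ⟨s, v⟩ := p; simp [PVal.addrListFields, ih]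

theorem PVal.map_congr {g g' : S.Addr → S.Addr} {f : F → G} (v : PVal S F) :
    (∀ a ∈ v.addrList, g a = g' a) → v.map g f = v.map g' f := by
  induction v using PVal.ind with
  | const k => simp [PVal.map]
  | addr a => simp [PVal.map, PVal.addrList]
  | fn p => simp [PVal.map]
  | record fs ih =>
    simp only [PVal.map, PVal.addrList, PVal.mapFields_eq, PVal.addrListFields_eq, List.mem_flatMap,
      PVal.record.injEq]
    intro h
    refine List.map_congr_left fun p hp => ?_
    rw [ih p hp fun a ha => h a ⟨p, hp, ha⟩]

theorem PVal.map_id (v : PVal S F) : v.map id id = v := by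
  induction v using PVal.ind with
  | const k => simp [PVal.map]
  | addr a => simp [PVal.map]
  | fn p => simp [PVal.map]
  | record fs ih =>
    simp only [PVal.map, PVal.mapFields_eq, PVal.record.injEq]
    conv_rhs => rw [← List.map_id fs]
    exact List.map_congr_left fun p hp => by simp [ih p hp]

theorem PVal.addrList_map (g : S.Addr → S.Addr) (f : F → G) (v : PVal S F) :
    (v.map g f).addrList = v.addrList.map g := by
  induction v using PVal.ind with
  | const k => simp [PVal.map, PVal.addrList]
  | addr a => simp [PVal.map, PVal.addrList]
  | fn p => simp [PVal.map, PVal.addrList]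
  | record fs ih =>
    simp only [PVal.map, PVal.addrList, PVal.mapFields_eq, PVal.addrListFields_eq, List.flatMap_map,
      List.map_flatMap]
    exact List.flatMap_congr fun p hp => ih p hp

/-- A finite partial injection extends to a permutation. -/
theorem exists_perm_extending {α : Type} [DecidableEq α] (f : α → α) (s : Finset α) :
    Set.InjOn f s → ∃ π : Equiv.Perm α, ∀ a ∈ s, π a = f a := by
  induction s using Finset.induction_on with
  | empty => exact fun _ => ⟨1, by simp⟩
  | insert a s ha ih =>
    intro hf
    obtain ⟨π, hπ⟩ := ih (hf.mono (by simp))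
    -- The swap corrects the image of the new point and moves no earlier image: `π x` differs from
    -- `π a` because `π` is injective, and from `f a` because `f` is injective on the enlarged set.
    refine ⟨π.trans (Equiv.swap (π a) (f a)), fun x hx => ?_⟩
    rcases Finset.mem_insert.1 hx with rfl | hx
    · simp
    · have hxa : x ≠ a := fun h => ha (h ▸ hx)
      simp only [Equiv.trans_apply]
      rw [Equiv.swap_apply_of_ne_of_ne, hπ x hx]
      · exact fun h => hxa (π.injective h)
      · rw [hπ x hx]
        exact fun h => hxa (hf (by simp [hx]) (by simp) h)

/-- An equivariant `δ` cannot invent addresses. -/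
theorem Delta.Equivariant.addrs_subset [Infinite S.Addr] {δ : Delta S} (hδ : δ.Equivariant)
    {o : S.Op} {vs : List (PVal S Unit)} {r : PVal S Empty}
    (h : δ o vs = .ok r ∨ δ o vs = .error r) {a : S.Addr} (ha : a ∈ r.addrList) :
    ∃ v ∈ vs, a ∈ v.addrList := by
  by_contra hcon
  push Not at hcon
  -- Swapping `a`, which no argument mentions, with an address `c` that occurs nowhere fixes the
  -- arguments, hence by equivariance the result. But the swapped result contains `c`.
  obtain ⟨c, hc⟩ := Infinite.exists_notMem_finset
    (r.addrList ++ vs.flatMap PVal.addrList).toFinset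
  simp only [List.mem_toFinset, List.mem_append, List.mem_flatMap, not_or, not_exists,
    not_and] at hc
  have hvs : vs.map (PVal.map (Equiv.swap a c) id) = vs := by
    conv_rhs => rw [← List.map_id vs]
    refine List.map_congr_left fun v hv => ?_
    rw [id, PVal.map_congr (g' := id), PVal.map_id]
    intro x hx
    refine Equiv.swap_apply_of_ne_of_ne ?_ ?_
    · rintro rfl; exact hcon v hv hx
    · rintro rfl; exact hc.2 v hv hx
  have key := hδ (Equiv.swap a c) o vs
  rw [hvs] at key
  have hr : r.map (Equiv.swap a c) id = r := by
    rcases h with h | h <;> rw [h] at key <;> simpa using key.symm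
  apply hc.1
  rw [← hr, PVal.addrList_map]
  exact List.mem_map.2 ⟨a, ha, by simp⟩

end Renaming

/-! ### Relating the calculus of explicit substitutions and the machine -/

section Relations
variable {S : Sig}

/-- The relation on named components that have the same name and related contents. -/
inductive PairRel {α β : Type} (r : α → β → Prop) : String × α → String × β → Prop
  | mk (s : String) (a : α) (b : β) : r a b → PairRel r (s, a) (s, b)

/-- The correspondence between the addresses of the calculus and of the machine: `cell a b` if the
machine uses `b` for the reference cell `a`, and `bound b v` if it keeps at `b` a variable that
has the value `v` in the calculus. -/
structure World (S : Sig) where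
  cell : S.Addr → S.Addr → Prop
  bound : S.Addr → RVal S → Prop

structure World.Le (W W' : World S) : Prop where
  cell : ∀ a b, W.cell a b → W'.cell a b
  bound : ∀ b v, W.bound b v → W'.bound b v

theorem World.Le.refl (W : World S) : W.Le W := ⟨fun _ _ h => h, fun _ _ h => h⟩

/-- The comparison goes through the world and not through the store, so it is unaffected by
assignments. `Option.Rel` also makes the domains equal. -/
def EnvRel (W : World S) (ρ : REnv S) (η : JEnv S) : Prop :=
  ∀ x, Option.Rel (fun v b => W.bound b v) (ρ.lookup x) (List.lookup x η)

/-- For function values there is no recursive call on the contents of the environment: `bound`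
already names them. The condition on the body excludes literal addresses, which is what allows the
same code on both sides although addresses are renamed. -/
inductive VRel (W : World S) : RVal S → JVal S → Prop
  | const (k : Const S) : VRel W (.const k) (.const k)
  | addr (a b : S.Addr) : W.cell a b → VRel W (.addr a) (.addr b)
  | fn (f : Fun S) (ρ : REnv S) (η : JEnv S) : f.body.addrs = ∅ → EnvRel W ρ η →
      VRel W (.fn (f, ρ)) (.fn (f, η))
  | record (fs : List (String × RVal S)) (gs : List (String × JVal S)) :
      List.Forall₂ (PairRel (VRel W)) fs gs → VRel W (.record fs) (.record gs)

inductive CloRel (W : World S) : RClo S → JClo S → Prop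
  | clos (e : Exp S) (ρ : REnv S) (η : JEnv S) : e.addrs = ∅ → EnvRel W ρ η →
      CloRel W (.clos e ρ) (.clos e η)
  | val (v : RVal S) (w : JVal S) : VRel W v w → CloRel W (.val v) (.val w)
  | record (fs : List (String × RClo S)) (gs : List (String × JClo S)) :
      List.Forall₂ (PairRel (CloRel W)) fs gs → CloRel W (.record fs) (.record gs)
  | letE (x : S.Var) (c d : RClo S) (c' d' : JClo S) : CloRel W c c' → CloRel W d d' →
      CloRel W (.letE x c d) (.letE x c' d')
  | app (c : RClo S) (ds : List (RClo S)) (c' : JClo S) (ds' : List (JClo S)) :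
      CloRel W c c' → List.Forall₂ (CloRel W) ds ds' → CloRel W (.app c ds) (.app c' ds')
  | get (c d : RClo S) (c' d' : JClo S) : CloRel W c c' → CloRel W d d' →
      CloRel W (.get c d) (.get c' d')
  | set (c d e : RClo S) (c' d' e' : JClo S) : CloRel W c c' → CloRel W d d' → CloRel W e e' →
      CloRel W (.set c d e) (.set c' d' e')
  | del (c d : RClo S) (c' d' : JClo S) : CloRel W c c' → CloRel W d d' →
      CloRel W (.del c d) (.del c' d')
  | assign (c d : RClo S) (c' d' : JClo S) : CloRel W c c' → CloRel W d d' →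
      CloRel W (.assign c d) (.assign c' d')
  | ref (c : RClo S) (c' : JClo S) : CloRel W c c' → CloRel W (.ref c) (.ref c')
  | deref (c : RClo S) (c' : JClo S) : CloRel W c c' → CloRel W (.deref c) (.deref c')
  | ite (c d e : RClo S) (c' d' e' : JClo S) : CloRel W c c' → CloRel W d d' → CloRel W e e' →
      CloRel W (.ite c d e) (.ite c' d' e')
  | seq (c d : RClo S) (c' d' : JClo S) : CloRel W c c' → CloRel W d d' →
      CloRel W (.seq c d) (.seq c' d')
  | while (c d : RClo S) (c' d' : JClo S) : CloRel W c c' → CloRel W d d' →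
      CloRel W (.while c d) (.while c' d')
  | label (l : S.Lab) (c : RClo S) (c' : JClo S) : CloRel W c c' →
      CloRel W (.label l c) (.label l c')
  | brk (l : S.Lab) (c : RClo S) (c' : JClo S) : CloRel W c c' → CloRel W (.brk l c) (.brk l c')
  | tryCatch (c : RClo S) (x : S.Var) (d : RClo S) (c' d' : JClo S) : CloRel W c c' →
      CloRel W d d' → CloRel W (.tryCatch c x d) (.tryCatch c' x d')
  | tryFinally (c d : RClo S) (c' d' : JClo S) : CloRel W c c' → CloRel W d d' →
      CloRel W (.tryFinally c d) (.tryFinally c' d')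
  | throw (c : RClo S) (c' : JClo S) : CloRel W c c' → CloRel W (.throw c) (.throw c')
  | op (o : S.Op) (ds : List (RClo S)) (ds' : List (JClo S)) :
      List.Forall₂ (CloRel W) ds ds' → CloRel W (.op o ds) (.op o ds')

/-- Frames related componentwise; `rb` relates the components under a binder. -/
inductive FrameRel {T T' V V' : Type} (rt : T → T' → Prop) (rb : S.Var → T → T' → Prop)
    (rv : V → V' → Prop) : Frame S T V → Frame S T' V' → Prop
  | letF (x : S.Var) (d : T) (d' : T') : rb x d d' → FrameRel rt rb rv (.letF x d) (.letF x d')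
  | appFun (ds : List T) (ds' : List T') : List.Forall₂ rt ds ds' →
      FrameRel rt rb rv (.appFun ds) (.appFun ds')
  | appArg (v : V) (v' : V') (vs : List V) (vs' : List V') (ds : List T) (ds' : List T') :
      rv v v' → List.Forall₂ rv vs vs' → List.Forall₂ rt ds ds' →
      FrameRel rt rb rv (.appArg v vs ds) (.appArg v' vs' ds')
  | recordF (vs : List (String × V)) (vs' : List (String × V')) (s : String)
      (ds : List (String × T)) (ds' : List (String × T')) :
      List.Forall₂ (PairRel rv) vs vs' → List.Forall₂ (PairRel rt) ds ds' →
      FrameRel rt rb rv (.recordF vs s ds) (.recordF vs' s ds')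
  | opF (o : S.Op) (vs : List V) (vs' : List V') (ds : List T) (ds' : List T') :
      List.Forall₂ rv vs vs' → List.Forall₂ rt ds ds' →
      FrameRel rt rb rv (.opF o vs ds) (.opF o vs' ds')
  | getL (d : T) (d' : T') : rt d d' → FrameRel rt rb rv (.getL d) (.getL d')
  | getR (v : V) (v' : V') : rv v v' → FrameRel rt rb rv (.getR v) (.getR v')
  | setL (d e : T) (d' e' : T') : rt d d' → rt e e' → FrameRel rt rb rv (.setL d e) (.setL d' e')
  | setM (v : V) (v' : V') (e : T) (e' : T') : rv v v' → rt e e' →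
      FrameRel rt rb rv (.setM v e) (.setM v' e')
  | setR (v u : V) (v' u' : V') : rv v v' → rv u u' → FrameRel rt rb rv (.setR v u) (.setR v' u')
  | delL (d : T) (d' : T') : rt d d' → FrameRel rt rb rv (.delL d) (.delL d')
  | delR (v : V) (v' : V') : rv v v' → FrameRel rt rb rv (.delR v) (.delR v')
  | refF : FrameRel rt rb rv .refF .refF
  | derefF : FrameRel rt rb rv .derefF .derefF
  | assignL (d : T) (d' : T') : rt d d' → FrameRel rt rb rv (.assignL d) (.assignL d')
  | assignR (v : V) (v' : V') : rv v v' → FrameRel rt rb rv (.assignR v) (.assignR v')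
  | iteF (d e : T) (d' e' : T') : rt d d' → rt e e' → FrameRel rt rb rv (.iteF d e) (.iteF d' e')
  | seqF (d : T) (d' : T') : rt d d' → FrameRel rt rb rv (.seqF d) (.seqF d')
  | throwF : FrameRel rt rb rv .throwF .throwF
  | brkF (l : S.Lab) : FrameRel rt rb rv (.brkF l) (.brkF l)
  | catchF (x : S.Var) (d : T) (d' : T') : rb x d d' →
      FrameRel rt rb rv (.catchF x d) (.catchF x d')
  | finallyF (d : T) (d' : T') : rt d d' → FrameRel rt rb rv (.finallyF d) (.finallyF d')
  | labelF (l : S.Lab) : FrameRel rt rb rv (.labelF l) (.labelF l)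

/-- Components under a binder are treated here like all others. The separate slot of `FrameRel`
serves the comparison with the substitution calculus, where a binder hides part of a substitution.
-/
abbrev FRel (W : World S) : Frame S (RClo S) (RVal S) → Frame S (JClo S) (JVal S) → Prop :=
  FrameRel (CloRel W) (fun _ => CloRel W) (VRel W)

abbrev CtxRel (W : World S) : RCtx S → JCtx S → Prop := List.Forall₂ (FRel W)

section FrameKinds
variable {T T' V V' : Type} {rt : T → T' → Prop} {rb : S.Var → T → T' → Prop} {rv : V → V' → Prop}
  {F : Frame S T V} {F' : Frame S T' V'}

theorem FrameRel.isLocal_iff (h : FrameRel rt rb rv F F') : F.IsLocal ↔ F'.IsLocal := by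
  cases h <;> simp [Frame.IsLocal]

theorem FrameRel.isLabel_iff (h : FrameRel rt rb rv F F') : F.IsLabel ↔ F'.IsLabel := by
  cases h <;> simp [Frame.IsLabel]

theorem FrameRel.isCatch_iff (h : FrameRel rt rb rv F F') : F.IsCatch ↔ F'.IsCatch := by
  cases h <;> simp [Frame.IsCatch]

theorem isLocal_of_forall₂ {C : Ctx S T V} {C' : Ctx S T' V'}
    (h : List.Forall₂ (FrameRel rt rb rv) C C') : C.IsLocal ↔ C'.IsLocal := by
  induction h with
  | nil => simp [Ctx.IsLocal]
  | cons h _ ih =>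
    simp only [Ctx.IsLocal, List.mem_cons, forall_eq_or_imp] at ih ⊢
    rw [h.isLocal_iff, ih]

end FrameKinds

/-! Monotonicity in the world. -/

/-- Membership in the first list is kept because the induction hypotheses for nested types are
available only for members. -/
theorem forall₂_imp_mem {α β : Type} {r r' : α → β → Prop} {l : List α} {m : List β}
    (h : List.Forall₂ r l m) (H : ∀ a ∈ l, ∀ b, r a b → r' a b) : List.Forall₂ r' l m := by
  induction h with
  | nil => exact .nil
  | cons h _ ih =>
    exact .cons (H _ (by simp) _ h) (ih fun a ha => H a (by simp [ha]))

theorem pairRel_imp {α β : Type} {r r' : α → β → Prop} {p : String × α} {q : String × β}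
    (h : PairRel r p q) (H : ∀ b, r p.2 b → r' p.2 b) : PairRel r' p q := by
  cases h with
  | mk s a b h => exact .mk s a b (H b h)

theorem EnvRel.mono {W W' : World S} (hW : W.Le W') {ρ : REnv S} {η : JEnv S}
    (h : EnvRel W ρ η) : EnvRel W' ρ η := by
  intro x
  have := h x
  revert this
  cases ρ.lookup x <;> cases List.lookup x η <;> intro h <;> cases h
  · exact .none
  · rename_i h; exact .some (hW.bound _ _ h)

/-- Each allocation enlarges the world, while everything related in the old world stays in use. No
induction into environments is needed, since they are related through `bound` alone. -/
theorem VRel.mono {W W' : World S} (hW : W.Le W') {v : RVal S} {w : JVal S} :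
    VRel W v w → VRel W' v w := by
  induction v using PVal.ind generalizing w with
  | const k => intro h; cases h; exact .const k
  | addr a => intro h; cases h with | addr _ b h => exact .addr a b (hW.cell _ _ h)
  | fn f => intro h; cases h with | fn f ρ η h h' => exact .fn f ρ η h (h'.mono hW)
  | record fs ih =>
    intro h; cases h with
    | record _ gs h =>
      exact .record fs gs (forall₂_imp_mem h fun p hp q hq => pairRel_imp hq fun _ => ih p hp)

mutual
theorem CloRel.mono {W W' : World S} (hW : W.Le W') :
    ∀ {c : RClo S} {c' : JClo S}, CloRel W c c' → CloRel W' c c'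
  | .clos e ρ, _, h => by cases h with | clos _ _ η h h' => exact .clos e ρ η h (h'.mono hW)
  | .val v, _, h => by cases h with | val _ w h => exact .val v w (h.mono hW)
  | .record fs, _, h => by
    cases h with | record _ gs h => exact .record fs gs (CloRel.monoFields hW h)
  | .letE _ _ _, _, h => by
    cases h with | letE _ _ _ _ _ h h' => exact .letE _ _ _ _ _ (h.mono hW) (h'.mono hW)
  | .app _ _, _, h => by
    cases h with | app _ _ _ _ h h' => exact .app _ _ _ _ (h.mono hW) (CloRel.monoList hW h')
  | .get _ _, _, h => by
    cases h with | get _ _ _ _ h h' => exact .get _ _ _ _ (h.mono hW) (h'.mono hW)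
  | .set _ _ _, _, h => by
    cases h with
    | set _ _ _ _ _ _ h h' h'' =>
      exact .set _ _ _ _ _ _ (h.mono hW) (h'.mono hW) (h''.mono hW)
  | .del _ _, _, h => by
    cases h with | del _ _ _ _ h h' => exact .del _ _ _ _ (h.mono hW) (h'.mono hW)
  | .assign _ _, _, h => by
    cases h with | assign _ _ _ _ h h' => exact .assign _ _ _ _ (h.mono hW) (h'.mono hW)
  | .ref _, _, h => by cases h with | ref _ _ h => exact .ref _ _ (h.mono hW)
  | .deref _, _, h => by cases h with | deref _ _ h => exact .deref _ _ (h.mono hW)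
  | .ite _ _ _, _, h => by
    cases h with
    | ite _ _ _ _ _ _ h h' h'' =>
      exact .ite _ _ _ _ _ _ (h.mono hW) (h'.mono hW) (h''.mono hW)
  | .seq _ _, _, h => by
    cases h with | seq _ _ _ _ h h' => exact .seq _ _ _ _ (h.mono hW) (h'.mono hW)
  | .while _ _, _, h => by
    cases h
    rename_i h h'
    exact .while _ _ _ _ (h.mono hW) (h'.mono hW)
  | .label _ _, _, h => by cases h with | label _ _ _ h => exact .label _ _ _ (h.mono hW)
  | .brk _ _, _, h => by cases h with | brk _ _ _ h => exact .brk _ _ _ (h.mono hW)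
  | .tryCatch _ _ _, _, h => by
    cases h with | tryCatch _ _ _ _ _ h h' => exact .tryCatch _ _ _ _ _ (h.mono hW) (h'.mono hW)
  | .tryFinally _ _, _, h => by
    cases h with | tryFinally _ _ _ _ h h' => exact .tryFinally _ _ _ _ (h.mono hW) (h'.mono hW)
  | .throw _, _, h => by cases h with | throw _ _ h => exact .throw _ _ (h.mono hW)
  | .op _ _, _, h => by cases h with | op _ _ _ h => exact .op _ _ _ (CloRel.monoList hW h)
theorem CloRel.monoList {W W' : World S} (hW : W.Le W') :
    ∀ {cs : List (RClo S)} {cs' : List (JClo S)},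
      List.Forall₂ (CloRel W) cs cs' → List.Forall₂ (CloRel W') cs cs'
  | [], _, h => by cases h; exact .nil
  | _ :: _, _, h => by cases h with | cons h h' => exact .cons (h.mono hW) (CloRel.monoList hW h')
theorem CloRel.monoFields {W W' : World S} (hW : W.Le W') :
    ∀ {cs : List (String × RClo S)} {cs' : List (String × JClo S)},
      List.Forall₂ (PairRel (CloRel W)) cs cs' → List.Forall₂ (PairRel (CloRel W')) cs cs'
  | [], _, h => by cases h; exact .nil
  | (s, c) :: _, _, h => by
    cases h with
    | cons h h' =>
      cases h with
      | mk _ _ b h => exact .cons (.mk s c b (h.mono hW)) (CloRel.monoFields hW h')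
end

theorem vRel_mono_list {W W' : World S} (hW : W.Le W') {vs : List (RVal S)} {ws : List (JVal S)}
    (h : List.Forall₂ (VRel W) vs ws) : List.Forall₂ (VRel W') vs ws :=
  h.imp fun _ _ h => h.mono hW

theorem FRel.mono {W W' : World S} (hW : W.Le W') {F : Frame S (RClo S) (RVal S)}
    {F' : Frame S (JClo S) (JVal S)} (h : FRel W F F') : FRel W' F F' := by
  have hf : ∀ {fs : List (String × RVal S)} {gs : List (String × JVal S)},
      List.Forall₂ (PairRel (VRel W)) fs gs → List.Forall₂ (PairRel (VRel W')) fs gs :=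
    fun h => h.imp fun _ _ h => pairRel_imp h fun _ h => h.mono hW
  have hc : ∀ {c c'}, CloRel W c c' → CloRel W' c c' := fun h => h.mono hW
  have hv : ∀ {c c'}, VRel W c c' → VRel W' c c' := fun h => h.mono hW
  have hcl : ∀ {c c'}, List.Forall₂ (CloRel W) c c' → List.Forall₂ (CloRel W') c c' :=
    fun h => h.imp fun _ _ h => h.mono hW
  cases h <;> constructor <;>
    first
      | exact hc ‹_› | exact hv ‹_› | exact hf ‹_› | exact vRel_mono_list hW ‹_›
      | exact CloRel.monoFields hW ‹_› | exact hcl ‹_›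

theorem CtxRel.mono {W W' : World S} (hW : W.Le W') {E : RCtx S} {E' : JCtx S}
    (h : CtxRel W E E') : CtxRel W' E E' :=
  h.imp fun _ _ h => FRel.mono hW h

end Relations

-- The store invariant and its preservation.

section Stores
variable {S : Sig}

/-- The stores `σ` of the calculus and `τ` of the machine correspond as described by the world. -/
structure StoreRel (W : World S) (σ : Store S (RVal S)) (τ : Store S (JVal S)) : Prop where
  cell : ∀ a b, W.cell a b →
    ∃ v w, σ.lookup a = some v ∧ τ.lookup b = some w ∧ VRel W v w
  dom : ∀ a, a ∈ σ → ∃ b, W.cell a b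
  functional : ∀ a b b', W.cell a b → W.cell a b' → b = b'
  injective : ∀ a a' b, W.cell a b → W.cell a' b → a = a'
  bound : ∀ b v, W.bound b v → ∃ w, τ.lookup b = some w ∧ VRel W v w
  disjoint : ∀ a b v, W.cell a b → ¬ W.bound b v

theorem StoreRel.empty : StoreRel (⟨fun _ _ => False, fun _ _ => False⟩ : World S) ∅ ∅ where
  cell _ _ h := h.elim
  dom _ h := absurd h Finmap.notMem_empty
  functional _ _ _ h := h.elim
  injective _ _ _ h := h.elim
  bound _ _ h := h.elim
  disjoint _ _ _ h := h.elim

theorem mem_of_lookup_eq_some {V : Type} {σ : Store S V} {a : S.Addr} {v : V}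
    (h : σ.lookup a = some v) : a ∈ σ := Finmap.mem_iff.2 ⟨v, h⟩

theorem StoreRel.mem_left {W : World S} {σ : Store S (RVal S)} {τ : Store S (JVal S)}
    (h : StoreRel W σ τ) {a b : S.Addr} (hab : W.cell a b) : a ∈ σ := by
  obtain ⟨v, w, h1, _, _⟩ := h.cell a b hab
  exact mem_of_lookup_eq_some h1

theorem StoreRel.mem_right {W : World S} {σ : Store S (RVal S)} {τ : Store S (JVal S)}
    (h : StoreRel W σ τ) {a b : S.Addr} (hab : W.cell a b) : b ∈ τ := by
  obtain ⟨v, w, _, h1, _⟩ := h.cell a b hab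
  exact mem_of_lookup_eq_some h1

theorem StoreRel.mem_bound {W : World S} {σ : Store S (RVal S)} {τ : Store S (JVal S)}
    (h : StoreRel W σ τ) {b : S.Addr} {v : RVal S} (hab : W.bound b v) : b ∈ τ := by
  obtain ⟨w, h1, _⟩ := h.bound b v hab
  exact mem_of_lookup_eq_some h1

/-- A new variable. -/
theorem StoreRel.bind {W : World S} {σ : Store S (RVal S)} {τ : Store S (JVal S)}
    (h : StoreRel W σ τ) {b : S.Addr} (hb : b ∉ τ) {v : RVal S} {w : JVal S} (hv : VRel W v w) :
    ∃ W' : World S, W.Le W' ∧ StoreRel W' σ (τ.insert b w) ∧ W'.bound b v := by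
  -- Every recorded machine address lies in the domain of `τ`, so the fresh `b` can clash neither
  -- with a cell nor with an earlier variable.
  have hle : W.Le ⟨W.cell, fun b' v' => W.bound b' v' ∨ (b' = b ∧ v' = v)⟩ :=
    ⟨fun _ _ h => h, fun _ _ h => .inl h⟩
  refine ⟨_, hle, ⟨?_, h.dom, h.functional, h.injective, ?_, ?_⟩, .inr ⟨rfl, rfl⟩⟩
  · intro a b' hab
    obtain ⟨v', w', h1, h2, h3⟩ := h.cell a b' hab
    refine ⟨v', w', h1, ?_, h3.mono hle⟩
    rw [Finmap.lookup_insert_of_ne]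
    · exact h2
    · rintro rfl; exact hb (h.mem_right hab)
  · rintro b' v' (hbv | ⟨rfl, rfl⟩)
    · obtain ⟨w', h2, h3⟩ := h.bound b' v' hbv
      refine ⟨w', ?_, h3.mono hle⟩
      rw [Finmap.lookup_insert_of_ne]
      · exact h2
      · rintro rfl; exact hb (h.mem_bound hbv)
    · exact ⟨w, Finmap.lookup_insert _, hv.mono hle⟩
  · rintro a b' v' hab (hbv | ⟨rfl, rfl⟩)
    · exact h.disjoint _ _ _ hab hbv
    · exact hb (h.mem_right hab)

theorem World.Le.trans {W W' W'' : World S} (h : W.Le W') (h' : W'.Le W'') : W.Le W'' :=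
  ⟨fun _ _ x => h'.cell _ _ (h.cell _ _ x), fun _ _ x => h'.bound _ _ (h.bound _ _ x)⟩

/-- New variables, as many as there are values. -/
theorem StoreRel.bindList {σ : Store S (RVal S)} {bs : List S.Addr} :
    ∀ {W : World S} {τ : Store S (JVal S)} {vs : List (RVal S)} {ws : List (JVal S)},
      StoreRel W σ τ → bs.Nodup → (∀ b ∈ bs, b ∉ τ) → List.Forall₂ (VRel W) vs ws →
      bs.length = vs.length →
      ∃ W' : World S, W.Le W' ∧ StoreRel W' σ (put τ bs ws) ∧
        List.Forall₂ (fun v b => W'.bound b v) vs bs := by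
  induction bs with
  | nil =>
    intro W τ vs ws h _ _ hv hl
    cases hv
    · exact ⟨W, .refl W, by simpa [put] using h, .nil⟩
    · simp at hl
  | cons b bs ih =>
    intro W τ vs ws h hn hb hv hl
    cases hv with
    | nil => simp at hl
    | @cons v w vs ws hvw hv =>
      obtain ⟨W₁, hle, hs, hbd⟩ := h.bind (hb b (by simp)) hvw
      -- The remaining variables are bound in the store that already contains `b`. Distinctness of
      -- the addresses keeps them fresh there.
      obtain ⟨W₂, hle', hs', hbd'⟩ := ih (τ := τ.insert b w) hs hn.of_cons
        (by
          intro b' hb' hmem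
          rcases Finmap.mem_insert.1 hmem with rfl | hmem
          · exact (List.nodup_cons.1 hn).1 hb'
          · exact hb b' (by simp [hb']) hmem)
        (vRel_mono_list hle hv) (by simpa using hl)
      exact ⟨W₂, hle.trans hle', by simpa [put] using hs', .cons (hle'.bound _ _ hbd) hbd'⟩

/-- A new reference cell. -/
theorem StoreRel.ref {W : World S} {σ : Store S (RVal S)} {τ : Store S (JVal S)}
    (h : StoreRel W σ τ) {a b : S.Addr} (ha : a ∉ σ) (hb : b ∉ τ) {v : RVal S} {w : JVal S}
    (hv : VRel W v w) :
    ∃ W' : World S, W.Le W' ∧ StoreRel W' (σ.insert a v) (τ.insert b w) ∧ W'.cell a b := by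
  have hle : W.Le ⟨fun a' b' => W.cell a' b' ∨ (a' = a ∧ b' = b), W.bound⟩ :=
    ⟨fun _ _ h => .inl h, fun _ _ h => h⟩
  refine ⟨_, hle, ⟨?_, ?_, ?_, ?_, ?_, ?_⟩, .inr ⟨rfl, rfl⟩⟩
  · rintro a' b' (hab | ⟨rfl, rfl⟩)
    · obtain ⟨v', w', h1, h2, h3⟩ := h.cell a' b' hab
      refine ⟨v', w', ?_, ?_, h3.mono hle⟩
      · rw [Finmap.lookup_insert_of_ne]
        · exact h1
        · rintro rfl; exact ha (h.mem_left hab)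
      · rw [Finmap.lookup_insert_of_ne]
        · exact h2
        · rintro rfl; exact hb (h.mem_right hab)
    · exact ⟨v, w, Finmap.lookup_insert _, Finmap.lookup_insert _, hv.mono hle⟩
  · intro a' ha'
    rcases Finmap.mem_insert.1 ha' with rfl | ha'
    · exact ⟨b, .inr ⟨rfl, rfl⟩⟩
    · obtain ⟨b', hb'⟩ := h.dom a' ha'
      exact ⟨b', .inl hb'⟩
  · rintro a' b' b'' (h1 | ⟨rfl, rfl⟩) (h2 | ⟨h2, rfl⟩)
    · exact h.functional _ _ _ h1 h2
    · subst h2; exact absurd (h.mem_left h1) ha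
    · exact absurd (h.mem_left h2) ha
    · rfl
  · rintro a' a'' b' (h1 | ⟨rfl, rfl⟩) (h2 | ⟨rfl, h2⟩)
    · exact h.injective _ _ _ h1 h2
    · subst h2; exact absurd (h.mem_right h1) hb
    · exact absurd (h.mem_right h2) hb
    · rfl
  · intro b' v' hbv
    obtain ⟨w', h2, h3⟩ := h.bound b' v' hbv
    refine ⟨w', ?_, h3.mono hle⟩
    rw [Finmap.lookup_insert_of_ne]
    · exact h2
    · rintro rfl; exact hb (h.mem_bound hbv)
  · rintro a' b' v' (hab | ⟨rfl, rfl⟩) hbv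
    · exact h.disjoint _ _ _ hab hbv
    · exact hb (h.mem_bound hbv)

/-- An assignment. -/
theorem StoreRel.assign {W : World S} {σ : Store S (RVal S)} {τ : Store S (JVal S)}
    (h : StoreRel W σ τ) {a b : S.Addr} (hab : W.cell a b) {v : RVal S} {w : JVal S}
    (hv : VRel W v w) : StoreRel W (σ.insert a v) (τ.insert b w) := by
  refine ⟨?_, ?_, h.functional, h.injective, ?_, h.disjoint⟩
  · intro a' b' hab'
    -- Functionality identifies the machine address of the assigned cell. For any other cell,
    -- injectivity shows that the overwritten location is not its own.
    by_cases haa : a' = a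
    · subst haa
      obtain rfl := h.functional _ _ _ hab hab'
      exact ⟨v, w, Finmap.lookup_insert _, Finmap.lookup_insert _, hv⟩
    · obtain ⟨v', w', h1, h2, h3⟩ := h.cell a' b' hab'
      refine ⟨v', w', ?_, ?_, h3⟩
      · rwa [Finmap.lookup_insert_of_ne _ haa]
      · rw [Finmap.lookup_insert_of_ne]
        · exact h2
        · rintro rfl; exact haa (h.injective _ _ _ hab' hab)
  · intro a' ha'
    rcases Finmap.mem_insert.1 ha' with rfl | ha'
    · exact ⟨b, hab⟩
    · exact h.dom a' ha'
  -- Variables keep their values: their locations are disjoint from the cells, and `b` is a cell.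
  · intro b' v' hbv
    obtain ⟨w', h2, h3⟩ := h.bound b' v' hbv
    refine ⟨w', ?_, h3⟩
    rw [Finmap.lookup_insert_of_ne]
    · exact h2
    · rintro rfl; exact h.disjoint _ _ _ hab hbv

/-- No condition on the length of `xs` is needed: values and addresses are paired one to one, so
both zips are cut off at the same point. -/
theorem EnvRel.extend {W : World S} {ρ : REnv S} {η : JEnv S} (h : EnvRel W ρ η) :
    ∀ {xs : List S.Var} {vs : List (RVal S)} {bs : List S.Addr},
      List.Forall₂ (fun v b => W.bound b v) vs bs →
      EnvRel W (ρ.extend (xs.zip vs)) (xs.zip bs ++ η) := by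
  obtain ⟨l⟩ := ρ
  intro xs
  induction xs with
  | nil => intro vs bs _; simpa [REnv.extend] using h
  | cons x xs ih =>
    intro vs bs hvb
    cases hvb with
    | nil => simpa [REnv.extend] using h
    | cons hb hvb =>
      intro y
      have := ih hvb y
      simp only [REnv.extend, REnv.lookup, List.zip_cons_cons, List.cons_append,
        List.lookup_cons] at this ⊢
      by_cases hxy : y = x
      · simp only [hxy, beq_self_eq_true]
        exact .some hb
      · simp only [beq_false_of_ne hxy]
        exact this

theorem EnvRel.lookup_left {W : World S} {ρ : REnv S} {η : JEnv S} (h : EnvRel W ρ η) {x : S.Var}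
    {v : RVal S} (hv : ρ.lookup x = some v) : ∃ b, List.lookup x η = some b ∧ W.bound b v := by
  have := h x
  rw [hv] at this
  revert this
  cases List.lookup x η <;> intro h <;> cases h
  exact ⟨_, rfl, ‹_›⟩

theorem EnvRel.lookup_right {W : World S} {ρ : REnv S} {η : JEnv S} (h : EnvRel W ρ η) {x : S.Var}
    {b : S.Addr} (hb : List.lookup x η = some b) : ∃ v, ρ.lookup x = some v ∧ W.bound b v := by
  have := h x
  rw [hb] at this
  revert this
  cases ρ.lookup x <;> intro h <;> cases h
  exact ⟨_, rfl, ‹_›⟩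

/-! ### Answers -/

/-- Answers and `δ` are compared along permutations of all addresses, whereas a world matches only
finitely many cells. On the keys of `σ` the matching is an injective function, and a finite partial
injection extends. -/
theorem StoreRel.exists_perm {W : World S} {σ : Store S (RVal S)} {τ : Store S (JVal S)}
    (h : StoreRel W σ τ) : ∃ π : Equiv.Perm S.Addr, ∀ a b, W.cell a b → π a = b := by
  classical
  -- Outside the domain of `σ` nothing is required, and `a` itself serves as a default.
  have hex : ∀ a, ∃ b, a ∈ σ.keys → W.cell a b := fun a => by
    by_cases ha : a ∈ σ
    · obtain ⟨b, hb⟩ := h.dom a ha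
      exact ⟨b, fun _ => hb⟩
    · exact ⟨a, fun h => absurd (Finmap.mem_keys.1 h) ha⟩
  choose f hf using hex
  obtain ⟨π, hπ⟩ := exists_perm_extending f σ.keys fun a ha a' ha' he =>
    h.injective a a' (f a) (hf a ha) (he ▸ hf a' ha')
  refine ⟨π, fun a b hab => ?_⟩
  have ha := Finmap.mem_keys.2 (h.mem_left hab)
  rw [hπ a ha]
  exact h.functional _ _ _ (hf a ha) hab

/-- Here the contents of environments have to be compared after all. The induction enters
environments, and the store invariant supplies a related machine value at the address of each
variable. -/
theorem SameVal.of_vRel {W : World S} {σ : Store S (RVal S)} {τ : Store S (JVal S)}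
    (h : StoreRel W σ τ) {π : Equiv.Perm S.Addr} (hπ : ∀ a b, W.cell a b → π a = b) {v : RVal S}
    {w : JVal S} : VRel W v w → SameVal π τ v w := by
  induction v using RVal.ind generalizing w with
  | const k => intro hv; cases hv; exact .const k
  | addr a =>
    intro hv
    cases hv with
    | addr _ b hab => rw [← hπ a b hab]; exact .addr a
  | fn f ρ ih =>
    intro hv
    cases hv with
    | fn _ _ η _ hη =>
      refine .fn f ρ η (fun x => ?_) (fun x b hb => ?_) (fun x v b w hv hb hw => ?_)
      · constructor
        · intro hs
          obtain ⟨v, hv⟩ := Option.isSome_iff_exists.1 hs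
          obtain ⟨b, hb, _⟩ := hη.lookup_left hv
          simp [hb]
        · intro hs
          obtain ⟨b, hb⟩ := Option.isSome_iff_exists.1 hs
          obtain ⟨v, hv, _⟩ := hη.lookup_right hb
          simp [hv]
      · obtain ⟨v, hv, hbd⟩ := hη.lookup_right hb
        obtain ⟨w, hw, _⟩ := h.bound b v hbd
        simp [hw]
      · obtain ⟨b', hb', hbd⟩ := hη.lookup_left hv
        rw [hb] at hb'
        cases hb'
        obtain ⟨w', hw', hr⟩ := h.bound b v hbd
        rw [hw] at hw'
        cases hw'
        exact ih x v hv hr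
  | record fs ih =>
    intro hv
    cases hv with
    | record _ gs hf =>
      refine .record fs gs ?_
      clear hπ
      induction hf with
      | nil => exact .nil
      | cons hp _ ihf =>
        cases hp with
        | mk s a b hab =>
          exact .cons s a b _ _ (ih (s, a) (by simp) hab)
            (ihf fun p hp => ih p (by simp [hp]))

theorem StoreRel.sameStore {W : World S} {σ : Store S (RVal S)} {τ : Store S (JVal S)}
    (h : StoreRel W σ τ) {π : Equiv.Perm S.Addr} (hπ : ∀ a b, W.cell a b → π a = b) :
    SameStore π σ τ := by
  intro a v hv
  obtain ⟨b, hb⟩ := h.dom a (mem_of_lookup_eq_some hv)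
  obtain ⟨v', w, h1, h2, h3⟩ := h.cell a b hb
  rw [hv] at h1
  cases h1
  exact ⟨w, by rw [hπ a b hb]; exact h2, .of_vRel h hπ h3⟩

theorem StoreRel.sameAnswer_value {W : World S} {σ : Store S (RVal S)} {τ : Store S (JVal S)}
    (h : StoreRel W σ τ) {v : RVal S} {w : JVal S} (hv : VRel W v w) :
    SameAnswer (.value σ v) (.value τ w) := by
  obtain ⟨π, hπ⟩ := h.exists_perm
  exact .value π σ τ v w (h.sameStore hπ) (.of_vRel h hπ hv)

theorem StoreRel.sameAnswer_error {W : World S} {σ : Store S (RVal S)} {τ : Store S (JVal S)}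
    (h : StoreRel W σ τ) {v : RVal S} {w : JVal S} (hv : VRel W v w) :
    SameAnswer (.error σ v) (.error τ w) := by
  obtain ⟨π, hπ⟩ := h.exists_perm
  exact .error π σ τ v w (h.sameStore hπ) (.of_vRel h hπ hv)

/-! ### Primitive operations -/

/-- Since `δ` sees functions as opaque, what it sees of related values differs only by the renaming
of cells. -/
theorem VRel.skeleton_eq {W : World S} {π : Equiv.Perm S.Addr}
    (hπ : ∀ a b, W.cell a b → π a = b) {v : RVal S} {w : JVal S} :
    VRel W v w → skeleton w = (skeleton v).map π id := by
  induction v using PVal.ind generalizing w with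
  | const k => intro h; cases h; simp [skeleton, PVal.map]
  | addr a => intro h; cases h with | addr _ b hab => simp [skeleton, PVal.map, hπ a b hab]
  | fn f => intro h; cases h; simp [skeleton, PVal.map]
  | record fs ih =>
    intro h
    cases h with
    | record _ gs hf =>
      simp only [skeleton, PVal.map, PVal.mapFields_eq, PVal.record.injEq, List.map_map]
      clear hπ
      induction hf with
      | nil => rfl
      | cons hp _ ihf =>
        cases hp with
        | mk s a b hab =>
          rw [List.map_cons, List.map_cons, ihf fun p hp => ih p (by simp [hp])]
          have := ih (s, a) (by simp) hab
          simp only [skeleton] at this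
          simp [this]

/-- An address that `δ` can see in an argument is a cell, so a permutation extending the world is
prescribed on it. -/
theorem VRel.cell_of_mem {W : World S} {v : RVal S} {w : JVal S} :
    VRel W v w → ∀ a ∈ (skeleton v).addrList, ∃ b, W.cell a b := by
  induction v using PVal.ind generalizing w with
  | const k => simp [skeleton, PVal.map, PVal.addrList]
  | addr a =>
    intro h
    cases h with
    | addr _ b hab => simp only [skeleton, PVal.map, PVal.addrList]; simpa using ⟨b, hab⟩
  | fn f => simp [skeleton, PVal.map, PVal.addrList]
  | record fs ih =>
    intro h a ha
    cases h with
    | record _ gs hf =>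
      simp only [skeleton, PVal.map, PVal.mapFields_eq, PVal.addrList, PVal.addrListFields_eq,
        List.mem_flatMap, List.mem_map] at ha
      obtain ⟨_, ⟨p, hp, rfl⟩, ha⟩ := ha
      obtain ⟨q, _, hpq⟩ : ∃ q ∈ gs, PairRel (VRel W) p q := by
        clear ih
        induction hf with
        | nil => simp at hp
        | cons h _ ih =>
          rcases List.mem_cons.1 hp with rfl | hp
          · exact ⟨_, by simp, h⟩
          · obtain ⟨q, hq, h⟩ := ih hp
            exact ⟨q, by simp [hq], h⟩
      cases hpq with
      | mk s x y hxy => exact ih _ hp hxy a ha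

theorem VRel.ofData {W : World S} {π : Equiv.Perm S.Addr} (r : PVal S Empty) :
    (∀ a ∈ r.addrList, W.cell a (π a)) → VRel W (ofData r) (ofData (r.map π id)) := by
  induction r using PVal.ind with
  | const k => intro _; exact .const k
  | addr a => intro h; exact .addr a (π a) (h a (by simp [PVal.addrList]))
  | fn f => exact f.elim
  | record fs ih =>
    intro h
    simp only [JSCalc.ofData, PVal.map, PVal.mapFields_eq] at ih ⊢
    refine .record _ _ ?_
    simp only [PVal.addrList, PVal.addrListFields_eq, List.mem_flatMap] at h
    induction fs with
    | nil => exact .nil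
    | cons p fs ihf =>
      refine .cons (.mk _ _ _ (ih p (by simp) fun a ha => h a ⟨p, by simp, ha⟩)) ?_
      exact ihf (fun q hq => ih q (by simp [hq])) fun a ⟨q, hq, ha⟩ => h a ⟨q, by simp [hq], ha⟩

/-- Related arguments have related results. -/
theorem delta_rel [Infinite S.Addr] {δ : Delta S} (hδ : δ.Equivariant) {W : World S}
    {σ : Store S (RVal S)} {τ : Store S (JVal S)} (h : StoreRel W σ τ) {o : S.Op}
    {vs : List (RVal S)} {ws : List (JVal S)} (hv : List.Forall₂ (VRel W) vs ws) :
    (∃ r r', δ o (vs.map skeleton) = .ok r ∧ δ o (ws.map skeleton) = .ok r' ∧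
      VRel W (ofData r) (ofData r')) ∨
    (∃ r r', δ o (vs.map skeleton) = .error r ∧ δ o (ws.map skeleton) = .error r' ∧
      VRel W (ofData r) (ofData r')) := by
  obtain ⟨π, hπ⟩ := h.exists_perm
  have hws : ws.map skeleton = (vs.map skeleton).map (PVal.map π id) := by
    rw [List.map_map]
    induction hv with
    | nil => rfl
    | cons hv _ ih => rw [List.map_cons, List.map_cons, ih, hv.skeleton_eq hπ]; rfl
  -- An address of the result occurs in some argument, hence is a cell, and on cells `π` is the
  -- matching of the world.
  have hcell : ∀ r, (δ o (vs.map skeleton) = .ok r ∨ δ o (vs.map skeleton) = .error r) →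
      ∀ a ∈ r.addrList, W.cell a (π a) := by
    intro r hr a ha
    obtain ⟨u, hu, hau⟩ := hδ.addrs_subset hr ha
    obtain ⟨v, hvs, rfl⟩ := List.mem_map.1 hu
    have hex : ∃ w, VRel W v w := by
      clear hws hr hu
      induction hv with
      | nil => simp at hvs
      | cons h _ ih =>
        rcases List.mem_cons.1 hvs with rfl | hvs
        · exact ⟨_, h⟩
        · exact ih hvs
    obtain ⟨w, hw⟩ := hex
    obtain ⟨b, hb⟩ := hw.cell_of_mem a hau
    rwa [hπ a b hb]
  have key := hδ π o (vs.map skeleton)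
  rw [← hws] at key
  cases hr : δ o (vs.map skeleton) with
  | ok r =>
    rw [hr] at key
    exact .inl ⟨r, _, rfl, key, .ofData r (hcell r (.inl hr))⟩
  | error r =>
    rw [hr] at key
    exact .inr ⟨r, _, rfl, key, .ofData r (hcell r (.inr hr))⟩

end Stores

-- Contexts and related closures.

section Plugging
variable {S : Sig} {W : World S}

theorem forall₂_append_left {α β : Type} {r : α → β → Prop} {a b : List α} {l : List β}
    (h : List.Forall₂ r (a ++ b) l) :
    ∃ a' b', l = a' ++ b' ∧ List.Forall₂ r a a' ∧ List.Forall₂ r b b' := by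
  induction a generalizing l with
  | nil => exact ⟨[], l, rfl, .nil, h⟩
  | cons x a ih =>
    cases h with
    | cons hx h =>
      obtain ⟨a', b', rfl, h1, h2⟩ := ih h
      exact ⟨_ :: a', b', rfl, .cons hx h1, h2⟩

theorem forall₂_append_right {α β : Type} {r : α → β → Prop} {a b : List β} {l : List α}
    (h : List.Forall₂ r l (a ++ b)) :
    ∃ a' b', l = a' ++ b' ∧ List.Forall₂ r a' a ∧ List.Forall₂ r b' b := by
  obtain ⟨a', b', h1, h2, h3⟩ := forall₂_append_left h.flip
  exact ⟨a', b', h1, h2.flip, h3.flip⟩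

theorem forall₂_append {α β : Type} {r : α → β → Prop} {a b : List α} {a' b' : List β}
    (h : List.Forall₂ r a a') (h' : List.Forall₂ r b b') :
    List.Forall₂ r (a ++ b) (a' ++ b') := by
  induction h with
  | nil => exact h'
  | cons hx _ ih => exact .cons hx ih

theorem cloRel_vals {vs : List (RVal S)} {ws : List (JVal S)} (h : List.Forall₂ (VRel W) vs ws) :
    List.Forall₂ (CloRel W) (vs.map .val) (ws.map .val) := by
  induction h with
  | nil => exact .nil
  | cons h _ ih => exact .cons (.val _ _ h) ih

theorem cloRel_vals_left {vs : List (RVal S)} {ds : List (JClo S)}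
    (h : List.Forall₂ (CloRel W) (vs.map .val) ds) :
    ∃ ws, ds = ws.map .val ∧ List.Forall₂ (VRel W) vs ws := by
  induction vs generalizing ds with
  | nil => cases h; exact ⟨[], rfl, .nil⟩
  | cons v vs ih =>
    cases h with
    | cons hv h =>
      cases hv with
      | val _ w hv =>
        obtain ⟨ws, rfl, hvs⟩ := ih h
        exact ⟨w :: ws, rfl, .cons hv hvs⟩

theorem cloRel_vals_right {ws : List (JVal S)} {ds : List (RClo S)}
    (h : List.Forall₂ (CloRel W) ds (ws.map .val)) :
    ∃ vs, ds = vs.map .val ∧ List.Forall₂ (VRel W) vs ws := by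
  induction ws generalizing ds with
  | nil => cases h; exact ⟨[], rfl, .nil⟩
  | cons v vs ih =>
    cases h with
    | cons hv h =>
      cases hv with
      | val w _ hv =>
        obtain ⟨ws, rfl, hvs⟩ := ih h
        exact ⟨w :: ws, rfl, .cons hv hvs⟩

theorem cloRel_fields {vs : List (String × RVal S)} {ws : List (String × JVal S)}
    (h : List.Forall₂ (PairRel (VRel W)) vs ws) :
    List.Forall₂ (PairRel (CloRel W)) (vs.map fun p => (p.1, .val p.2))
      (ws.map fun p => (p.1, .val p.2)) := by
  induction h with
  | nil => exact .nil
  | cons h _ ih => cases h with | mk s a b h => exact .cons (.mk _ _ _ (.val _ _ h)) ih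

theorem cloRel_fields_left {vs : List (String × RVal S)} {ds : List (String × JClo S)}
    (h : List.Forall₂ (PairRel (CloRel W)) (vs.map fun p => (p.1, .val p.2)) ds) :
    ∃ ws : List (String × JVal S), ds = (ws.map fun p => (p.1, .val p.2)) ∧
      List.Forall₂ (PairRel (VRel W)) vs ws := by
  induction vs generalizing ds with
  | nil => cases h; exact ⟨[], rfl, .nil⟩
  | cons v vs ih =>
    cases h with
    | cons hv h =>
      cases hv with
      | mk s _ b hv =>
        cases hv with
        | val _ w hv =>
          obtain ⟨ws, rfl, hvs⟩ := ih h
          exact ⟨(v.1, w) :: ws, rfl, .cons (.mk _ _ _ hv) hvs⟩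

theorem cloRel_fields_right {ws : List (String × JVal S)} {ds : List (String × RClo S)}
    (h : List.Forall₂ (PairRel (CloRel W)) ds (ws.map fun p => (p.1, .val p.2))) :
    ∃ vs : List (String × RVal S), ds = (vs.map fun p => (p.1, .val p.2)) ∧
      List.Forall₂ (PairRel (VRel W)) vs ws := by
  induction ws generalizing ds with
  | nil => cases h; exact ⟨[], rfl, .nil⟩
  | cons v vs ih =>
    cases h with
    | cons hv h =>
      cases hv with
      | mk s b _ hv =>
        cases hv with
        | val w _ hv =>
          obtain ⟨ws, rfl, hvs⟩ := ih h
          exact ⟨(v.1, w) :: ws, rfl, .cons (.mk _ _ _ hv) hvs⟩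

/-- Contexts of the machine, applied to a closure. -/
def plugJ : JCtx S → JClo S → JClo S
  | [], c => c
  | F :: E, c => plugJ E (F.plugClo c)

theorem plug_append (E E' : RCtx S) (c : RClo S) : plug (E ++ E') c = plug E' (plug E c) := by
  induction E generalizing c with
  | nil => rfl
  | cons F E ih => exact ih _

theorem plugJ_append (E E' : JCtx S) (c : JClo S) : plugJ (E ++ E') c = plugJ E' (plugJ E c) := by
  induction E generalizing c with
  | nil => rfl
  | cons F E ih => exact ih _

theorem cloRel_plugClo {F : Frame S (RClo S) (RVal S)} {F' : Frame S (JClo S) (JVal S)}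
    {c : RClo S} {c' : JClo S} (hF : FRel W F F') (hc : CloRel W c c') :
    CloRel W (F.plugClo c) (F'.plugClo c') := by
  cases hF with
  | appArg _ _ _ _ _ _ hv hvs hds =>
    exact .app _ _ _ _ (.val _ _ hv) (forall₂_append (cloRel_vals hvs) (.cons hc hds))
  | recordF _ _ s _ _ hvs hds =>
    exact .record _ _ (forall₂_append (cloRel_fields hvs) (.cons (.mk _ _ _ hc) hds))
  | opF _ _ _ _ _ hvs hds =>
    exact .op _ _ _ (forall₂_append (cloRel_vals hvs) (.cons hc hds))
  | _ => constructor <;> first | exact hc | assumption | exact .val _ _ ‹_›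

theorem cloRel_plug {E : RCtx S} {E' : JCtx S} {c : RClo S} {c' : JClo S} (hE : CtxRel W E E')
    (hc : CloRel W c c') : CloRel W (plug E c) (plugJ E' c') := by
  induction hE generalizing c c' with
  | nil => exact hc
  | cons hF _ ih => exact ih (cloRel_plugClo hF hc)

/-- The relation is structural and relates `val` only to `val`. A frame on one side therefore forces
a frame of the same shape on the other, with the same components already evaluated. In this way any
decomposition into context and redex is transferred. -/
theorem cloRel_plugClo_left {F : Frame S (RClo S) (RVal S)} {c : RClo S} {d : JClo S}
    (h : CloRel W (F.plugClo c) d) :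
    ∃ F' c', d = F'.plugClo c' ∧ FRel W F F' ∧ CloRel W c c' := by
  cases F with
  | letF => cases h with | letE _ _ _ _ _ h h' => exact ⟨.letF _ _, _, rfl, .letF _ _ _ h', h⟩
  | appFun => cases h with | app _ _ _ _ h h' => exact ⟨.appFun _, _, rfl, .appFun _ _ h', h⟩
  | appArg v vs ds =>
    cases h with
    | app _ _ _ _ h h' =>
      cases h with
      | val _ w hv =>
        obtain ⟨_, _, rfl, h1, h2⟩ := forall₂_append_left h'
        obtain ⟨ws, rfl, hvs⟩ := cloRel_vals_left h1
        cases h2 with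
        | cons hc hds => exact ⟨.appArg w ws _, _, rfl, .appArg _ _ _ _ _ _ hv hvs hds, hc⟩
  | recordF vs s ds =>
    cases h with
    | record _ _ h' =>
      obtain ⟨_, _, rfl, h1, h2⟩ := forall₂_append_left h'
      obtain ⟨ws, rfl, hvs⟩ := cloRel_fields_left h1
      cases h2 with
      | cons hc hds =>
        cases hc with
        | mk _ _ b hc => exact ⟨.recordF ws s _, _, rfl, .recordF _ _ _ _ _ hvs hds, hc⟩
  | opF o vs ds =>
    cases h with
    | op _ _ _ h' =>
      obtain ⟨_, _, rfl, h1, h2⟩ := forall₂_append_left h'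
      obtain ⟨ws, rfl, hvs⟩ := cloRel_vals_left h1
      cases h2 with
      | cons hc hds => exact ⟨.opF o ws _, _, rfl, .opF _ _ _ _ _ hvs hds, hc⟩
  | getL => cases h with | get _ _ _ _ h h' => exact ⟨.getL _, _, rfl, .getL _ _ h', h⟩
  | getR =>
    cases h with
    | get _ _ _ _ h h' => cases h with | val _ _ h => exact ⟨.getR _, _, rfl, .getR _ _ h, h'⟩
  | setL =>
    cases h with
    | set _ _ _ _ _ _ h h' h'' => exact ⟨.setL _ _, _, rfl, .setL _ _ _ _ h' h'', h⟩
  | setM =>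
    cases h with
    | set _ _ _ _ _ _ h h' h'' =>
      cases h with | val _ _ h => exact ⟨.setM _ _, _, rfl, .setM _ _ _ _ h h'', h'⟩
  | setR =>
    cases h with
    | set _ _ _ _ _ _ h h' h'' =>
      cases h with
      | val _ _ h =>
        cases h' with | val _ _ h' => exact ⟨.setR _ _, _, rfl, .setR _ _ _ _ h h', h''⟩
  | delL => cases h with | del _ _ _ _ h h' => exact ⟨.delL _, _, rfl, .delL _ _ h', h⟩
  | delR =>
    cases h with
    | del _ _ _ _ h h' => cases h with | val _ _ h => exact ⟨.delR _, _, rfl, .delR _ _ h, h'⟩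
  | refF => cases h with | ref _ _ h => exact ⟨.refF, _, rfl, .refF, h⟩
  | derefF => cases h with | deref _ _ h => exact ⟨.derefF, _, rfl, .derefF, h⟩
  | assignL =>
    cases h with | assign _ _ _ _ h h' => exact ⟨.assignL _, _, rfl, .assignL _ _ h', h⟩
  | assignR =>
    cases h with
    | assign _ _ _ _ h h' =>
      cases h with | val _ _ h => exact ⟨.assignR _, _, rfl, .assignR _ _ h, h'⟩
  | iteF =>
    cases h with
    | ite _ _ _ _ _ _ h h' h'' => exact ⟨.iteF _ _, _, rfl, .iteF _ _ _ _ h' h'', h⟩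
  | seqF => cases h with | seq _ _ _ _ h h' => exact ⟨.seqF _, _, rfl, .seqF _ _ h', h⟩
  | throwF => cases h with | throw _ _ h => exact ⟨.throwF, _, rfl, .throwF, h⟩
  | brkF l => cases h with | brk _ _ _ h => exact ⟨.brkF l, _, rfl, .brkF l, h⟩
  | catchF =>
    cases h with | tryCatch _ _ _ _ _ h h' => exact ⟨.catchF _ _, _, rfl, .catchF _ _ _ h', h⟩
  | finallyF =>
    cases h with | tryFinally _ _ _ _ h h' => exact ⟨.finallyF _, _, rfl, .finallyF _ _ h', h⟩
  | labelF l => cases h with | label _ _ _ h => exact ⟨.labelF l, _, rfl, .labelF l, h⟩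

theorem cloRel_plug_left {E : RCtx S} {c : RClo S} {d : JClo S} (h : CloRel W (plug E c) d) :
    ∃ E' c', d = plugJ E' c' ∧ CtxRel W E E' ∧ CloRel W c c' := by
  induction E generalizing c with
  | nil => exact ⟨[], d, rfl, .nil, h⟩
  | cons F E ih =>
    obtain ⟨E', c', rfl, hE, hc⟩ := ih h
    obtain ⟨F', c', rfl, hF, hc⟩ := cloRel_plugClo_left hc
    exact ⟨F' :: E', c', rfl, .cons hF hE, hc⟩

theorem cloRel_plugClo_right {F : Frame S (JClo S) (JVal S)} {c : JClo S} {d : RClo S}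
    (h : CloRel W d (F.plugClo c)) :
    ∃ F' c', d = F'.plugClo c' ∧ FRel W F' F ∧ CloRel W c' c := by
  cases F with
  | letF => cases h with | letE _ _ _ _ _ h h' => exact ⟨.letF _ _, _, rfl, .letF _ _ _ h', h⟩
  | appFun => cases h with | app _ _ _ _ h h' => exact ⟨.appFun _, _, rfl, .appFun _ _ h', h⟩
  | appArg v vs ds =>
    cases h with
    | app _ _ _ _ h h' =>
      cases h with
      | val w _ hv =>
        obtain ⟨_, _, rfl, h1, h2⟩ := forall₂_append_right h'
        obtain ⟨ws, rfl, hvs⟩ := cloRel_vals_right h1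
        cases h2 with
        | cons hc hds => exact ⟨.appArg w ws _, _, rfl, .appArg _ _ _ _ _ _ hv hvs hds, hc⟩
  | recordF vs s ds =>
    cases h with
    | record _ _ h' =>
      obtain ⟨_, _, rfl, h1, h2⟩ := forall₂_append_right h'
      obtain ⟨ws, rfl, hvs⟩ := cloRel_fields_right h1
      cases h2 with
      | cons hc hds =>
        cases hc with
        | mk _ b _ hc => exact ⟨.recordF ws s _, _, rfl, .recordF _ _ _ _ _ hvs hds, hc⟩
  | opF o vs ds =>
    cases h with
    | op _ _ _ h' =>
      obtain ⟨_, _, rfl, h1, h2⟩ := forall₂_append_right h'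
      obtain ⟨ws, rfl, hvs⟩ := cloRel_vals_right h1
      cases h2 with
      | cons hc hds => exact ⟨.opF o ws _, _, rfl, .opF _ _ _ _ _ hvs hds, hc⟩
  | getL => cases h with | get _ _ _ _ h h' => exact ⟨.getL _, _, rfl, .getL _ _ h', h⟩
  | getR =>
    cases h with
    | get _ _ _ _ h h' => cases h with | val _ _ h => exact ⟨.getR _, _, rfl, .getR _ _ h, h'⟩
  | setL =>
    cases h with
    | set _ _ _ _ _ _ h h' h'' => exact ⟨.setL _ _, _, rfl, .setL _ _ _ _ h' h'', h⟩
  | setM =>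
    cases h with
    | set _ _ _ _ _ _ h h' h'' =>
      cases h with | val _ _ h => exact ⟨.setM _ _, _, rfl, .setM _ _ _ _ h h'', h'⟩
  | setR =>
    cases h with
    | set _ _ _ _ _ _ h h' h'' =>
      cases h with
      | val _ _ h =>
        cases h' with | val _ _ h' => exact ⟨.setR _ _, _, rfl, .setR _ _ _ _ h h', h''⟩
  | delL => cases h with | del _ _ _ _ h h' => exact ⟨.delL _, _, rfl, .delL _ _ h', h⟩
  | delR =>
    cases h with
    | del _ _ _ _ h h' => cases h with | val _ _ h => exact ⟨.delR _, _, rfl, .delR _ _ h, h'⟩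
  | refF => cases h with | ref _ _ h => exact ⟨.refF, _, rfl, .refF, h⟩
  | derefF => cases h with | deref _ _ h => exact ⟨.derefF, _, rfl, .derefF, h⟩
  | assignL =>
    cases h with | assign _ _ _ _ h h' => exact ⟨.assignL _, _, rfl, .assignL _ _ h', h⟩
  | assignR =>
    cases h with
    | assign _ _ _ _ h h' =>
      cases h with | val _ _ h => exact ⟨.assignR _, _, rfl, .assignR _ _ h, h'⟩
  | iteF =>
    cases h with
    | ite _ _ _ _ _ _ h h' h'' => exact ⟨.iteF _ _, _, rfl, .iteF _ _ _ _ h' h'', h⟩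
  | seqF => cases h with | seq _ _ _ _ h h' => exact ⟨.seqF _, _, rfl, .seqF _ _ h', h⟩
  | throwF => cases h with | throw _ _ h => exact ⟨.throwF, _, rfl, .throwF, h⟩
  | brkF l => cases h with | brk _ _ _ h => exact ⟨.brkF l, _, rfl, .brkF l, h⟩
  | catchF =>
    cases h with | tryCatch _ _ _ _ _ h h' => exact ⟨.catchF _ _, _, rfl, .catchF _ _ _ h', h⟩
  | finallyF =>
    cases h with | tryFinally _ _ _ _ h h' => exact ⟨.finallyF _, _, rfl, .finallyF _ _ h', h⟩
  | labelF l => cases h with | label _ _ _ h => exact ⟨.labelF l, _, rfl, .labelF l, h⟩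

theorem cloRel_plug_right {E : JCtx S} {c : JClo S} {d : RClo S} (h : CloRel W d (plugJ E c)) :
    ∃ E' c', d = plug E' c' ∧ CtxRel W E' E ∧ CloRel W c' c := by
  induction E generalizing c with
  | nil => exact ⟨[], d, rfl, .nil, h⟩
  | cons F E ih =>
    obtain ⟨E', c', rfl, hE, hc⟩ := ih h
    obtain ⟨F', c', rfl, hF, hc⟩ := cloRel_plugClo_right hc
    exact ⟨F' :: E', c', rfl, .cons hF hE, hc⟩

/-! ### Propagation and faults -/

theorem VRel.isFn_iff {v : RVal S} {w : JVal S} (h : VRel W v w) : v.IsFn ↔ w.IsFn := by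
  cases h <;> simp [PVal.IsFn]

theorem VRel.isRecord_iff {v : RVal S} {w : JVal S} (h : VRel W v w) :
    v.IsRecord ↔ w.IsRecord := by
  cases h <;> simp [PVal.IsRecord]

theorem VRel.isStr_iff {v : RVal S} {w : JVal S} (h : VRel W v w) : v.IsStr ↔ w.IsStr := by
  cases h <;> simp [PVal.IsStr]

theorem VRel.isBool_iff {v : RVal S} {w : JVal S} (h : VRel W v w) : v.IsBool ↔ w.IsBool := by
  cases h <;> simp [PVal.IsBool]

theorem VRel.isAddr_iff {v : RVal S} {w : JVal S} (h : VRel W v w) : v.IsAddr ↔ w.IsAddr := by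
  cases h <;> simp [PVal.IsAddr]

theorem addrsList_eq_empty {es : List (Exp S)} (h : Exp.addrsList es = ∅) :
    ∀ e ∈ es, e.addrs = ∅ := by
  induction es with
  | nil => simp
  | cons e es ih =>
    simp only [Exp.addrsList, Set.union_empty_iff] at h
    simpa using ⟨h.1, ih h.2⟩

theorem addrsFields_eq_empty {fs : List (String × Exp S)} (h : Exp.addrsFields fs = ∅) :
    ∀ p ∈ fs, p.2.addrs = ∅ := by
  induction fs with
  | nil => simp
  | cons p fs ih =>
    obtain ⟨s, e⟩ := p
    simp only [Exp.addrsFields, Set.union_empty_iff] at h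
    rintro q hq
    rcases List.mem_cons.1 hq with rfl | hq
    · exact h.1
    · exact ih h.2 q hq

theorem cloRel_clos_list {ρ : REnv S} {η : JEnv S} (hη : EnvRel W ρ η) {es : List (Exp S)}
    (h : ∀ e ∈ es, e.addrs = ∅) :
    List.Forall₂ (CloRel W) (es.map fun e => .clos e ρ) (es.map fun e => .clos e η) := by
  induction es with
  | nil => exact .nil
  | cons e es ih => exact .cons (.clos _ _ _ (h e (by simp)) hη) (ih fun e he => h e (by simp [he]))

theorem cloRel_clos_fields {ρ : REnv S} {η : JEnv S} (hη : EnvRel W ρ η)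
    {fs : List (String × Exp S)} (h : ∀ p ∈ fs, p.2.addrs = ∅) :
    List.Forall₂ (PairRel (CloRel W)) (fs.map fun p => (p.1, .clos p.2 ρ))
      (fs.map fun p => (p.1, .clos p.2 η)) := by
  induction fs with
  | nil => exact .nil
  | cons p fs ih =>
    exact .cons (.mk _ _ _ (.clos _ _ _ (h p (by simp)) hη)) (ih fun e he => h e (by simp [he]))

/-- Propagation on both sides. -/
theorem propagate_rel {ρ : REnv S} {η : JEnv S} (hη : EnvRel W ρ η) {e : Exp S}
    (he : e.addrs = ∅) {c : RClo S} {d : JClo S} (hc : Propagate ρ e c) (hd : Propagate η e d) :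
    CloRel W c d := by
  -- The case of a literal address is closed by `he`; nothing else could relate such an address to
  -- itself.
  cases hc <;> cases hd <;>
    simp only [Exp.addrs, Set.union_empty_iff, Set.singleton_ne_empty] at he
  case record => exact .record _ _ (cloRel_clos_fields hη (addrsFields_eq_empty he))
  case app => exact .app _ _ _ _ (.clos _ _ _ he.1 hη) (cloRel_clos_list hη (addrsList_eq_empty he.2))
  case op => exact .op _ _ _ (cloRel_clos_list hη (addrsList_eq_empty he))
  case const k => exact .val _ _ (.const k)
  case func => exact .val _ _ (.fn _ _ _ he hη)
  all_goals
    constructor <;>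
      first
      | exact .clos _ _ _ he hη
      | exact .clos _ _ _ he.1 hη
      | exact .clos _ _ _ he.2 hη
      | exact .clos _ _ _ he.1.1 hη
      | exact .clos _ _ _ he.1.2 hη

/-- The rules for propagation inspect the expression only and never the environment. -/
theorem propagate_other {R R' : Type} {ρ : R} (η : R') {e : Exp S} {c : Clo S R}
    (hc : Propagate ρ e c) : ∃ d, Propagate η e d := by
  cases hc <;> exact ⟨_, by constructor⟩

/-- Faults depend only on the kinds of the values involved and on the numbers of parameters and
arguments, all of which the relation preserves. -/
theorem fault_left {c : RClo S} {d : JClo S} {k : RuntimeError} (h : CloRel W c d)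
    (hf : Fault c k) : Fault d k := by
  cases hf with
  | notFunction v vs hv =>
    cases h with
    | app _ _ _ _ h h' =>
      cases h with
      | val _ w h =>
        obtain ⟨ws, rfl, _⟩ := cloRel_vals_left h'
        exact .notFunction w ws (by rwa [← h.isFn_iff])
  | arity xs e ρ vs hl =>
    cases h with
    | app _ _ _ _ h h' =>
      cases h with
      | val _ w h =>
        obtain ⟨ws, rfl, hvs⟩ := cloRel_vals_left h'
        cases h with
        | fn => exact .arity _ _ _ _ (by rwa [← hvs.length_eq])
  | getRecord v u hv =>
    cases h with
    | get _ _ _ _ h h' =>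
      cases h with
      | val _ w h => cases h' with | val _ w' h' => exact .getRecord _ _ (by rwa [← h.isRecord_iff])
  | getString v u hv hu =>
    cases h with
    | get _ _ _ _ h h' =>
      cases h with
      | val _ w h =>
        cases h' with
        | val _ w' h' =>
          exact .getString _ _ (by rwa [← h.isRecord_iff]) (by rwa [← h'.isStr_iff])
  | delRecord v u hv =>
    cases h with
    | del _ _ _ _ h h' =>
      cases h with
      | val _ w h => cases h' with | val _ w' h' => exact .delRecord _ _ (by rwa [← h.isRecord_iff])
  | delString v u hv hu =>
    cases h with
    | del _ _ _ _ h h' =>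
      cases h with
      | val _ w h =>
        cases h' with
        | val _ w' h' =>
          exact .delString _ _ (by rwa [← h.isRecord_iff]) (by rwa [← h'.isStr_iff])
  | setRecord v u t hv =>
    cases h with
    | set _ _ _ _ _ _ h h' h'' =>
      cases h with
      | val _ w h =>
        cases h' with
        | val _ w' h' =>
          cases h'' with
          | val => exact .setRecord _ _ _ (by rwa [← h.isRecord_iff])
  | setString v u t hv hu =>
    cases h with
    | set _ _ _ _ _ _ h h' h'' =>
      cases h with
      | val _ w h =>
        cases h' with
        | val _ w' h' =>
          cases h'' with
          | val => exact .setString _ _ _ (by rwa [← h.isRecord_iff]) (by rwa [← h'.isStr_iff])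
  | notBoolean v _ _ hv =>
    cases h with
    | ite _ _ _ _ _ _ h h' h'' =>
      cases h with | val _ w h => exact .notBoolean _ _ _ (by rwa [← h.isBool_iff])
  | deref v hv =>
    cases h with
    | deref _ _ h => cases h with | val _ w h => exact .deref _ (by rwa [← h.isAddr_iff])
  | assign v u hv =>
    cases h with
    | assign _ _ _ _ h h' =>
      cases h with
      | val _ w h => cases h' with | val _ w' h' => exact .assign _ _ (by rwa [← h.isAddr_iff])

theorem fault_right {c : RClo S} {d : JClo S} {k : RuntimeError} (h : CloRel W c d)
    (hf : Fault d k) : Fault c k := by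
  cases hf with
  | notFunction v vs hv =>
    cases h with
    | app _ _ _ _ h h' =>
      cases h with
      | val w _ h =>
        obtain ⟨ws, rfl, _⟩ := cloRel_vals_right h'
        exact .notFunction w ws (by rwa [h.isFn_iff])
  | arity xs e ρ vs hl =>
    cases h with
    | app _ _ _ _ h h' =>
      cases h with
      | val w _ h =>
        obtain ⟨ws, rfl, hvs⟩ := cloRel_vals_right h'
        cases h with
        | fn => exact .arity _ _ _ _ (by rwa [hvs.length_eq])
  | getRecord v u hv =>
    cases h with
    | get _ _ _ _ h h' =>
      cases h with
      | val w _ h => cases h' with | val w' _ h' => exact .getRecord _ _ (by rwa [h.isRecord_iff])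
  | getString v u hv hu =>
    cases h with
    | get _ _ _ _ h h' =>
      cases h with
      | val w _ h =>
        cases h' with
        | val w' _ h' =>
          exact .getString _ _ (by rwa [h.isRecord_iff]) (by rwa [h'.isStr_iff])
  | delRecord v u hv =>
    cases h with
    | del _ _ _ _ h h' =>
      cases h with
      | val w _ h => cases h' with | val w' _ h' => exact .delRecord _ _ (by rwa [h.isRecord_iff])
  | delString v u hv hu =>
    cases h with
    | del _ _ _ _ h h' =>
      cases h with
      | val w _ h =>
        cases h' with
        | val w' _ h' =>
          exact .delString _ _ (by rwa [h.isRecord_iff]) (by rwa [h'.isStr_iff])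
  | setRecord v u t hv =>
    cases h with
    | set _ _ _ _ _ _ h h' h'' =>
      cases h with
      | val w _ h =>
        cases h' with
        | val w' _ h' =>
          cases h'' with
          | val => exact .setRecord _ _ _ (by rwa [h.isRecord_iff])
  | setString v u t hv hu =>
    cases h with
    | set _ _ _ _ _ _ h h' h'' =>
      cases h with
      | val w _ h =>
        cases h' with
        | val w' _ h' =>
          cases h'' with
          | val => exact .setString _ _ _ (by rwa [h.isRecord_iff]) (by rwa [h'.isStr_iff])
  | notBoolean v _ _ hv =>
    cases h with
    | ite _ _ _ _ _ _ h h' h'' =>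
      cases h with | val w _ h => exact .notBoolean _ _ _ (by rwa [h.isBool_iff])
  | deref v hv =>
    cases h with
    | deref _ _ h => cases h with | val w _ h => exact .deref _ (by rwa [h.isAddr_iff])
  | assign v u hv =>
    cases h with
    | assign _ _ _ _ h h' =>
      cases h with
      | val w _ h => cases h' with | val w' _ h' => exact .assign _ _ (by rwa [h.isAddr_iff])

end Plugging

/-! ### Administrative transitions of the machine -/

section Navigation
variable {S : Sig}

/-- The transitions that only move the focus of the machine, as a partial function. -/
def nav : JState S → Option (JState S)
  | .ev σ (.clos (.var x) ρ) E => some (.ap σ (.clos (.var x) ρ) E)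
  | .ev σ (.val v) E => some (.co σ v E)
  | .ev σ (.record ((s, c) :: ds)) E => some (.ev σ c (.recordF [] s ds :: E))
  | .ev σ (.letE x c d) E => some (.ev σ c (.letF x d :: E))
  | .ev σ (.app c ds) E => some (.ev σ c (.appFun ds :: E))
  | .ev σ (.get c d) E => some (.ev σ c (.getL d :: E))
  | .ev σ (.set c d d') E => some (.ev σ c (.setL d d' :: E))
  | .ev σ (.del c d) E => some (.ev σ c (.delL d :: E))
  | .ev σ (.assign c d) E => some (.ev σ c (.assignL d :: E))
  | .ev σ (.ref c) E => some (.ev σ c (.refF :: E))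
  | .ev σ (.deref c) E => some (.ev σ c (.derefF :: E))
  | .ev σ (.ite c d d') E => some (.ev σ c (.iteF d d' :: E))
  | .ev σ (.seq c d) E => some (.ev σ c (.seqF d :: E))
  | .ev σ (.label l c) E => some (.ev σ c (.labelF l :: E))
  | .ev σ (.brk l c) E => some (.ev σ c (.brkF l :: E))
  | .ev σ (.tryCatch c x d) E => some (.ev σ c (.catchF x d :: E))
  | .ev σ (.tryFinally c d) E => some (.ev σ c (.finallyF d :: E))
  | .ev σ (.throw c) E => some (.ev σ c (.throwF :: E))
  | .ev σ (.op o []) E => some (.ap σ (.op o []) E)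
  | .ev σ (.op o (c :: ds)) E => some (.ev σ c (.opF o [] ds :: E))
  | .co σ v (.letF x c :: E) => some (.ap σ (.letE x (.val v) c) E)
  | .co σ v (.appFun [] :: E) => some (.ap σ (.app (.val v) []) E)
  | .co σ v (.appFun (c :: ds) :: E) => some (.ev σ c (.appArg v [] ds :: E))
  | .co σ v (.appArg t us [] :: E) => some (.ap σ (.app (.val t) ((us ++ [v]).map .val)) E)
  | .co σ v (.appArg t us (c :: ds) :: E) => some (.ev σ c (.appArg t (us ++ [v]) ds :: E))
  | .co σ v (.recordF us s ((s', c) :: ds) :: E) =>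
      some (.ev σ c (.recordF (us ++ [(s, v)]) s' ds :: E))
  | .co σ v (.getL c :: E) => some (.ev σ c (.getR v :: E))
  | .co σ v (.getR u :: E) => some (.ap σ (.get (.val u) (.val v)) E)
  | .co σ v (.setL c d :: E) => some (.ev σ c (.setM v d :: E))
  | .co σ v (.setM u c :: E) => some (.ev σ c (.setR u v :: E))
  | .co σ v (.setR u t :: E) => some (.ap σ (.set (.val u) (.val t) (.val v)) E)
  | .co σ v (.delL c :: E) => some (.ev σ c (.delR v :: E))
  | .co σ v (.delR u :: E) => some (.ap σ (.del (.val u) (.val v)) E)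
  | .co σ v (.refF :: E) => some (.ap σ (.ref (.val v)) E)
  | .co σ v (.derefF :: E) => some (.ap σ (.deref (.val v)) E)
  | .co σ v (.assignL c :: E) => some (.ev σ c (.assignR v :: E))
  | .co σ v (.assignR u :: E) => some (.ap σ (.assign (.val u) (.val v)) E)
  | .co σ v (.iteF c d :: E) => some (.ap σ (.ite (.val v) c d) E)
  | .co σ v (.throwF :: E) => some (.ap σ (.throw (.val v)) E)
  | .co σ v (.brkF l :: E) => some (.ap σ (.brk l (.val v)) E)
  | .co σ v (.opF o us [] :: E) => some (.ap σ (.op o ((us ++ [v]).map .val)) E)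
  | .co σ v (.opF o us (c :: ds) :: E) => some (.ev σ c (.opF o (us ++ [v]) ds :: E))
  -- What is left out contracts a redex, halts, or treats a control effect. Completing a record
  -- counts as a contraction, because the calculus spends a step on it.
  | _ => none

abbrev NavStar : JState S → JState S → Prop :=
  Relation.ReflTransGen fun s s' => nav s = some s'

variable (δ : Delta S) (msg : RuntimeError → String) (alloc : Alloc S)

abbrev JStar : JState S → JState S → Prop := Relation.ReflTransGen (JStep δ msg alloc)

theorem JStep.of_nav {s s' : JState S} (h : nav s = some s') : JStep δ msg alloc s s' := by
  unfold nav at h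
  split at h <;> cases h <;> constructor

variable {δ msg alloc}

theorem NavStar.jstar {s s' : JState S} (h : NavStar s s') : JStar δ msg alloc s s' :=
  h.lift id fun _ _ h => JStep.of_nav δ msg alloc h

/-- Navigation is deterministic. -/
theorem NavStar.to_normal {s a b : JState S} (ha : NavStar s a) (hb : NavStar s b)
    (hn : nav b = none) : NavStar a b := by
  induction ha using Relation.ReflTransGen.head_induction_on with
  | refl => exact hb
  | head h _ ih =>
    apply ih
    cases hb using Relation.ReflTransGen.head_induction_on with
    | refl => rw [hn] at h; cases h
    | head h' hb =>
      rw [h] at h'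
      cases h'
      exact hb

theorem NavStar.step {s s' s'' : JState S} (h : nav s = some s') (h' : NavStar s' s'') :
    NavStar s s'' := .head h h'

section Arrive
variable (τ : Store S (JVal S)) (E : JCtx S)

/-- Arguments that are already values are passed over one by one, each through an `ev` and a `co`
state. The prefix `us` grows on the way, hence the generality in `us` and `w`. -/
theorem nav_args (t : JVal S) (c : JClo S) (ds : List (JClo S)) (vs : List (JVal S)) :
    ∀ (us : List (JVal S)) (w : JVal S),
      NavStar (.co τ w (.appArg t us (vs.map .val ++ c :: ds) :: E))
        (.ev τ c (.appArg t (us ++ w :: vs) ds :: E)) := by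
  induction vs with
  | nil => exact fun us w => .step rfl .refl
  | cons v vs ih =>
    intro us w
    have := ih (us ++ [w]) v
    rw [List.append_assoc] at this
    exact .step rfl (.step rfl this)

theorem nav_args_end (t : JVal S) (vs : List (JVal S)) :
    ∀ (us : List (JVal S)) (w : JVal S),
      NavStar (.co τ w (.appArg t us (vs.map .val) :: E))
        (.ap τ (.app (.val t) ((us ++ w :: vs).map .val)) E) := by
  induction vs with
  | nil => exact fun us w => .step rfl .refl
  | cons v vs ih =>
    intro us w
    have := ih (us ++ [w]) v
    rw [List.append_assoc] at this
    exact .step rfl (.step rfl this)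

theorem nav_app (t : JVal S) (vs : List (JVal S)) :
    NavStar (.ev τ (.app (.val t) (vs.map .val)) E) (.ap τ (.app (.val t) (vs.map .val)) E) := by
  cases vs with
  | nil => exact .step rfl (.step rfl (.step rfl .refl))
  | cons v vs => exact .step rfl (.step rfl (.step rfl (.step rfl (nav_args_end τ E t vs [] v))))

theorem nav_operands (o : S.Op) (c : JClo S) (ds : List (JClo S)) (vs : List (JVal S)) :
    ∀ (us : List (JVal S)) (w : JVal S),
      NavStar (.co τ w (.opF o us (vs.map .val ++ c :: ds) :: E))
        (.ev τ c (.opF o (us ++ w :: vs) ds :: E)) := by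
  induction vs with
  | nil => exact fun us w => .step rfl .refl
  | cons v vs ih =>
    intro us w
    have := ih (us ++ [w]) v
    rw [List.append_assoc] at this
    exact .step rfl (.step rfl this)

theorem nav_operands_end (o : S.Op) (vs : List (JVal S)) :
    ∀ (us : List (JVal S)) (w : JVal S),
      NavStar (.co τ w (.opF o us (vs.map .val) :: E))
        (.ap τ (.op o ((us ++ w :: vs).map .val)) E) := by
  induction vs with
  | nil => exact fun us w => .step rfl .refl
  | cons v vs ih =>
    intro us w
    have := ih (us ++ [w]) v
    rw [List.append_assoc] at this
    exact .step rfl (.step rfl this)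

theorem nav_op (o : S.Op) (vs : List (JVal S)) :
    NavStar (.ev τ (.op o (vs.map .val)) E) (.ap τ (.op o (vs.map .val)) E) := by
  cases vs with
  | nil => exact .step rfl .refl
  | cons v vs => exact .step rfl (.step rfl (nav_operands_end τ E o vs [] v))

theorem nav_record_fields (s' : String) (c : JClo S) (ds : List (String × JClo S))
    (vs : List (String × JVal S)) :
    ∀ (us : List (String × JVal S)) (s : String) (w : JVal S),
      NavStar (.co τ w (.recordF us s (vs.map (fun p => (p.1, .val p.2)) ++ (s', c) :: ds) :: E))
        (.ev τ c (.recordF (us ++ (s, w) :: vs) s' ds :: E)) := by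
  induction vs with
  | nil => exact fun us s w => .step rfl .refl
  | cons p vs ih =>
    intro us s w
    have := ih (us ++ [(s, w)]) p.1 p.2
    rw [List.append_assoc] at this
    exact .step rfl (.step rfl this)

/-- Evaluation of a frame around a closure moves to the closure. -/
theorem nav_plugClo (F : Frame S (JClo S) (JVal S)) (c : JClo S) :
    NavStar (.ev τ (F.plugClo c) E) (.ev τ c (F :: E)) := by
  cases F with
  | appArg v vs ds =>
    cases vs with
    | nil => exact .step rfl (.step rfl (.step rfl .refl))
    | cons u us =>
      exact .step rfl (.step rfl (.step rfl (.step rfl (nav_args τ E v c ds us [] u))))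
  | recordF vs s ds =>
    cases vs with
    | nil => exact .step rfl .refl
    | cons p vs => exact .step rfl (.step rfl (nav_record_fields τ E s c ds vs [] p.1 p.2))
  | opF o vs ds =>
    cases vs with
    | nil => exact .step rfl .refl
    | cons u us => exact .step rfl (.step rfl (nav_operands τ E o c ds us [] u))
  | getR | setM | delR | assignR => exact .step rfl (.step rfl (.step rfl .refl))
  | setR => exact .step rfl (.step rfl (.step rfl (.step rfl (.step rfl .refl))))
  | _ => exact .step rfl .refl

/-- However a term is decomposed, its evaluation moves the focus to the hole. This replaces any
appeal to uniqueness of decompositions. -/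
theorem nav_plug (E' : JCtx S) (c : JClo S) :
    NavStar (.ev τ (plugJ E' c) E) (.ev τ c (E' ++ E)) := by
  induction E' generalizing c with
  | nil => exact .refl
  | cons F E' ih => exact (ih _).trans (nav_plugClo τ (E' ++ E) F c)

theorem nav_throw (v : JVal S) :
    NavStar (.ev τ (.throw (.val v)) E) (.ap τ (.throw (.val v)) E) :=
  .step rfl (.step rfl (.step rfl .refl))

theorem nav_brk (l : S.Lab) (v : JVal S) :
    NavStar (.ev τ (.brk l (.val v)) E) (.ap τ (.brk l (.val v)) E) :=
  .step rfl (.step rfl (.step rfl .refl))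

/-- A faulty redex is sent to the `ap` states. -/
theorem nav_fault {c : JClo S} {k : RuntimeError} (h : Fault c k) :
    NavStar (.ev τ c E) (.ap τ c E) := by
  cases h with
  | notFunction v vs => exact nav_app τ E v vs
  | arity xs e ρ vs => exact nav_app τ E _ vs
  | setRecord | setString =>
    exact .step rfl (.step rfl (.step rfl (.step rfl (.step rfl (.step rfl (.step rfl .refl))))))
  | notBoolean => exact .step rfl (.step rfl (.step rfl .refl))
  | deref => exact .step rfl (.step rfl (.step rfl .refl))
  | _ => exact .step rfl (.step rfl (.step rfl (.step rfl (.step rfl .refl))))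

end Arrive

end Navigation

/-! ### The machine simulates the calculus of explicit substitutions -/

section RhoToMachine
variable {S : Sig} {δ : Delta S} {msg : RuntimeError → String} {alloc : Alloc S}

/-- Otherwise a request for one address more than exist could not be met. The infinity is used to
choose fresh addresses, in the equivariance argument and for `ref` in the calculus. -/
theorem Alloc.Valid.infinite (h : alloc.Valid) : Infinite S.Addr := by
  by_contra hf
  rw [not_infinite_iff_finite] at hf
  have := Fintype.ofFinite S.Addr
  obtain ⟨hl, hn, _⟩ := h (.ans (.value ∅ (.const .null))) (Fintype.card S.Addr + 1)
  have := hn.length_le_card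
  omega

theorem Alloc.Valid.single (h : alloc.Valid) (s : JState S) :
    ∃ a, alloc s 1 = [a] ∧ a ∉ s.store := by
  obtain ⟨hl, _, hf⟩ := h s 1
  obtain ⟨a, ha⟩ := List.length_eq_one_iff.1 hl
  exact ⟨a, ha, hf a (by simp [ha])⟩

/-- The machine, in the state `s`, is about to contract the closure `c'` in the context `E'`: it
moves to a state in which its result is related to the closure `d` of the calculus. -/
def Contracts (δ : Delta S) (msg : RuntimeError → String) (alloc : Alloc S) (W : World S)
    (τ : Store S (JVal S)) (c' : JClo S) (E' : JCtx S) (σ' : Store S (RVal S)) (d : RClo S) :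
    Prop :=
  ∃ X s W' τ' d', NavStar (.ev τ c' E') X ∧ nav X = none ∧ JStar δ msg alloc X s ∧
    NavStar (.ev τ' d' E') s ∧ W.Le W' ∧ StoreRel W' σ' τ' ∧ CloRel W' d d'

variable {W : World S} {σ : Store S (RVal S)} {τ : Store S (JVal S)}

theorem Contracts.of_step {c' : JClo S} {E' : JCtx S} {d : RClo S} {d' : JClo S} {X s : JState S}
    (hs : StoreRel W σ τ) (h : NavStar (.ev τ c' E') X) (hX : nav X = none)
    (hXs : JStep δ msg alloc X s) (hd : NavStar (.ev τ d' E') s) (hc : CloRel W d d') :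
    Contracts δ msg alloc W τ c' E' σ d :=
  ⟨X, s, W, τ, d', h, hX, .single hXs, hd, .refl W, hs, hc⟩

/-- A transition into a `co` state bypasses the `ev` state of the value returned. This is one reason
why results are compared only up to navigation. -/
theorem Contracts.of_value {c' : JClo S} {E' : JCtx S} {v : RVal S} {w : JVal S} {X : JState S}
    (hs : StoreRel W σ τ) (h : NavStar (.ev τ c' E') X) (hX : nav X = none)
    (hXs : JStep δ msg alloc X (.co τ w E')) (hc : VRel W v w) :
    Contracts δ msg alloc W τ c' E' σ (.val v) :=
  .of_step hs h hX hXs (.step rfl .refl) (.val v w hc)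

theorem fields_split_left {fs fs' : List (String × RVal S)} {s : String} {v : RVal S}
    {gs : List (String × JVal S)}
    (h : List.Forall₂ (PairRel (VRel W)) (fs ++ (s, v) :: fs') gs) :
    ∃ hs w hs', gs = hs ++ (s, w) :: hs' ∧ List.Forall₂ (PairRel (VRel W)) fs hs ∧ VRel W v w ∧
      List.Forall₂ (PairRel (VRel W)) fs' hs' := by
  obtain ⟨hs, l, rfl, h1, h2⟩ := forall₂_append_left h
  cases h2 with
  | cons h2 h3 => cases h2 with | mk _ _ w h2 => exact ⟨hs, w, _, rfl, h1, h2, h3⟩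

theorem fields_split_right {fs fs' : List (String × JVal S)} {s : String} {w : JVal S}
    {gs : List (String × RVal S)}
    (h : List.Forall₂ (PairRel (VRel W)) gs (fs ++ (s, w) :: fs')) :
    ∃ hs v hs', gs = hs ++ (s, v) :: hs' ∧ List.Forall₂ (PairRel (VRel W)) hs fs ∧ VRel W v w ∧
      List.Forall₂ (PairRel (VRel W)) hs' fs' := by
  obtain ⟨hs, l, rfl, h1, h2⟩ := forall₂_append_right h
  cases h2 with
  | cons h2 h3 => cases h2 with | mk _ w _ h2 => exact ⟨hs, w, _, rfl, h1, h2, h3⟩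

theorem fields_names {α β : Type} {r : α → β → Prop} {fs : List (String × α)}
    {gs : List (String × β)} (h : List.Forall₂ (PairRel r) fs gs) :
    fs.map Prod.fst = gs.map Prod.fst := by
  induction h with
  | nil => rfl
  | cons h _ ih => cases h with | mk s a b h => simp [ih]

theorem vRel_errVal (k : RuntimeError) : VRel W (errVal msg k) (errVal msg k) := .const _

theorem fields_cons {fs gs fs' gs'} {s : String} {v w}
    (h : List.Forall₂ (PairRel (VRel W)) fs gs) (hv : VRel W v w)
    (h' : List.Forall₂ (PairRel (VRel W)) fs' gs') :
    List.Forall₂ (PairRel (VRel W)) (fs ++ (s, v) :: fs') (gs ++ (s, w) :: gs') :=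
  forall₂_append h (.cons (.mk s v w hv) h')

/-- For each rule, relatedness forces the shape of the machine closure, navigation leads to the
corresponding redex, and a single transition contracts it. Among these rules only `let` and
application enlarge the world and the store. -/
theorem rhoRed_contracts (hδ : δ.Equivariant) (halloc : alloc.Valid)
    (hs : StoreRel W σ τ) {c d : RClo S} {c' : JClo S} (E' : JCtx S)
    (hc : CloRel W c c') (hr : RhoRed δ msg c d) : Contracts δ msg alloc W τ c' E' σ d := by
  have := halloc.infinite
  cases hr with
  | propagate e ρ c hp =>
    cases hc with
    | clos _ _ η he hη =>
      obtain ⟨d', hd'⟩ := propagate_other η hp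
      exact .of_step hs .refl (by cases hp <;> rfl) (.evPropagate _ _ _ _ _ hd') .refl
        (propagate_rel hη he hp hd')
  | record fs =>
    cases hc with
    | record _ gs h =>
      obtain ⟨ws, rfl, hws⟩ := cloRel_fields_left h
      -- The machine completes an empty record at once, and any other record when its last field
      -- returns.
      rcases List.eq_nil_or_concat ws with rfl | ⟨us, p, rfl⟩
      · exact .of_value hs .refl rfl (.evRecordNil _ _) (.record _ _ hws)
      · refine .of_value (w := .record (us ++ [(p.1, p.2)])) hs
          (X := .co τ p.2 (.recordF us p.1 [] :: E')) ?_ rfl (.coRecordLast _ _ _ _ _)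
          (.record _ _ (by simpa using hws))
        have := (nav_plugClo τ E' (.recordF us p.1 []) (.val p.2)).tail
          (c := .co τ p.2 (.recordF us p.1 [] :: E')) rfl
        simpa [Frame.plugClo] using this
  | var x ρ v hv =>
    cases hc with
    | clos _ _ η he hη =>
      obtain ⟨b, hb, hbd⟩ := hη.lookup_left hv
      obtain ⟨w, hw, hvw⟩ := hs.bound b v hbd
      exact .of_value hs (.step rfl .refl) rfl (.apVar _ _ _ _ b w hb hw) hvw
  | letE x v e ρ =>
    cases hc with
    | letE _ _ _ _ _ hv hd =>
      cases hv with
      | val _ w hv =>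
        cases hd with
        | clos _ _ η he hη =>
          obtain ⟨a, ha, hfr⟩ := halloc.single (.ap τ (.letE x (.val w) (.clos e η)) E')
          obtain ⟨W', hle, hs', hb⟩ := hs.bindList (bs := [a]) (by simp) (by simpa [JState.store] using hfr)
            (.cons hv .nil) rfl
          exact ⟨_, _, W', _, _, .step rfl (.step rfl (.step rfl .refl)), rfl,
            .single (.apLet _ _ _ _ _ _ a ha), .refl, hle, hs',
            .clos _ _ _ he ((hη.mono hle).extend (xs := [x]) hb)⟩
  | app xs e ρ vs hl =>
    cases hc with
    | app _ _ _ _ hf hvs =>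
      cases hf with
      | val _ w hf =>
        cases hf with
        | fn _ _ η he hη =>
          obtain ⟨ws, rfl, hws⟩ := cloRel_vals_left hvs
          obtain ⟨hal, han, haf⟩ := halloc
            (.ap τ (.app (.val (.fn (⟨xs, e⟩, η))) (ws.map .val)) E') xs.length
          obtain ⟨W', hle, hs', hb⟩ := hs.bindList han haf hws (hal.trans hl)
          exact ⟨_, _, W', _, _, nav_app τ E' _ ws, rfl,
            .single (.apApp _ _ _ _ _ _ _ (hl.trans hws.length_eq) rfl),
            .refl, hle, hs', .clos _ _ _ he ((hη.mono hle).extend hb)⟩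
  | get fs fs' s v =>
    cases hc with
    | get _ _ _ _ h h' =>
      cases h with
      | val _ _ h =>
        cases h' with
        | val _ _ h' =>
          cases h'
          cases h with
          | record _ _ h =>
            obtain ⟨gs, w, gs', rfl, _, hv, _⟩ := fields_split_left h
            exact .of_value hs (.step rfl (.step rfl (.step rfl (.step rfl (.step rfl .refl))))) rfl
              (.apGet _ _ _ _ _ _) hv
  | getNone fs s hn =>
    cases hc with
    | get _ _ _ _ h h' =>
      cases h with
      | val _ _ h =>
        cases h' with
        | val _ _ h' =>
          cases h'
          cases h with
          | record _ _ h =>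
            exact .of_value hs (.step rfl (.step rfl (.step rfl (.step rfl (.step rfl .refl))))) rfl
              (.apGetNone _ _ _ _ (by rwa [← fields_names h])) (.const _)
  | set fs fs' s u v =>
    cases hc with
    | set _ _ _ _ _ _ h h' h'' =>
      cases h with
      | val _ _ h =>
        cases h' with
        | val _ _ h' =>
          cases h'' with
          | val _ _ hv =>
            cases h'
            cases h with
            | record _ _ h =>
              obtain ⟨gs, w, gs', rfl, h1, _, h2⟩ := fields_split_left h
              exact .of_value hs (.step rfl (.step rfl (.step rfl (.step rfl (.step rfl
                (.step rfl (.step rfl .refl))))))) rfl (.apSet _ _ _ _ _ _ _)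
                (.record _ _ (fields_cons h1 hv h2))
  | setNew fs s v hn =>
    cases hc with
    | set _ _ _ _ _ _ h h' h'' =>
      cases h with
      | val _ _ h =>
        cases h' with
        | val _ _ h' =>
          cases h'' with
          | val _ _ hv =>
            cases h'
            cases h with
            | record _ _ h =>
              exact .of_value hs (.step rfl (.step rfl (.step rfl (.step rfl (.step rfl
                (.step rfl (.step rfl .refl))))))) rfl
                (.apSetNew _ _ _ _ _ (by rwa [← fields_names h]))
                (.record _ _ (.cons (.mk _ _ _ hv) h))
  | del fs fs' s u =>
    cases hc with
    | del _ _ _ _ h h' =>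
      cases h with
      | val _ _ h =>
        cases h' with
        | val _ _ h' =>
          cases h'
          cases h with
          | record _ _ h =>
            obtain ⟨gs, w, gs', rfl, h1, _, h2⟩ := fields_split_left h
            exact .of_value hs (.step rfl (.step rfl (.step rfl (.step rfl (.step rfl .refl))))) rfl
              (.apDel _ _ _ _ _ _) (.record _ _ (forall₂_append h1 h2))
  | delNone fs s hn =>
    cases hc with
    | del _ _ _ _ h h' =>
      cases h with
      | val _ _ h =>
        cases h' with
        | val _ _ h' =>
          cases h'
          cases h with
          | record _ _ h =>
            exact .of_value hs (.step rfl (.step rfl (.step rfl (.step rfl (.step rfl .refl))))) rfl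
              (.apDelNone _ _ _ _ (by rwa [← fields_names h])) (.record _ _ h)
  | iteTrue c d =>
    cases hc with
    | ite _ _ _ _ _ _ h h' h'' =>
      cases h with
      | val _ _ h =>
        cases h
        exact .of_step hs (.step rfl (.step rfl (.step rfl .refl))) rfl (.apIteTrue _ _ _ _) .refl h'
  | iteFalse c d =>
    cases hc with
    | ite _ _ _ _ _ _ h h' h'' =>
      cases h with
      | val _ _ h =>
        cases h
        exact .of_step hs (.step rfl (.step rfl (.step rfl .refl))) rfl (.apIteFalse _ _ _ _) .refl
          h''
  | seq v c =>
    cases hc with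
    | seq _ _ _ _ h h' =>
      cases h with
      | val _ _ h => exact .of_step hs (.step rfl (.step rfl .refl)) rfl (.coSeq _ _ _ _) .refl h'
  | tryCatch v x c =>
    cases hc with
    | tryCatch _ _ _ _ _ h h' =>
      cases h with
      | val _ _ h => exact .of_value hs (.step rfl (.step rfl .refl)) rfl (.coCatch _ _ _ _ _) h
  | tryFinally v c =>
    cases hc with
    | tryFinally _ _ _ _ h h' =>
      cases h with
      | val _ _ h =>
        exact .of_step hs (.step rfl (.step rfl .refl)) rfl (.coFinally _ _ _ _) .refl
          (.seq _ _ _ _ h' (.val _ _ h))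
  | label l v =>
    cases hc with
    | label _ _ _ h =>
      cases h with
      | val _ _ h => exact .of_value hs (.step rfl (.step rfl .refl)) rfl (.coLabel _ _ _ _) h
  | op o vs r hr =>
    cases hc with
    | op _ _ _ h =>
      obtain ⟨ws, rfl, hvs⟩ := cloRel_vals_left h
      rcases delta_rel hδ hs (o := o) hvs with ⟨r₁, r', h1, h2, h3⟩ | ⟨r₁, r', h1, h2, h3⟩
      · rw [hr] at h1
        cases h1
        exact .of_value hs (nav_op τ E' o ws) rfl (.apOp _ _ _ _ _ h2) h3
      · rw [hr] at h1
        cases h1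
  | opError o vs r hr =>
    cases hc with
    | op _ _ _ h =>
      obtain ⟨ws, rfl, hvs⟩ := cloRel_vals_left h
      rcases delta_rel hδ hs (o := o) hvs with ⟨r₁, r', h1, h2, h3⟩ | ⟨r₁, r', h1, h2, h3⟩
      · rw [hr] at h1
        cases h1
      · rw [hr] at h1
        cases h1
        exact .of_step hs (nav_op τ E' o ws) rfl (.apOpError _ _ _ _ _ h2) (nav_throw _ _ _)
          (.throw _ _ (.val _ _ h3))
  | fault c k hf =>
    have hf' := fault_left hc hf
    exact .of_step hs (nav_fault τ E' hf') rfl (.apFault _ _ _ _ hf') (nav_throw _ _ _)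
      (.throw _ _ (.val _ _ (vRel_errVal k)))
  -- The remaining rule unfolds `while`. The transition of the machine also enters the test, which
  -- is one navigation step beyond the unfolded term.
  | _ =>
    cases hc
    rename_i h h'
    exact .of_step hs .refl rfl (.evWhile _ _ _ _) (.step rfl .refl)
      (.ite _ _ _ _ _ _ h (.seq _ _ _ _ h' (.while _ _ _ _ h h')) (.val _ _ (.const _)))

/-- Exceptions leave the local frames. -/
theorem throw_local {C : JCtx S} (hC : C.IsLocal) (E : JCtx S) (v : JVal S) :
    JStar δ msg alloc (.ap τ (.throw (.val v)) (C ++ E)) (.ap τ (.throw (.val v)) E) := by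
  induction C with
  | nil => exact .refl
  | cons F C ih =>
    exact .head (.apThrowLocal _ _ _ _ (hC F (by simp))) (ih fun G hG => hC G (by simp [hG]))

/-- Breaks leave the local frames. -/
theorem brk_local {C : JCtx S} (hC : C.IsLocal) (E : JCtx S) (l : S.Lab) (v : JVal S) :
    JStar δ msg alloc (.ap τ (.brk l (.val v)) (C ++ E)) (.ap τ (.brk l (.val v)) E) := by
  induction C with
  | nil => exact .refl
  | cons F C ih =>
    exact .head (.apBrkLocal _ _ _ _ _ (hC F (by simp))) (ih fun G hG => hC G (by simp [hG]))

/-- The machine state `s` represents a configuration of the calculus. -/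
inductive MachineRel : Conf S (RClo S) (RVal S) → JState S → Prop
  | run (W : World S) (σ : Store S (RVal S)) (τ : Store S (JVal S)) (c : RClo S) (c' : JClo S)
      (s : JState S) : NavStar (.ev τ c' []) s → CloRel W c c' → StoreRel W σ τ →
      MachineRel (.run σ c) s
  | err (W : World S) (σ : Store S (RVal S)) (τ : Store S (JVal S)) (v : RVal S) (w : JVal S) :
      VRel W v w → StoreRel W σ τ → MachineRel (.err σ v) (.ans (.error τ w))

theorem nav_plug_nil (E' : JCtx S) (c : JClo S) :
    NavStar (.ev τ (plugJ E' c) []) (.ev τ c E') := by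
  simpa using nav_plug τ [] E' c

/-- Contraction in a context. -/
theorem Contracts.machineRel {E : RCtx S} {E' : JCtx S} {c' : JClo S} {d : RClo S} {s : JState S}
    {σ' : Store S (RVal S)} (h : Contracts δ msg alloc W τ c' E' σ' d)
    (hn : NavStar (.ev τ (plugJ E' c') []) s) (hE : CtxRel W E E') :
    ∃ s', JStar δ msg alloc s s' ∧ MachineRel (.run σ' (plug E d)) s' := by
  obtain ⟨X, s', W', τ', d', h1, h2, h3, h4, h5, h6, h7⟩ := h
  refine ⟨s', (hn.to_normal ((nav_plug_nil E' c').trans h1) h2).jstar.trans h3, ?_⟩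
  exact .run W' _ τ' _ (plugJ E' d') _ ((nav_plug_nil E' d').trans h4)
    (cloRel_plug (hE.mono h5) h7) h6

/-- At the redex the stack is still `C ++ F :: E`. The machine then drops the frames of `C` one at a
time, whereas the calculus removes them together with `F`. -/
theorem throw_arrive {E C : JCtx S} {F : Frame S (JClo S) (JVal S)} {v : JVal S} {s : JState S}
    (hC : C.IsLocal)
    (hn : NavStar (.ev τ (plugJ E (F.plugClo (plugJ C (.throw (.val v))))) []) s) :
    JStar δ msg alloc s (.ap τ (.throw (.val v)) (F :: E)) := by
  refine .trans (NavStar.jstar (hn.to_normal (b := .ap τ (.throw (.val v)) (C ++ F :: E)) ?_ rfl))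
    (throw_local hC _ v)
  exact ((nav_plug_nil E _).trans (nav_plugClo τ E F _)).trans
    ((nav_plug τ (F :: E) C _).trans (nav_throw _ _ _))

theorem brk_arrive {E C : JCtx S} {F : Frame S (JClo S) (JVal S)} {l : S.Lab} {v : JVal S}
    {s : JState S} (hC : C.IsLocal)
    (hn : NavStar (.ev τ (plugJ E (F.plugClo (plugJ C (.brk l (.val v))))) []) s) :
    JStar δ msg alloc s (.ap τ (.brk l (.val v)) (F :: E)) := by
  refine .trans (NavStar.jstar (hn.to_normal (b := .ap τ (.brk l (.val v)) (C ++ F :: E)) ?_ rfl))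
    (brk_local hC _ l v)
  exact ((nav_plug_nil E _).trans (nav_plugClo τ E F _)).trans
    ((nav_plug τ (F :: E) C _).trans (nav_brk _ _ _ _))

/-- Inversion for a control effect below a control frame. -/
theorem cloRel_control {E C : RCtx S} {F : Frame S (RClo S) (RVal S)} {c : RClo S} {d : JClo S}
    (hC : C.IsLocal) (h : CloRel W (plug E (F.plugClo (plug C c))) d) :
    ∃ E' F' C' c', d = plugJ E' (F'.plugClo (plugJ C' c')) ∧ CtxRel W E E' ∧ FRel W F F' ∧
      C'.IsLocal ∧ CloRel W c c' := by
  obtain ⟨E', _, rfl, hE, h⟩ := cloRel_plug_left h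
  obtain ⟨F', _, rfl, hF, h⟩ := cloRel_plugClo_left h
  obtain ⟨C', c', rfl, hC', h⟩ := cloRel_plug_left h
  exact ⟨E', F', C', c', rfl, hE, hF, (isLocal_of_forall₂ hC').1 hC, h⟩

/-- One step of the calculus may cost many transitions: navigation to the redex, the dropping of
local frames, and the contraction. The context of the step is carried over to the machine, so the
way in which the term is decomposed does not matter. -/
theorem machineRel_step (hδ : δ.Equivariant) (halloc : alloc.Valid)
    {x y : Conf S (RClo S) (RVal S)} {s : JState S} (h : MachineRel x s)
    (hxy : RhoStep δ msg x y) : ∃ s', JStar δ msg alloc s s' ∧ MachineRel y s' := by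
  have := halloc.infinite
  cases h with
  | err => cases hxy
  | run W σ τ t t' s hn hc hs =>
    cases hxy with
    | red _ E c c' hr =>
      obtain ⟨E', c', rfl, hE, hk⟩ := cloRel_plug_left hc
      exact (rhoRed_contracts hδ halloc hs E' hk hr).machineRel hn hE
    | ref _ E v a ha =>
      obtain ⟨E', _, rfl, hE, hk⟩ := cloRel_plug_left hc
      cases hk with
      | ref _ _ hk =>
        cases hk with
        | val _ w hv =>
          -- The calculus has chosen `a` and the allocator chooses `b`; the new world matches the
          -- two.
          obtain ⟨b, hb, hfr⟩ := halloc.single (.ap τ (.ref (.val w)) E')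
          obtain ⟨W', hle, hs', hab⟩ := hs.ref ha hfr hv
          exact Contracts.machineRel (W := W) ⟨_, _, W', _, _, .step rfl (.step rfl (.step rfl .refl)), rfl,
            .single (.apRef _ _ _ b hb), .step rfl .refl, hle, hs', .val _ _ (.addr _ _ hab)⟩ hn hE
    | deref _ E a v hv =>
      obtain ⟨E', _, rfl, hE, hk⟩ := cloRel_plug_left hc
      cases hk with
      | deref _ _ hk =>
        cases hk with
        | val _ w hw =>
          cases hw with
          | addr _ b hab =>
            obtain ⟨v', w, h1, h2, h3⟩ := hs.cell a b hab
            rw [hv] at h1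
            cases h1
            exact (Contracts.of_value hs (.step rfl (.step rfl (.step rfl .refl))) rfl
              (.apDeref _ _ _ _ h2) h3).machineRel hn hE
    | assign _ E a v =>
      obtain ⟨E', _, rfl, hE, hk⟩ := cloRel_plug_left hc
      cases hk with
      | assign _ _ _ _ hk hv =>
        cases hk with
        | val _ w hw =>
          cases hv with
          | val _ u hv =>
            cases hw with
            | addr _ b hab =>
              exact Contracts.machineRel (W := W) ⟨_, _, W, _, _,
                .step rfl (.step rfl (.step rfl (.step rfl (.step rfl .refl)))), rfl,
                .single (.apAssign _ _ _ _), .step rfl .refl, .refl W, hs.assign hab hv,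
                .val _ _ hv⟩ hn hE
    | uncaught _ C v hC =>
      obtain ⟨C', _, rfl, hC', hk⟩ := cloRel_plug_left hc
      cases hk with
      | throw _ _ hk =>
        cases hk with
        | val _ w hv =>
          refine ⟨.ans (.error τ w), ?_, .err W σ τ v w hv hs⟩
          have hl := throw_local (δ := δ) (msg := msg) (alloc := alloc) (τ := τ)
            ((isLocal_of_forall₂ hC').1 hC) [] w
          rw [List.append_nil] at hl
          exact (NavStar.jstar (hn.to_normal ((nav_plug_nil C' _).trans (nav_throw _ _ _)) rfl)).trans
            (hl.tail (.apThrowNil _ _))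
    | throwCatch _ E C v x e ρ hC =>
      obtain ⟨E', F', C', _, rfl, hE, hF, hC', hk⟩ := cloRel_control (F := .catchF x _) hC hc
      cases hk with
      | throw _ _ hk =>
        cases hk with
        | val _ w hv =>
          cases hF with
          | catchF _ _ _ hd =>
            cases hd with
            | clos _ _ η he hη =>
              obtain ⟨b, hb, hfr⟩ := halloc.single
                (.ap τ (.throw (.val w)) (.catchF x (.clos e η) :: E'))
              obtain ⟨W', hle, hs', hbd⟩ := hs.bindList (bs := [b]) (by simp) (by simpa [JState.store] using hfr)
                (.cons hv .nil) rfl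
              exact ⟨_, (throw_arrive hC' hn).tail (.apThrowCatch _ _ _ _ _ _ b hb),
                .run W' _ _ _ _ _ (nav_plug_nil _ _) (cloRel_plug (hE.mono hle)
                  (.clos _ _ _ he ((hη.mono hle).extend (xs := [x]) hbd))) hs'⟩
    | throwFinally _ E C v c hC =>
      obtain ⟨E', F', C', _, rfl, hE, hF, hC', hk⟩ := cloRel_control (F := .finallyF _) hC hc
      cases hk with
      | throw _ _ hk =>
        cases hF with
        | finallyF _ _ hd =>
          cases hk with
          | val _ w hv =>
            exact ⟨_, (throw_arrive hC' hn).tail (.apThrowFinally _ _ _ _),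
              .run W _ _ _ _ _ (nav_plug_nil _ _)
                (cloRel_plug hE (.seq _ _ _ _ hd (.throw _ _ (.val _ _ hv)))) hs⟩
    | throwLabel _ E C v l hC =>
      obtain ⟨E', F', C', _, rfl, hE, hF, hC', hk⟩ := cloRel_control (F := .labelF l) hC hc
      cases hk with
      | throw _ _ hk =>
        cases hF
        cases hk with
        | val _ w hv =>
          exact ⟨_, (throw_arrive hC' hn).tail (.apThrowLabel _ _ _ _),
            .run W _ _ _ _ _ ((nav_plug_nil _ _).trans (nav_throw _ _ _))
              (cloRel_plug hE (.throw _ _ (.val _ _ hv))) hs⟩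
    | brkCatch _ E C l v x c hC =>
      obtain ⟨E', F', C', _, rfl, hE, hF, hC', hk⟩ := cloRel_control (F := .catchF x _) hC hc
      cases hk with
      | brk _ _ _ hk =>
        cases hF
        cases hk with
        | val _ w hv =>
          exact ⟨_, (brk_arrive hC' hn).tail (.apBrkCatch _ _ _ _ _ _),
            .run W _ _ _ _ _ (nav_plug_nil _ _)
              (cloRel_plug hE (.brk _ _ _ (.val _ _ hv))) hs⟩
    | brkFinally _ E C l v c hC =>
      obtain ⟨E', F', C', _, rfl, hE, hF, hC', hk⟩ := cloRel_control (F := .finallyF _) hC hc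
      cases hk with
      | brk _ _ _ hk =>
        cases hF with
        | finallyF _ _ hd =>
          cases hk with
          | val _ w hv =>
            exact ⟨_, (brk_arrive hC' hn).tail (.apBrkFinally _ _ _ _ _),
              .run W _ _ _ _ _ (nav_plug_nil _ _)
                (cloRel_plug hE (.seq _ _ _ _ hd (.brk _ _ _ (.val _ _ hv)))) hs⟩
    | brkLabel _ E C l v hC =>
      obtain ⟨E', F', C', _, rfl, hE, hF, hC', hk⟩ := cloRel_control (F := .labelF l) hC hc
      cases hk with
      | brk _ _ _ hk =>
        cases hF
        cases hk with
        | val _ w hv =>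
          exact ⟨_, (brk_arrive hC' hn).tail (.apBrkLabel _ _ _ _),
            .run W _ _ _ _ _ ((nav_plug_nil _ _).tail rfl) (cloRel_plug hE (.val _ _ hv)) hs⟩
    | brkOther _ E C l l' v hC hne =>
      obtain ⟨E', F', C', _, rfl, hE, hF, hC', hk⟩ := cloRel_control (F := .labelF l') hC hc
      cases hk with
      | brk _ _ _ hk =>
        cases hF
        cases hk with
        | val _ w hv =>
          exact ⟨_, (brk_arrive hC' hn).tail (.apBrkOther _ _ _ _ _ hne),
            .run W _ _ _ _ _ ((nav_plug_nil _ _).trans (nav_brk _ _ _ _))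
              (cloRel_plug hE (.brk _ _ _ (.val _ _ hv))) hs⟩
    | brkUnmatched _ C l v hC =>
      obtain ⟨C', _, rfl, hC', hk⟩ := cloRel_plug_left hc
      cases hk with
      | brk _ _ _ hk =>
        cases hk with
        | val _ w hv =>
          have hl := brk_local (δ := δ) (msg := msg) (alloc := alloc) (τ := τ)
            ((isLocal_of_forall₂ hC').1 hC) [] l w
          rw [List.append_nil] at hl
          exact ⟨_, (NavStar.jstar (hn.to_normal ((nav_plug_nil C' _).trans (nav_brk _ _ _ _))
            rfl)).trans (hl.tail (.apBrkNil _ _ _)),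
            .run W _ _ _ _ _ (nav_throw _ _ _) (.throw _ _ (.val _ _ (vRel_errVal _))) hs⟩

theorem envRel_empty (W : World S) : EnvRel W .empty [] := fun _ => .none

theorem jamEval_of_rhoEval (hδ : δ.Equivariant) (halloc : alloc.Valid)
    {e : Exp S} (he : e.addrs = ∅) {B : Answer S (RVal S)}
    (h : RhoEval δ msg e B) : ∃ C, JAMEval δ msg alloc e C ∧ SameAnswer B C := by
  have key : ∀ y, Relation.ReflTransGen (RhoStep δ msg) (injJS e) y →
      ∃ s, JStar δ msg alloc (injJAM e) s ∧ MachineRel y s := by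
    intro y hy
    induction hy with
    | refl =>
      exact ⟨_, .refl, .run _ _ _ _ _ _ .refl (.clos e _ _ he (envRel_empty _)) .empty⟩
    | tail _ hxy ih =>
      obtain ⟨s, h1, h2⟩ := ih
      obtain ⟨s', h3, h4⟩ := machineRel_step hδ halloc h2 hxy
      exact ⟨s', h1.trans h3, h4⟩
  obtain ⟨s, h1, h2⟩ := key _ h
  cases B with
  | value σ v =>
    simp only [Answer.toRho] at h2
    cases h2 with
    | run W _ τ _ c' s hn hc hs =>
      cases hc with
      | val _ w hv =>
        -- From a value on the empty stack, navigation can only end in the `co` state, and from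
        -- there the machine halts.
        exact ⟨.value τ w, (h1.trans (hn.to_normal (b := .co τ w []) (.step rfl .refl)
          rfl).jstar).tail (.coNil _ _), hs.sameAnswer_value hv⟩
  | error σ v =>
    simp only [Answer.toRho] at h2
    cases h2 with
    | err W _ τ _ w hv hs => exact ⟨_, h1, hs.sameAnswer_error hv⟩

end RhoToMachine

/-! ### The calculus of explicit substitutions simulates the machine -/

section MachineToRho
variable {S : Sig} {δ : Delta S} {msg : RuntimeError → String} {alloc : Alloc S}

/-- The configuration `x` represents the closure `d` in the machine store `τ`. -/
def Rep (x : Conf S (RClo S) (RVal S)) (τ : Store S (JVal S)) (d : JClo S) : Prop :=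
  ∃ W σ c, x = .run σ c ∧ CloRel W c d ∧ StoreRel W σ τ

/-- The configuration `x` represents the machine state.  While a control effect is being
propagated, the local frames discarded by the machine are still present in the calculus. -/
inductive LoadRel (x : Conf S (RClo S) (RVal S)) : JState S → Prop
  | ev (τ : Store S (JVal S)) (c : JClo S) (E : JCtx S) : Rep x τ (plugJ E c) →
      LoadRel x (.ev τ c E)
  | co (τ : Store S (JVal S)) (v : JVal S) (E : JCtx S) : Rep x τ (plugJ E (.val v)) →
      LoadRel x (.co τ v E)
  | ap (τ : Store S (JVal S)) (c : JClo S) (E : JCtx S) : Rep x τ (plugJ E c) →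
      LoadRel x (.ap τ c E)
  | throw (τ : Store S (JVal S)) (v : JVal S) (C E : JCtx S) : C.IsLocal →
      Rep x τ (plugJ (C ++ E) (.throw (.val v))) → LoadRel x (.ap τ (.throw (.val v)) E)
  | brk (τ : Store S (JVal S)) (l : S.Lab) (v : JVal S) (C E : JCtx S) : C.IsLocal →
      Rep x τ (plugJ (C ++ E) (.brk l (.val v))) → LoadRel x (.ap τ (.brk l (.val v)) E)
  | value (W : World S) (σ : Store S (RVal S)) (τ : Store S (JVal S)) (v : RVal S) (w : JVal S) :
      x = .run σ (.val v) → VRel W v w → StoreRel W σ τ → LoadRel x (.ans (.value τ w))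
  | error (W : World S) (σ : Store S (RVal S)) (τ : Store S (JVal S)) (v : RVal S) (w : JVal S) :
      x = .err σ v → VRel W v w → StoreRel W σ τ → LoadRel x (.ans (.error τ w))

variable {x : Conf S (RClo S) (RVal S)}

/-- Moving the focus only shifts the boundary between stack and focus, so the plugged term stays the
same. -/
theorem LoadRel.nav {s s' : JState S} (h : LoadRel x s) (hn : JSCalc.nav s = some s') :
    LoadRel x s' := by
  unfold JSCalc.nav at hn
  split at hn <;> cases hn <;> cases h <;> constructor <;>
    simpa [plugJ, Frame.plugClo] using ‹Rep x _ _›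

theorem LoadRel.rep_ap {τ : Store S (JVal S)} {c : JClo S} {E : JCtx S}
    (h : LoadRel x (.ap τ c E)) (h1 : ∀ v, c ≠ .throw v) (h2 : ∀ l v, c ≠ .brk l v) :
    Rep x τ (plugJ E c) := by
  cases h with
  | ap _ _ _ h => exact h
  | throw => exact absurd rfl (h1 _)
  | brk => exact absurd rfl (h2 _ _)

/-- When no frame has been dropped yet, the dropped context is taken to be empty; this brings both
kinds of representation into one form. -/
theorem LoadRel.rep_throw {τ : Store S (JVal S)} {v : JVal S} {E : JCtx S}
    (h : LoadRel x (.ap τ (.throw (.val v)) E)) :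
    ∃ C : JCtx S, C.IsLocal ∧ Rep x τ (plugJ (C ++ E) (.throw (.val v))) := by
  cases h with
  | ap _ _ _ h => exact ⟨[], by simp [Ctx.IsLocal], h⟩
  | throw _ _ C _ hC h => exact ⟨C, hC, h⟩

theorem LoadRel.rep_brk {τ : Store S (JVal S)} {l : S.Lab} {v : JVal S} {E : JCtx S}
    (h : LoadRel x (.ap τ (.brk l (.val v)) E)) :
    ∃ C : JCtx S, C.IsLocal ∧ Rep x τ (plugJ (C ++ E) (.brk l (.val v))) := by
  cases h with
  | ap _ _ _ h => exact ⟨[], by simp [Ctx.IsLocal], h⟩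
  | brk _ _ _ C _ hC h => exact ⟨C, hC, h⟩

abbrev RhoStar (δ : Delta S) (msg : RuntimeError → String) :
    Conf S (RClo S) (RVal S) → Conf S (RClo S) (RVal S) → Prop :=
  Relation.ReflTransGen (RhoStep δ msg)

/-- The simulation of a transition is reduced to a statement about its focus. The surrounding
context stays related in the larger world by monotonicity. -/
theorem Rep.step {τ τ' : Store S (JVal S)} {E : JCtx S} {c' d' : JClo S}
    (h : Rep x τ (plugJ E c'))
    (H : ∀ W σ c E', CloRel W c c' → StoreRel W σ τ → ∃ W' σ' d,
      RhoStep δ msg (.run σ (plug E' c)) (.run σ' (plug E' d)) ∧ W.Le W' ∧ StoreRel W' σ' τ' ∧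
      CloRel W' d d') :
    ∃ y, RhoStar δ msg x y ∧ Rep y τ' (plugJ E d') := by
  obtain ⟨W, σ, t, rfl, hc, hs⟩ := h
  obtain ⟨E', c, rfl, hE, hk⟩ := cloRel_plug_right hc
  obtain ⟨W', σ', d, h1, h2, h3, h4⟩ := H W σ c E' hk hs
  exact ⟨_, .single h1, W', σ', _, rfl, cloRel_plug (hE.mono h2) h4, h3⟩

theorem Rep.red {τ : Store S (JVal S)} {E : JCtx S} {c' d' : JClo S} (h : Rep x τ (plugJ E c'))
    (H : ∀ W σ c, CloRel W c c' → StoreRel W σ τ → ∃ d, RhoRed δ msg c d ∧ CloRel W d d') :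
    ∃ y, RhoStar δ msg x y ∧ Rep y τ (plugJ E d') :=
  h.step fun W σ c _ hc hs =>
    let ⟨d, h1, h2⟩ := H W σ c hc hs
    ⟨W, σ, d, .red _ _ _ _ h1, .refl W, hs, h2⟩

/-- The frames that the machine has dropped reappear as `C`. Relatedness preserves the kind of a
frame, so on the side of the calculus they form the local context that its control rules demand. -/
theorem Rep.control {τ : Store S (JVal S)} {C E : JCtx S} {F : Frame S (JClo S) (JVal S)}
    {c' : JClo S} (hC : C.IsLocal) (h : Rep x τ (plugJ (C ++ F :: E) c')) :
    ∃ W σ E' F' C' c, x = .run σ (plug E' (F'.plugClo (plug C' c))) ∧ CtxRel W E' E ∧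
      FRel W F' F ∧ C'.IsLocal ∧ CloRel W c c' ∧ StoreRel W σ τ := by
  obtain ⟨W, σ, t, rfl, hc, hs⟩ := h
  rw [plugJ_append] at hc
  obtain ⟨E', _, rfl, hE, hk⟩ := cloRel_plug_right (E := E) hc
  obtain ⟨F', _, rfl, hF, hk⟩ := cloRel_plugClo_right hk
  obtain ⟨C', c, rfl, hC', hk⟩ := cloRel_plug_right hk
  exact ⟨W, σ, E', F', C', c, rfl, hE, hF, (isLocal_of_forall₂ hC').2 hC, hk, hs⟩

theorem cloRel_throw_right {W : World S} {c : RClo S} {w : JVal S}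
    (h : CloRel W c (.throw (.val w))) : ∃ v, c = .throw (.val v) ∧ VRel W v w := by
  cases h with
  | throw _ _ h => cases h with | val v _ h => exact ⟨v, rfl, h⟩

theorem cloRel_brk_right {W : World S} {c : RClo S} {l : S.Lab} {w : JVal S}
    (h : CloRel W c (.brk l (.val w))) : ∃ v, c = .brk l (.val v) ∧ VRel W v w := by
  cases h with
  | brk _ _ _ h => cases h with | val v _ h => exact ⟨v, rfl, h⟩

theorem cloRel_get_right {W : World S} {c : RClo S} {w : JVal S} {s : String}
    (h : CloRel W c (.get (.val w) (.val (.const (.str s))))) :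
    ∃ v, c = .get (.val v) (.val (.const (.str s))) ∧ VRel W v w := by
  cases h with
  | get _ _ _ _ h h' =>
    cases h with
    | val v _ h => cases h' with | val _ _ h' => cases h'; exact ⟨v, rfl, h⟩

theorem cloRel_del_right {W : World S} {c : RClo S} {w : JVal S} {s : String}
    (h : CloRel W c (.del (.val w) (.val (.const (.str s))))) :
    ∃ v, c = .del (.val v) (.val (.const (.str s))) ∧ VRel W v w := by
  cases h with
  | del _ _ _ _ h h' =>
    cases h with
    | val v _ h => cases h' with | val _ _ h' => cases h'; exact ⟨v, rfl, h⟩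

theorem cloRel_set_right {W : World S} {c : RClo S} {w w' : JVal S} {s : String}
    (h : CloRel W c (.set (.val w) (.val (.const (.str s))) (.val w'))) :
    ∃ v v', c = .set (.val v) (.val (.const (.str s))) (.val v') ∧ VRel W v w ∧ VRel W v' w' := by
  cases h with
  | set _ _ _ _ _ _ h h' h'' =>
    cases h with
    | val v _ h =>
      cases h' with
      | val _ _ h' => cases h'' with | val v' _ h'' => cases h'; exact ⟨v, v', rfl, h, h''⟩

theorem vRel_record_right {W : World S} {v : RVal S} {gs : List (String × JVal S)}
    (h : VRel W v (.record gs)) : ∃ fs, v = .record fs ∧ List.Forall₂ (PairRel (VRel W)) fs gs := by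
  cases h with
  | record fs _ h => exact ⟨fs, rfl, h⟩

/-- A contraction, and a control effect that meets a control frame or the empty stack, is answered
by one step. Navigation, halting with a value and the dropping of a local frame are answered by
none. -/
theorem loadRel_step (hδ : δ.Equivariant) (halloc : alloc.Valid)
    {s s' : JState S} (h : LoadRel x s) (hstep : JStep δ msg alloc s s') :
    ∃ y, RhoStar δ msg x y ∧ LoadRel y s' := by
  have := halloc.infinite
  have ev : ∀ {τ c E}, (∃ y, RhoStar δ msg x y ∧ Rep y τ (plugJ E c)) →
      ∃ y, RhoStar δ msg x y ∧ LoadRel y (.ev τ c E) := fun ⟨y, h1, h2⟩ => ⟨y, h1, .ev _ _ _ h2⟩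
  have co : ∀ {τ v E}, (∃ y, RhoStar δ msg x y ∧ Rep y τ (plugJ E (.val v))) →
      ∃ y, RhoStar δ msg x y ∧ LoadRel y (.co τ v E) := fun ⟨y, h1, h2⟩ => ⟨y, h1, .co _ _ _ h2⟩
  have ap : ∀ {τ c E}, (∃ y, RhoStar δ msg x y ∧ Rep y τ (plugJ E c)) →
      ∃ y, RhoStar δ msg x y ∧ LoadRel y (.ap τ c E) := fun ⟨y, h1, h2⟩ => ⟨y, h1, .ap _ _ _ h2⟩
  cases hstep with
  | evPropagate τ e η c E hp =>
    cases h with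
    | ev _ _ _ h =>
      refine ev (h.red fun W σ t ht hs => ?_)
      cases ht with
      | clos _ ρ _ he hη =>
        obtain ⟨d, hd⟩ := propagate_other ρ hp
        exact ⟨d, .propagate _ _ _ hd, propagate_rel hη he hd hp⟩
  | evRecordNil τ E =>
    cases h with
    | ev _ _ _ h =>
      refine co (h.red fun W σ t ht hs => ?_)
      cases ht with
      | record _ _ h => cases h; exact ⟨_, .record [], .val _ _ (.record _ _ .nil)⟩
  | evWhile τ c d E =>
    cases h with
    | ev _ _ _ h =>
      refine ev (E := _ :: E) (h.red fun W σ t ht hs => ?_)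
      cases ht
      rename_i h h'
      exact ⟨_, .while _ _,
        .ite _ _ _ _ _ _ h (.seq _ _ _ _ h' (.while _ _ _ _ h h')) (.val _ _ (.const _))⟩
  | coNil τ v =>
    cases h with
    | co _ _ _ h =>
      obtain ⟨W, σ, t, rfl, hc, hs⟩ := h
      simp only [plugJ] at hc
      cases hc with
      | val v _ hv => exact ⟨_, .refl, .value W σ τ v _ rfl hv hs⟩
  | coRecordLast τ v us s E =>
    cases h with
    | co _ _ _ h =>
      -- In the calculus a record closure with evaluated fields still needs the step that turns it
      -- into a value.
      refine co (Rep.red (E := E) (c' := .record ((us ++ [(s, v)]).map fun p => (p.1, .val p.2)))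
        (by simpa [plugJ, Frame.plugClo] using h) fun W σ t ht hs => ?_)
      cases ht with
      | record _ _ h =>
        obtain ⟨fs, rfl, hfs⟩ := cloRel_fields_right h
        exact ⟨_, .record fs, .val _ _ (.record _ _ hfs)⟩
  | coSeq τ v c E =>
    cases h with
    | co _ _ _ h =>
      refine ev (Rep.red (E := E) h fun W σ t ht hs => ?_)
      cases ht with
      | seq _ _ _ _ h h' => cases h with | val => exact ⟨_, .seq _ _, h'⟩
  | coCatch τ v y c E =>
    cases h with
    | co _ _ _ h =>
      refine co (Rep.red (E := E) h fun W σ t ht hs => ?_)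
      cases ht with
      | tryCatch _ _ _ _ _ h h' =>
        cases h with | val _ _ h => exact ⟨_, .tryCatch _ _ _, .val _ _ h⟩
  | coFinally τ v c E =>
    cases h with
    | co _ _ _ h =>
      refine ev (Rep.red (E := E) h fun W σ t ht hs => ?_)
      cases ht with
      | tryFinally _ _ _ _ h h' =>
        cases h with
        | val _ _ h => exact ⟨_, .tryFinally _ _, .seq _ _ _ _ h' (.val _ _ h)⟩
  | coLabel τ v l E =>
    cases h with
    | co _ _ _ h =>
      refine co (Rep.red (E := E) h fun W σ t ht hs => ?_)
      cases ht with
      | label _ _ _ h => cases h with | val _ _ h => exact ⟨_, .label _ _, .val _ _ h⟩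
  | apVar τ y η E b w hb hw =>
    refine co ((h.rep_ap (by simp) (by simp)).red fun W σ t ht hs => ?_)
    cases ht with
    | clos _ ρ _ he hη =>
      obtain ⟨v, hv, hbd⟩ := hη.lookup_right hb
      obtain ⟨w', hw', hvw⟩ := hs.bound b v hbd
      have : τ.lookup b = some w := hw
      rw [this] at hw'
      cases hw'
      exact ⟨_, .var _ _ _ hv, .val _ _ hvw⟩
  | apLet τ y w e η E a ha =>
    refine ev ((h.rep_ap (by simp) (by simp)).step fun W σ t E' ht hs => ?_)
    cases ht with
    | letE _ _ _ _ _ hv hd =>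
      cases hv with
      | val v _ hv =>
        cases hd with
        | clos _ ρ _ he hη =>
          obtain ⟨_, _, hfr⟩ := halloc (.ap τ (.letE y (.val w) (.clos e η)) E) 1
          obtain ⟨W', hle, hs', hb⟩ := hs.bindList (bs := [a]) (by simp)
            (by simpa [JState.store, ha] using hfr) (.cons hv .nil) rfl
          exact ⟨W', σ, _, .red _ _ _ _ (.letE _ _ _ _), hle, hs',
            .clos _ _ _ he ((hη.mono hle).extend (xs := [y]) hb)⟩
  | apApp τ xs e η ws E bs hl hbs =>
    refine ev ((h.rep_ap (by simp) (by simp)).step fun W σ t E' ht hs => ?_)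
    cases ht with
    | app _ _ _ _ hf hvs =>
      cases hf with
      | val _ _ hf =>
        cases hf with
        | fn _ ρ _ he hη =>
          obtain ⟨vs, rfl, hvw⟩ := cloRel_vals_right hvs
          obtain ⟨hal, han, haf⟩ := halloc
            (.ap τ (.app (.val (.fn (⟨xs, e⟩, η))) (ws.map .val)) E) xs.length
          rw [hbs] at hal han haf
          have hlen := hl.trans hvw.length_eq.symm
          obtain ⟨W', hle, hs', hb⟩ := hs.bindList han haf hvw (hal.trans hlen)
          exact ⟨W', σ, _, .red _ _ _ _ (.app _ _ _ _ hlen), hle, hs',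
            .clos _ _ _ he ((hη.mono hle).extend hb)⟩
  | apGet τ fs fs' s v E =>
    refine co ((h.rep_ap (by simp) (by simp)).red fun W σ t ht hs => ?_)
    obtain ⟨_, rfl, hq⟩ := cloRel_get_right ht
    obtain ⟨_, rfl, hr⟩ := vRel_record_right hq
    obtain ⟨gs, u, gs', rfl, _, hu, _⟩ := fields_split_right hr
    exact ⟨_, .get _ _ _ _, .val _ _ hu⟩
  | apGetNone τ fs s E hn =>
    refine co ((h.rep_ap (by simp) (by simp)).red fun W σ t ht hs => ?_)
    obtain ⟨_, rfl, hq⟩ := cloRel_get_right ht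
    obtain ⟨_, rfl, hr⟩ := vRel_record_right hq
    exact ⟨_, .getNone _ _ (by rwa [fields_names hr]), .val _ _ (.const _)⟩
  | apSet τ fs fs' s u v E =>
    refine co ((h.rep_ap (by simp) (by simp)).red fun W σ t ht hs => ?_)
    obtain ⟨_, _, rfl, hq, hv⟩ := cloRel_set_right ht
    obtain ⟨_, rfl, hr⟩ := vRel_record_right hq
    obtain ⟨gs, u, gs', rfl, h1, _, h2⟩ := fields_split_right hr
    exact ⟨_, .set _ _ _ _ _, .val _ _ (.record _ _ (fields_cons h1 hv h2))⟩
  | apSetNew τ fs s v E hn =>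
    refine co ((h.rep_ap (by simp) (by simp)).red fun W σ t ht hs => ?_)
    obtain ⟨_, _, rfl, hq, hv⟩ := cloRel_set_right ht
    obtain ⟨_, rfl, hr⟩ := vRel_record_right hq
    exact ⟨_, .setNew _ _ _ (by rwa [fields_names hr]),
      .val _ _ (.record _ _ (.cons (.mk _ _ _ hv) hr))⟩
  | apDel τ fs fs' s u E =>
    refine co ((h.rep_ap (by simp) (by simp)).red fun W σ t ht hs => ?_)
    obtain ⟨_, rfl, hq⟩ := cloRel_del_right ht
    obtain ⟨_, rfl, hr⟩ := vRel_record_right hq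
    obtain ⟨gs, u, gs', rfl, h1, _, h2⟩ := fields_split_right hr
    exact ⟨_, .del _ _ _ _, .val _ _ (.record _ _ (forall₂_append h1 h2))⟩
  | apDelNone τ fs s E hn =>
    refine co ((h.rep_ap (by simp) (by simp)).red fun W σ t ht hs => ?_)
    obtain ⟨_, rfl, hq⟩ := cloRel_del_right ht
    obtain ⟨_, rfl, hr⟩ := vRel_record_right hq
    exact ⟨_, .delNone _ _ (by rwa [fields_names hr]), .val _ _ (.record _ _ hr)⟩
  | apIteTrue τ c d E =>
    refine ev ((h.rep_ap (by simp) (by simp)).red fun W σ t ht hs => ?_)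
    cases ht with
    | ite _ _ _ _ _ _ h h' h'' =>
      cases h with | val _ _ h => cases h; exact ⟨_, .iteTrue _ _, h'⟩
  | apIteFalse τ c d E =>
    refine ev ((h.rep_ap (by simp) (by simp)).red fun W σ t ht hs => ?_)
    cases ht with
    | ite _ _ _ _ _ _ h h' h'' =>
      cases h with | val _ _ h => cases h; exact ⟨_, .iteFalse _ _, h''⟩
  | apOp τ o ws E r hr =>
    refine co ((h.rep_ap (by simp) (by simp)).red fun W σ t ht hs => ?_)
    cases ht with
    | op _ _ _ h =>
      obtain ⟨vs, rfl, hvs⟩ := cloRel_vals_right h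
      rcases delta_rel hδ hs (o := o) hvs with ⟨r₁, r', h1, h2, h3⟩ | ⟨r₁, r', h1, h2, h3⟩ <;>
        rw [hr] at h2 <;> cases h2
      exact ⟨_, .op _ _ _ h1, .val _ _ h3⟩
  | apOpError τ o ws E r hr =>
    refine ap ((h.rep_ap (by simp) (by simp)).red fun W σ t ht hs => ?_)
    cases ht with
    | op _ _ _ h =>
      obtain ⟨vs, rfl, hvs⟩ := cloRel_vals_right h
      rcases delta_rel hδ hs (o := o) hvs with ⟨r₁, r', h1, h2, h3⟩ | ⟨r₁, r', h1, h2, h3⟩ <;>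
        rw [hr] at h2 <;> cases h2
      exact ⟨_, .opError _ _ _ h1, .throw _ _ (.val _ _ h3)⟩
  | apRef τ w E b hb =>
    refine co ((h.rep_ap (by simp) (by simp)).step fun W σ t E' ht hs => ?_)
    cases ht with
    | ref _ _ hv =>
      cases hv with
      | val v _ hv =>
        obtain ⟨_, _, hfr⟩ := halloc (.ap τ (.ref (.val w)) E) 1
        -- The address chosen by the machine may already name a different cell in the calculus, so
        -- an unused name is taken instead.
        obtain ⟨a, ha⟩ := Infinite.exists_notMem_finset σ.keys
        rw [Finmap.mem_keys] at ha
        obtain ⟨W', hle, hs', hab⟩ := hs.ref (b := b) ha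
          (by simpa [JState.store, hb] using hfr) hv
        exact ⟨W', _, _, .ref _ _ _ _ ha, hle, hs', .val _ _ (.addr _ _ hab)⟩
  | apDeref τ b E w hw =>
    refine co ((h.rep_ap (by simp) (by simp)).step fun W σ t E' ht hs => ?_)
    cases ht with
    | deref _ _ hv =>
      cases hv with
      | val v _ hv =>
        cases hv with
        | addr a _ hab =>
          obtain ⟨v, w', h1, h2, h3⟩ := hs.cell a b hab
          have : τ.lookup b = some w := hw
          rw [this] at h2
          cases h2
          exact ⟨W, σ, _, .deref _ _ _ _ h1, .refl W, hs, .val _ _ h3⟩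
  | apAssign τ b w E =>
    refine co ((h.rep_ap (by simp) (by simp)).step fun W σ t E' ht hs => ?_)
    cases ht with
    | assign _ _ _ _ hv hu =>
      cases hv with
      | val v _ hv =>
        cases hu with
        | val u _ hu =>
          cases hv with
          | addr a _ hab =>
            exact ⟨W, _, _, .assign _ _ _ _, .refl W, hs.assign hab hu, .val _ _ hu⟩
  | apFault τ c k E hf =>
    refine ap ((h.rep_ap (by rintro v rfl; cases hf) (by rintro l v rfl; cases hf)).red
      fun W σ t ht hs => ⟨_, .fault _ _ (fault_right ht hf),
        .throw _ _ (.val _ _ (vRel_errVal k))⟩)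
  | apThrowNil τ w =>
    obtain ⟨C, hC, W, σ, t, rfl, ht, hs⟩ := h.rep_throw
    rw [List.append_nil] at ht
    obtain ⟨C', _, rfl, hC', hk⟩ := cloRel_plug_right ht
    obtain ⟨v, rfl, hv⟩ := cloRel_throw_right hk
    exact ⟨_, .single (.uncaught _ _ _ ((isLocal_of_forall₂ hC').2 hC)),
      .error W σ τ v w rfl hv hs⟩
  | apThrowCatch τ w y e η E b hb =>
    obtain ⟨C, hC, h⟩ := h.rep_throw
    obtain ⟨W, σ, E', F', C', _, rfl, hE, hF, hC', hk, hs⟩ := h.control hC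
    obtain ⟨v, rfl, hv⟩ := cloRel_throw_right hk
    cases hF with
    | catchF _ _ _ hd =>
      cases hd with
      | clos _ ρ _ he hη =>
        obtain ⟨_, _, hfr⟩ := halloc (.ap τ (.throw (.val w)) (.catchF y (.clos e η) :: E)) 1
        obtain ⟨W', hle, hs', hbd⟩ := hs.bindList (bs := [b]) (by simp)
          (by simpa [JState.store, hb] using hfr) (.cons hv .nil) rfl
        exact ev ⟨_, .single (.throwCatch _ _ _ _ _ _ _ hC'), W', σ, _, rfl,
          cloRel_plug (hE.mono hle) (.clos _ _ _ he ((hη.mono hle).extend (xs := [y]) hbd)), hs'⟩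
  | apThrowFinally τ w c E =>
    obtain ⟨C, hC, h⟩ := h.rep_throw
    obtain ⟨W, σ, E', F', C', _, rfl, hE, hF, hC', hk, hs⟩ := h.control hC
    obtain ⟨v, rfl, hv⟩ := cloRel_throw_right hk
    cases hF with
    | finallyF _ _ hd =>
      exact ev ⟨_, .single (.throwFinally _ _ _ _ _ hC'), W, σ, _, rfl,
        cloRel_plug hE (.seq _ _ _ _ hd (.throw _ _ (.val _ _ hv))), hs⟩
  | apThrowLabel τ w l E =>
    obtain ⟨C, hC, h⟩ := h.rep_throw
    obtain ⟨W, σ, E', F', C', _, rfl, hE, hF, hC', hk, hs⟩ := h.control hC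
    obtain ⟨v, rfl, hv⟩ := cloRel_throw_right hk
    cases hF
    exact ap ⟨_, .single (.throwLabel _ _ _ _ _ hC'), W, σ, _, rfl,
      cloRel_plug hE (.throw _ _ (.val _ _ hv)), hs⟩
  | apThrowLocal τ w F E hF =>
    obtain ⟨C, hC, h⟩ := h.rep_throw
    -- The calculus waits: the dropped frame joins those that it still has to remove.
    refine ⟨x, .refl, .throw _ _ (C ++ [F]) _ ?_ (by simpa using h)⟩
    intro G hG
    rcases List.mem_append.1 hG with hG | hG
    · exact hC G hG
    · rw [List.mem_singleton.1 hG]; exact hF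
  | apBrkNil τ l w =>
    obtain ⟨C, hC, W, σ, t, rfl, ht, hs⟩ := h.rep_brk
    rw [List.append_nil] at ht
    obtain ⟨C', _, rfl, hC', hk⟩ := cloRel_plug_right ht
    obtain ⟨v, rfl, hv⟩ := cloRel_brk_right hk
    exact ap ⟨_, .single (.brkUnmatched _ _ _ _ ((isLocal_of_forall₂ hC').2 hC)), W, σ, _, rfl,
      .throw _ _ (.val _ _ (vRel_errVal _)), hs⟩
  | apBrkCatch τ l w y c E =>
    obtain ⟨C, hC, h⟩ := h.rep_brk
    obtain ⟨W, σ, E', F', C', _, rfl, hE, hF, hC', hk, hs⟩ := h.control hC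
    obtain ⟨v, rfl, hv⟩ := cloRel_brk_right hk
    cases hF
    exact ev ⟨_, .single (.brkCatch _ _ _ _ _ _ _ hC'), W, σ, _, rfl,
      cloRel_plug hE (.brk _ _ _ (.val _ _ hv)), hs⟩
  | apBrkFinally τ l w c E =>
    obtain ⟨C, hC, h⟩ := h.rep_brk
    obtain ⟨W, σ, E', F', C', _, rfl, hE, hF, hC', hk, hs⟩ := h.control hC
    obtain ⟨v, rfl, hv⟩ := cloRel_brk_right hk
    cases hF with
    | finallyF _ _ hd =>
      exact ev ⟨_, .single (.brkFinally _ _ _ _ _ _ hC'), W, σ, _, rfl,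
        cloRel_plug hE (.seq _ _ _ _ hd (.brk _ _ _ (.val _ _ hv))), hs⟩
  | apBrkLabel τ l w E =>
    obtain ⟨C, hC, h⟩ := h.rep_brk
    obtain ⟨W, σ, E', F', C', _, rfl, hE, hF, hC', hk, hs⟩ := h.control hC
    obtain ⟨v, rfl, hv⟩ := cloRel_brk_right hk
    cases hF
    exact co ⟨_, .single (.brkLabel _ _ _ _ _ hC'), W, σ, _, rfl,
      cloRel_plug hE (.val _ _ hv), hs⟩
  | apBrkOther τ l l' w E hne =>
    obtain ⟨C, hC, h⟩ := h.rep_brk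
    obtain ⟨W, σ, E', F', C', _, rfl, hE, hF, hC', hk, hs⟩ := h.control hC
    obtain ⟨v, rfl, hv⟩ := cloRel_brk_right hk
    cases hF
    exact ap ⟨_, .single (.brkOther _ _ _ _ _ _ hC' hne), W, σ, _, rfl,
      cloRel_plug hE (.brk _ _ _ (.val _ _ hv)), hs⟩
  | apBrkLocal τ l w F E hF =>
    obtain ⟨C, hC, h⟩ := h.rep_brk
    refine ⟨x, .refl, .brk _ _ _ (C ++ [F]) _ ?_ (by simpa using h)⟩
    intro G hG
    rcases List.mem_append.1 hG with hG | hG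
    · exact hC G hG
    · rw [List.mem_singleton.1 hG]; exact hF
  -- All remaining transitions are navigation.
  | _ => exact ⟨x, .refl, h.nav rfl⟩

theorem rhoEval_of_jamEval (hδ : δ.Equivariant) (halloc : alloc.Valid)
    {e : Exp S} (he : e.addrs = ∅) {C : Answer S (JVal S)}
    (h : JAMEval δ msg alloc e C) : ∃ B, RhoEval δ msg e B ∧ SameAnswer B C := by
  have key : ∀ s, JStar δ msg alloc (injJAM e) s →
      ∃ x, RhoStar δ msg (injJS e) x ∧ LoadRel x s := by
    intro s hs
    induction hs with
    | refl =>
      exact ⟨_, .refl, .ev _ _ _ ⟨_, _, _, rfl, .clos e _ _ he (envRel_empty _), .empty⟩⟩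
    | tail _ hst ih =>
      obtain ⟨x, h1, h2⟩ := ih
      obtain ⟨y, h3, h4⟩ := loadRel_step hδ halloc h2 hst
      exact ⟨y, h1.trans h3, h4⟩
  obtain ⟨x, h1, h2⟩ := key _ h
  cases h2 with
  | value W σ τ v w hx hv hs => exact ⟨.value σ v, by subst hx; exact h1, hs.sameAnswer_value hv⟩
  | error W σ τ v w hx hv hs => exact ⟨.error σ v, by subst hx; exact h1, hs.sameAnswer_error hv⟩

end MachineToRho

/-! ### Substitution -/

section Substitution
variable {S : Sig}

theorem Exp.ind {P : Exp S → Prop} (var : ∀ x, P (.var x)) (const : ∀ k, P (.const k))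
    (addr : ∀ a, P (.addr a)) (func : ∀ xs e, P e → P (.func xs e))
    (record : ∀ fs, (∀ p ∈ fs, P p.2) → P (.record fs))
    (letE : ∀ x e f, P e → P f → P (.letE x e f))
    (app : ∀ e fs, P e → (∀ f ∈ fs, P f) → P (.app e fs))
    (get : ∀ e f, P e → P f → P (.get e f)) (set : ∀ e f g, P e → P f → P g → P (.set e f g))
    (del : ∀ e f, P e → P f → P (.del e f)) (assign : ∀ e f, P e → P f → P (.assign e f))
    (ref : ∀ e, P e → P (.ref e)) (deref : ∀ e, P e → P (.deref e))
    (ite : ∀ e f g, P e → P f → P g → P (.ite e f g)) (seq : ∀ e f, P e → P f → P (.seq e f))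
    (loop : ∀ e f, P e → P f → P (.while e f)) (label : ∀ l e, P e → P (.label l e))
    (brk : ∀ l e, P e → P (.brk l e))
    (tryCatch : ∀ e x f, P e → P f → P (.tryCatch e x f))
    (tryFinally : ∀ e f, P e → P f → P (.tryFinally e f)) (throw : ∀ e, P e → P (.throw e))
    (op : ∀ o es, (∀ e ∈ es, P e) → P (.op o es)) (e : Exp S) : P e :=
  Exp.rec (motive_1 := P) (motive_2 := fun fs => ∀ p ∈ fs, P p.2)
    (motive_3 := fun es => ∀ e ∈ es, P e) (motive_4 := fun p => P p.2)
    var const addr func record letE app get set del assign ref deref ite seq loop label brk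
    tryCatch tryFinally throw op
    (by simp) (fun _ _ h h' => List.forall_mem_cons.2 ⟨h, h'⟩)
    (by simp) (fun _ _ h h' => List.forall_mem_cons.2 ⟨h, h'⟩) (fun _ _ h => h) e

theorem Exp.substList_eq (θ : Sub S) (es : List (Exp S)) :
    Exp.substList θ es = es.map (Exp.subst θ) := by
  induction es with
  | nil => simp [Exp.substList]
  | cons e es ih => simp [Exp.substList, ih]

theorem Exp.substFields_eq (θ : Sub S) (fs : List (String × Exp S)) :
    Exp.substFields θ fs = fs.map fun p => (p.1, p.2.subst θ) := by
  induction fs with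
  | nil => simp [Exp.substFields]
  | cons p fs ih => obtain ⟨s, e⟩ := p; simp [Exp.substFields, ih]

theorem Exp.mem_fvList {x : S.Var} {es : List (Exp S)} :
    x ∈ Exp.fvList es ↔ ∃ e ∈ es, x ∈ e.fv := by
  induction es with
  | nil => simp [Exp.fvList]
  | cons e es ih => simp [Exp.fvList, ih]

theorem Exp.mem_fvFields {x : S.Var} {fs : List (String × Exp S)} :
    x ∈ Exp.fvFields fs ↔ ∃ p ∈ fs, x ∈ p.2.fv := by
  induction fs with
  | nil => simp [Exp.fvFields]
  | cons p fs ih =>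
    obtain ⟨s, e⟩ := p
    simp only [Exp.fvFields, Set.mem_union, ih, List.mem_cons, exists_eq_or_imp]

/-- A substitution matters only on the free variables. -/
theorem Exp.subst_congr (e : Exp S) :
    ∀ {θ θ' : Sub S}, (∀ x ∈ e.fv, θ x = θ' x) → e.subst θ = e.subst θ' := by
  have hide : ∀ {θ θ' : Sub S} {xs : List S.Var} {A : Set S.Var},
      (∀ x ∈ A \ {x | x ∈ xs}, θ x = θ' x) → ∀ x ∈ A, θ.hide xs x = θ'.hide xs x := by
    intro θ θ' xs A h x hx
    by_cases hxs : x ∈ xs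
    · simp [Sub.hide, hxs]
    · simp [Sub.hide, hxs, h x ⟨hx, hxs⟩]
  have hide₁ : ∀ {θ θ' : Sub S} {y : S.Var} {A : Set S.Var},
      (∀ x ∈ A \ {y}, θ x = θ' x) → ∀ x ∈ A, θ.hide [y] x = θ'.hide [y] x :=
    fun h => hide (by simpa using h)
  induction e using Exp.ind with
  | var x => intro θ θ' h; simp [Exp.subst, h x (by simp [Exp.fv])]
  | const k => simp [Exp.subst]
  | addr a => simp [Exp.subst]
  | func xs e ih =>
    intro θ θ' h
    simp only [Exp.subst, Exp.fv] at h ⊢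
    rw [ih (hide h)]
  | record fs ih =>
    intro θ θ' h
    simp only [Exp.subst, Exp.substFields_eq, Exp.fv, Exp.record.injEq] at h ⊢
    refine List.map_congr_left fun p hp => ?_
    rw [ih p hp fun x hx => h x (Exp.mem_fvFields.2 ⟨p, hp, hx⟩)]
  | letE x e f ih ih' =>
    intro θ θ' h
    simp only [Exp.subst, Exp.fv] at h ⊢
    rw [ih fun x hx => h x (.inl hx), ih' (hide₁ fun x hx => h x (.inr hx))]
  | tryCatch e x f ih ih' =>
    intro θ θ' h
    simp only [Exp.subst, Exp.fv] at h ⊢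
    rw [ih fun x hx => h x (.inl hx), ih' (hide₁ fun x hx => h x (.inr hx))]
  | app e fs ih ih' =>
    intro θ θ' h
    simp only [Exp.subst, Exp.substList_eq, Exp.fv] at h ⊢
    rw [ih fun x hx => h x (.inl hx), List.map_congr_left fun f hf =>
      ih' f hf fun x hx => h x (.inr (Exp.mem_fvList.2 ⟨f, hf, hx⟩))]
  | op o fs ih' =>
    intro θ θ' h
    simp only [Exp.subst, Exp.substList_eq, Exp.fv] at h ⊢
    rw [List.map_congr_left fun f hf => ih' f hf fun x hx => h x (Exp.mem_fvList.2 ⟨f, hf, hx⟩)]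
  | set e f g ih ih' ih'' =>
    intro θ θ' h
    simp only [Exp.subst, Exp.fv] at h ⊢
    rw [ih fun x hx => h x (.inl (.inl hx)), ih' fun x hx => h x (.inl (.inr hx)),
      ih'' fun x hx => h x (.inr hx)]
  | ite e f g ih ih' ih'' =>
    intro θ θ' h
    simp only [Exp.subst, Exp.fv] at h ⊢
    rw [ih fun x hx => h x (.inl (.inl hx)), ih' fun x hx => h x (.inl (.inr hx)),
      ih'' fun x hx => h x (.inr hx)]
  | ref e ih | deref e ih | label l e ih | brk l e ih | throw e ih =>
    intro θ θ' h
    simp only [Exp.subst, Exp.fv] at h ⊢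
    rw [ih h]
  | get e f ih ih' | del e f ih ih' | assign e f ih ih' | seq e f ih ih' | loop e f ih ih'
  | tryFinally e f ih ih' =>
    intro θ θ' h
    simp only [Exp.subst, Exp.fv] at h ⊢
    rw [ih fun x hx => h x (.inl hx), ih' fun x hx => h x (.inr hx)]

def Sub.none : Sub S := fun _ => Option.none

theorem Sub.hide_none (xs : List S.Var) : (Sub.none : Sub S).hide xs = Sub.none := by
  funext x; simp [Sub.hide, Sub.none]

theorem map_eq_self {α : Type} {f : α → α} {l : List α} (h : ∀ a ∈ l, f a = a) : l.map f = l := by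
  conv_rhs => rw [← List.map_id l]
  exact List.map_congr_left h

theorem Exp.subst_none (e : Exp S) : e.subst Sub.none = e := by
  induction e using Exp.ind <;>
    simp_all [Exp.subst, Sub.hide_none, Exp.substList_eq, Exp.substFields_eq]
  case var => simp [Sub.none]
  case record fs ih => exact map_eq_self fun p hp => by rw [ih p.1 p.2 hp]
  case app e fs _ ih => exact map_eq_self ih
  case op o es ih => exact map_eq_self ih

theorem Exp.subst_of_closed {e : Exp S} (h : e.fv = ∅) (θ : Sub S) : e.subst θ = e := by
  conv_rhs => rw [← e.subst_none]
  exact e.subst_congr fun x hx => by simp [h] at hx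

def Sub.Closed (θ : Sub S) : Prop := ∀ x v, θ x = some v → v.toExp.fv = ∅

theorem Sub.Closed.hide {θ : Sub S} (h : θ.Closed) (xs : List S.Var) : (θ.hide xs).Closed := by
  intro x v hv
  by_cases hx : x ∈ xs
  · simp [Sub.hide, hx] at hv
  · exact h x v (by simpa [Sub.hide, hx] using hv)

/-- The substitution `θ`, followed by `θ'`. -/
def Sub.comp (θ θ' : Sub S) : Sub S := fun x => (θ x).or (θ' x)

theorem Sub.hide_comp (θ θ' : Sub S) (xs : List S.Var) :
    (θ.hide xs).comp (θ'.hide xs) = (θ.comp θ').hide xs := by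
  funext x
  by_cases hx : x ∈ xs <;> simp [Sub.hide, Sub.comp, hx]

/-- Whatever `θ` inserts is closed and thus untouched by the second pass, which acts only where `θ`
is undefined. -/
theorem Exp.subst_subst (e : Exp S) :
    ∀ {θ : Sub S}, θ.Closed → ∀ θ' : Sub S, (e.subst θ).subst θ' = e.subst (θ.comp θ') := by
  induction e using Exp.ind with
  | var x =>
    intro θ h θ'
    cases hx : θ x with
    | none => simp [Exp.subst, Sub.comp, hx]
    | some v => simp [Exp.subst, Sub.comp, hx, Exp.subst_of_closed (h x v hx)]
  | const k => simp [Exp.subst]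
  | addr a => simp [Exp.subst]
  | func xs e ih => intro θ h θ'; simp [Exp.subst, ih (h.hide xs), Sub.hide_comp]
  | letE x e f ih ih' | tryCatch e x f ih ih' =>
    intro θ h θ'; simp [Exp.subst, ih h, ih' (h.hide _), Sub.hide_comp]
  | record fs ih =>
    intro θ h θ'
    simp only [Exp.subst, Exp.substFields_eq, List.map_map, Exp.record.injEq]
    exact List.map_congr_left fun p hp => by simp [ih p hp h]
  | app e fs ih ih' =>
    intro θ h θ'
    simp only [Exp.subst, Exp.substList_eq, List.map_map, ih h, Exp.app.injEq, true_and]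
    exact List.map_congr_left fun p hp => by simp [ih' p hp h]
  | op o fs ih' =>
    intro θ h θ'
    simp only [Exp.subst, Exp.substList_eq, List.map_map, Exp.op.injEq, true_and]
    exact List.map_congr_left fun p hp => by simp [ih' p hp h]
  | _ => intro θ h θ'; simp_all [Exp.subst]

/-- Closed values contribute no free variables, so what remains free was free before and was not
replaced. -/
theorem Exp.fv_subst (e : Exp S) :
    ∀ {θ : Sub S}, θ.Closed → ∀ x ∈ (e.subst θ).fv, x ∈ e.fv ∧ θ x = none := by
  have hide : ∀ {θ : Sub S} {xs : List S.Var} {x : S.Var}, x ∉ xs → θ.hide xs x = none →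
      θ x = none := fun hx h => by simpa [Sub.hide, hx] using h
  induction e using Exp.ind with
  | var x =>
    intro θ h y hy
    cases hx : θ x with
    | none =>
      simp only [Exp.subst, hx, Exp.fv, Set.mem_singleton_iff] at hy
      subst hy
      simp [Exp.fv, hx]
    | some v => simp [Exp.subst, hx, h x v hx] at hy
  | const k => simp [Exp.subst, Exp.fv]
  | addr a => simp [Exp.subst, Exp.fv]
  | func xs e ih =>
    rintro θ h y ⟨hy, hys⟩
    obtain ⟨h1, h2⟩ := ih (h.hide xs) y hy
    exact ⟨⟨h1, hys⟩, hide hys h2⟩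
  | letE x e f ih ih' | tryCatch e x f ih ih' =>
    rintro θ h y (hy | ⟨hy, hyx⟩)
    · exact ⟨.inl (ih h y hy).1, (ih h y hy).2⟩
    · obtain ⟨h1, h2⟩ := ih' (h.hide [x]) y hy
      exact ⟨.inr ⟨h1, hyx⟩, hide (by simpa using hyx) h2⟩
  | record fs ih =>
    intro θ h y hy
    simp only [Exp.subst, Exp.substFields_eq, Exp.fv, Exp.mem_fvFields, List.mem_map] at hy ⊢
    obtain ⟨_, ⟨p, hp, rfl⟩, hy⟩ := hy
    exact ⟨⟨p, hp, (ih p hp h y hy).1⟩, (ih p hp h y hy).2⟩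
  | app e fs ih ih' =>
    intro θ h y hy
    simp only [Exp.subst, Exp.substList_eq, Exp.fv, Set.mem_union, Exp.mem_fvList,
      List.mem_map] at hy ⊢
    rcases hy with hy | ⟨_, ⟨p, hp, rfl⟩, hy⟩
    · exact ⟨.inl (ih h y hy).1, (ih h y hy).2⟩
    · exact ⟨.inr ⟨p, hp, (ih' p hp h y hy).1⟩, (ih' p hp h y hy).2⟩
  | op o fs ih' =>
    intro θ h y hy
    simp only [Exp.subst, Exp.substList_eq, Exp.fv, Exp.mem_fvList, List.mem_map] at hy ⊢
    obtain ⟨_, ⟨p, hp, rfl⟩, hy⟩ := hy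
    exact ⟨⟨p, hp, (ih' p hp h y hy).1⟩, (ih' p hp h y hy).2⟩
  | set e f g ih ih' ih'' | ite e f g ih ih' ih'' =>
    rintro θ h y ((hy | hy) | hy)
    · exact ⟨.inl (.inl (ih h y hy).1), (ih h y hy).2⟩
    · exact ⟨.inl (.inr (ih' h y hy).1), (ih' h y hy).2⟩
    · exact ⟨.inr (ih'' h y hy).1, (ih'' h y hy).2⟩
  | ref e ih | deref e ih | label l e ih | brk l e ih | throw e ih =>
    intro θ h y hy
    exact ih h y hy
  | get e f ih ih' | del e f ih ih' | assign e f ih ih' | seq e f ih ih' | loop e f ih ih'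
  | tryFinally e f ih ih' =>
    rintro θ h y (hy | hy)
    · exact ⟨.inl (ih h y hy).1, (ih h y hy).2⟩
    · exact ⟨.inr (ih' h y hy).1, (ih' h y hy).2⟩

/-! ### Forcing -/

theorem PVal.toExpFields_eq (fs : List (String × SynVal S)) :
    PVal.toExpFields fs = fs.map fun p => (p.1, p.2.toExp) := by
  induction fs with
  | nil => simp [PVal.toExpFields]
  | cons p fs ih => obtain ⟨s, v⟩ := p; simp [PVal.toExpFields, ih]

theorem forceFields_eq (fs : List (String × RVal S)) :
    forceFields fs = fs.map fun p => (p.1, forceVal p.2) := by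
  induction fs with
  | nil => simp [forceFields]
  | cons p fs ih => obtain ⟨s, v⟩ := p; simp [forceFields, ih]

theorem forceBindings_eq (l : List (S.Var × RVal S)) :
    forceBindings l = l.map fun p => (p.1, forceVal p.2) := by
  induction l with
  | nil => simp [forceBindings]
  | cons p l ih => obtain ⟨s, v⟩ := p; simp [forceBindings, ih]

/-- The substitution that an environment stands for. -/
def envSub (ρ : REnv S) : Sub S := Sub.ofList (forceEnv ρ)

theorem lookup_map_snd {α β γ : Type} [DecidableEq α] (f : β → γ) (x : α) (l : List (α × β)) :
    List.lookup x (l.map fun p => (p.1, f p.2)) = (List.lookup x l).map f := by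
  induction l with
  | nil => simp
  | cons p l ih =>
    obtain ⟨y, v⟩ := p
    by_cases hxy : x = y
    · simp [hxy]
    · simp [List.lookup_cons, beq_false_of_ne hxy, ih]

theorem envSub_apply (ρ : REnv S) (x : S.Var) : envSub ρ x = (ρ.lookup x).map forceVal := by
  obtain ⟨l⟩ := ρ
  rw [envSub, Sub.ofList, forceEnv, forceBindings_eq]
  exact lookup_map_snd _ _ _

/-- Closedness is hereditary through environments. It is stated by lookup, so shadowed entries of an
association list are not constrained. -/
inductive VClosed : RVal S → Prop
  | const (k : Const S) : VClosed (.const k)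
  | addr (a : S.Addr) : VClosed (.addr a)
  | fn (f : Fun S) (ρ : REnv S) :
      (∀ x ∈ f.body.fv, x ∈ f.params ∨ (ρ.lookup x).isSome) →
      (∀ x v, ρ.lookup x = some v → VClosed v) → VClosed (.fn (f, ρ))
  | record (fs : List (String × RVal S)) : (∀ p ∈ fs, VClosed p.2) → VClosed (.record fs)

/-- The environment `ρ` has closed values and, with `xs`, covers the free variables of `e`. -/
structure Scoped (ρ : REnv S) (xs : List S.Var) (e : Exp S) : Prop where
  closed : ∀ x v, ρ.lookup x = some v → VClosed v
  covers : ∀ x ∈ e.fv, x ∈ xs ∨ (ρ.lookup x).isSome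

/-- By induction into the environment the substitution has closed values, and it replaces every free
variable of the body that is not a parameter. -/
theorem VClosed.fv_force {v : RVal S} : VClosed v → (forceVal v).toExp.fv = ∅ := by
  induction v using RVal.ind with
  | const k => simp [forceVal, PVal.toExp, Exp.fv]
  | addr a => simp [forceVal, PVal.toExp, Exp.fv]
  | fn f ρ ih =>
    intro h
    cases h with
    | fn _ _ h1 h2 =>
      have hc : ((envSub ρ).hide f.params).Closed := by
        refine Sub.Closed.hide (fun x v hv => ?_) _
        rw [envSub_apply] at hv
        obtain ⟨w, hw, rfl⟩ := Option.map_eq_some_iff.1 hv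
        exact ih x w hw (h2 x w hw)
      simp only [forceVal, PVal.toExp, Exp.fv]
      rw [Set.sdiff_eq_empty]
      intro x hx
      obtain ⟨h3, h4⟩ := Exp.fv_subst _ hc x hx
      rcases h1 x h3 with h5 | h5
      · exact h5
      · by_contra hxp
        have hxp : x ∉ f.params := hxp
        obtain ⟨w, hw⟩ := Option.isSome_iff_exists.1 h5
        simp [Sub.hide, hxp, envSub_apply, hw] at h4
  | record fs ih =>
    intro h
    cases h with
    | record _ h =>
      simp only [forceVal, PVal.toExp, Exp.fv, forceFields_eq, PVal.toExpFields_eq]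
      ext x
      simp only [Exp.mem_fvFields, List.map_map, List.mem_map, Set.mem_empty_iff_false, iff_false]
      rintro ⟨_, ⟨p, hp, rfl⟩, hx⟩
      simp [ih p hp (h p hp)] at hx

theorem Scoped.closed_sub {ρ : REnv S} {xs : List S.Var} {e : Exp S} (h : Scoped ρ xs e) :
    (envSub ρ).Closed := by
  intro x v hv
  rw [envSub_apply] at hv
  obtain ⟨w, hw, rfl⟩ := Option.map_eq_some_iff.1 hv
  exact (h.closed x w hw).fv_force

theorem lookup_zip_append {α β : Type} [DecidableEq α] {xs : List α} {x : α} :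
    ∀ {vs : List β} (l : List (α × β)), xs.length = vs.length →
      List.lookup x (xs.zip vs ++ l) =
        if x ∈ xs then List.lookup x (xs.zip vs) else List.lookup x l := by
  induction xs with
  | nil => simp
  | cons y xs ih =>
    intro vs l hl
    cases vs with
    | nil => simp at hl
    | cons v vs =>
      by_cases hxy : x = y
      · simp [hxy]
      · simp only [List.zip_cons_cons, List.cons_append, List.lookup_cons, beq_false_of_ne hxy,
          List.mem_cons, hxy, false_or]
        exact ih l (by simpa using hl)

theorem lookup_zip_isSome {α β : Type} [DecidableEq α] {xs : List α} {x : α} :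
    ∀ {vs : List β}, xs.length = vs.length → x ∈ xs → (List.lookup x (xs.zip vs)).isSome := by
  induction xs with
  | nil => simp
  | cons y xs ih =>
    intro vs hl hx
    cases vs with
    | nil => simp at hl
    | cons v vs =>
      by_cases hxy : x = y
      · simp [hxy]
      · simp only [List.zip_cons_cons, List.lookup_cons, beq_false_of_ne hxy]
        exact ih (by simpa using hl) (by simpa [hxy] using hx)

theorem REnv.lookup_extend_zip (ρ : REnv S) {xs : List S.Var} {vs : List (RVal S)}
    (hl : xs.length = vs.length) (x : S.Var) :
    (ρ.extend (xs.zip vs)).lookup x =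
      if x ∈ xs then List.lookup x (xs.zip vs) else ρ.lookup x := by
  obtain ⟨l⟩ := ρ
  exact lookup_zip_append l hl

/-- Binding parameters in the environment amounts to substituting for them. -/
theorem Scoped.subst_extend {ρ : REnv S} {xs : List S.Var} {e : Exp S} (h : Scoped ρ xs e)
    {vs : List (RVal S)} (hl : xs.length = vs.length) :
    (e.subst ((envSub ρ).hide xs)).subst (Sub.ofList (xs.zip (vs.map forceVal))) =
      e.subst (envSub (ρ.extend (xs.zip vs))) := by
  rw [Exp.subst_subst e (h.closed_sub.hide xs)]
  refine Exp.subst_congr e fun x hx => ?_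
  have hz : xs.zip (vs.map forceVal) = (xs.zip vs).map fun p => (p.1, forceVal p.2) := by
    rw [List.zip_map_right]
    rfl
  rw [envSub_apply, REnv.lookup_extend_zip ρ hl, Sub.comp, Sub.ofList, hz, lookup_map_snd]
  -- A parameter is hidden from the environment and receives its argument. Any other free variable
  -- is covered by `ρ`, so the second substitution is not consulted.
  by_cases hxs : x ∈ xs
  · simp [Sub.hide, hxs]
  · rcases h.covers x hx with h1 | h1
    · exact absurd h1 hxs
    · obtain ⟨v, hv⟩ := Option.isSome_iff_exists.1 h1
      simp [Sub.hide, hxs, envSub_apply, hv]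

theorem Scoped.extend {ρ : REnv S} {xs : List S.Var} {e : Exp S} (h : Scoped ρ xs e)
    {vs : List (RVal S)} (hl : xs.length = vs.length) (hv : ∀ v ∈ vs, VClosed v) :
    Scoped (ρ.extend (xs.zip vs)) [] e := by
  constructor
  · intro x v hx
    rw [REnv.lookup_extend_zip ρ hl] at hx
    split at hx
    · exact hv v (List.of_mem_zip (mem_of_lookup hx)).2
    · exact h.closed x v hx
  · intro x hx
    right
    rw [REnv.lookup_extend_zip ρ hl]
    split
    · exact lookup_zip_isSome hl ‹_›
    · exact (h.covers x hx).resolve_left ‹_›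

end Substitution

/-! ### Relating the calculus of explicit substitutions and the substitution calculus -/

section Forcing
variable {S : Sig}

/-- Closedness is carried along because forcing is compatible with binding only when the substituted
values are closed. -/
def ForceV (v : RVal S) (w : SynVal S) : Prop := VClosed v ∧ w = forceVal v

/-- Related terms under the binder of `x`. -/
def BindRel (x : S.Var) (c : RClo S) (u : Exp S) : Prop :=
  ∃ e ρ, c = .clos e ρ ∧ Scoped ρ [x] e ∧ u = e.subst ((envSub ρ).hide [x])

/-- The expression `u` is obtained from the closure by carrying out its delayed substitutions.  With
`p`, a control effect of the closure may still be under frames, over which it jumps, in `u`. -/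
inductive ForceRel (p : Prop) : RClo S → Exp S → Prop
  | clos (e : Exp S) (ρ : REnv S) (u : Exp S) : Scoped ρ [] e → u = e.subst (envSub ρ) →
      ForceRel p (.clos e ρ) u
  | val (v : RVal S) (w : SynVal S) (u : Exp S) : ForceV v w → u = w.toExp → ForceRel p (.val v) u
  | record (fs : List (String × RClo S)) (gs : List (String × Exp S)) :
      List.Forall₂ (PairRel (ForceRel p)) fs gs → ForceRel p (.record fs) (.record gs)
  | letE (x : S.Var) (c d : RClo S) (c' d' : Exp S) : ForceRel p c c' → BindRel x d d' →
      ForceRel p (.letE x c d) (.letE x c' d')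
  | app (c : RClo S) (ds : List (RClo S)) (c' : Exp S) (ds' : List (Exp S)) :
      ForceRel p c c' → List.Forall₂ (ForceRel p) ds ds' → ForceRel p (.app c ds) (.app c' ds')
  | get (c d : RClo S) (c' d' : Exp S) : ForceRel p c c' → ForceRel p d d' →
      ForceRel p (.get c d) (.get c' d')
  | set (c d e : RClo S) (c' d' e' : Exp S) : ForceRel p c c' → ForceRel p d d' →
      ForceRel p e e' → ForceRel p (.set c d e) (.set c' d' e')
  | del (c d : RClo S) (c' d' : Exp S) : ForceRel p c c' → ForceRel p d d' →
      ForceRel p (.del c d) (.del c' d')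
  | assign (c d : RClo S) (c' d' : Exp S) : ForceRel p c c' → ForceRel p d d' →
      ForceRel p (.assign c d) (.assign c' d')
  | ref (c : RClo S) (c' : Exp S) : ForceRel p c c' → ForceRel p (.ref c) (.ref c')
  | deref (c : RClo S) (c' : Exp S) : ForceRel p c c' → ForceRel p (.deref c) (.deref c')
  | ite (c d e : RClo S) (c' d' e' : Exp S) : ForceRel p c c' → ForceRel p d d' →
      ForceRel p e e' → ForceRel p (.ite c d e) (.ite c' d' e')
  | seq (c d : RClo S) (c' d' : Exp S) : ForceRel p c c' → ForceRel p d d' →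
      ForceRel p (.seq c d) (.seq c' d')
  | loop (c d : RClo S) (c' d' : Exp S) : ForceRel p c c' → ForceRel p d d' →
      ForceRel p (.while c d) (.while c' d')
  | label (l : S.Lab) (c : RClo S) (c' : Exp S) : ForceRel p c c' →
      ForceRel p (.label l c) (.label l c')
  | brk (l : S.Lab) (c : RClo S) (c' : Exp S) : ForceRel p c c' →
      ForceRel p (.brk l c) (.brk l c')
  | tryCatch (c : RClo S) (x : S.Var) (d : RClo S) (c' d' : Exp S) : ForceRel p c c' →
      BindRel x d d' → ForceRel p (.tryCatch c x d) (.tryCatch c' x d')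
  | tryFinally (c d : RClo S) (c' d' : Exp S) : ForceRel p c c' → ForceRel p d d' →
      ForceRel p (.tryFinally c d) (.tryFinally c' d')
  | throw (c : RClo S) (c' : Exp S) : ForceRel p c c' → ForceRel p (.throw c) (.throw c')
  | op (o : S.Op) (ds : List (RClo S)) (ds' : List (Exp S)) :
      List.Forall₂ (ForceRel p) ds ds' → ForceRel p (.op o ds) (.op o ds')
  | throwJump (v : RVal S) (w : SynVal S) (C : SCtx S) (u : Exp S) : p → ForceV v w →
      IsThrowCtx C → u = plugE C (.throw w.toExp) → ForceRel p (.throw (.val v)) u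
  | brkJump (l : S.Lab) (v : RVal S) (w : SynVal S) (C : SCtx S) (u : Exp S) : p → ForceV v w →
      IsBreakCtx C → u = plugE C (.brk l w.toExp) → ForceRel p (.brk l (.val v)) u

variable {p : Prop}

abbrev ForceFrame (p : Prop) : Frame S (RClo S) (RVal S) → Frame S (Exp S) (SynVal S) → Prop :=
  FrameRel (ForceRel p) BindRel ForceV

abbrev ForceCtx (p : Prop) : RCtx S → SCtx S → Prop := List.Forall₂ (ForceFrame p)

theorem ForceV.rel {v : RVal S} {w : SynVal S} (h : ForceV v w) : ForceRel p (.val v) w.toExp :=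
  .val v w _ h rfl

theorem forceV_of {v : RVal S} (h : VClosed v) : ForceV v (forceVal v) := ⟨h, rfl⟩

theorem forceRel_vals {vs : List (RVal S)} {ws : List (SynVal S)} (h : List.Forall₂ ForceV vs ws) :
    List.Forall₂ (ForceRel p) (vs.map .val) (ws.map PVal.toExp) := by
  induction h with
  | nil => exact .nil
  | cons h _ ih => exact .cons h.rel ih

theorem forceRel_vals_left {vs : List (RVal S)} {us : List (Exp S)}
    (h : List.Forall₂ (ForceRel p) (vs.map .val) us) :
    ∃ ws, us = ws.map PVal.toExp ∧ List.Forall₂ ForceV vs ws := by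
  induction vs generalizing us with
  | nil => cases h; exact ⟨[], rfl, .nil⟩
  | cons v vs ih =>
    cases h with
    | cons hv h =>
      cases hv with
      | val _ w _ hv hu =>
        obtain ⟨ws, rfl, hvs⟩ := ih h
        exact ⟨w :: ws, by rw [hu]; rfl, .cons hv hvs⟩

theorem forceRel_fields {vs : List (String × RVal S)} {ws : List (String × SynVal S)}
    (h : List.Forall₂ (PairRel ForceV) vs ws) :
    List.Forall₂ (PairRel (ForceRel p)) (vs.map fun q => (q.1, .val q.2))
      (PVal.toExpFields ws) := by
  induction h with
  | nil => exact .nil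
  | cons h _ ih => cases h with | mk s a b h => exact .cons (.mk _ _ _ h.rel) ih

theorem forceRel_fields_left {vs : List (String × RVal S)} {us : List (String × Exp S)}
    (h : List.Forall₂ (PairRel (ForceRel p)) (vs.map fun q => (q.1, .val q.2)) us) :
    ∃ ws, us = PVal.toExpFields ws ∧ List.Forall₂ (PairRel ForceV) vs ws := by
  induction vs generalizing us with
  | nil => cases h; exact ⟨[], rfl, .nil⟩
  | cons v vs ih =>
    cases h with
    | cons hv h =>
      cases hv with
      | mk s _ b hv =>
        cases hv with
        | val _ w _ hv hu =>
          obtain ⟨ws, rfl, hvs⟩ := ih h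
          exact ⟨(v.1, w) :: ws, by rw [hu]; rfl, .cons (.mk _ _ _ hv) hvs⟩

theorem forceV_record {fs : List (String × RVal S)} {gs : List (String × SynVal S)}
    (h : List.Forall₂ (PairRel ForceV) fs gs) : ForceV (.record fs) (.record gs) := by
  constructor
  · refine .record fs ?_
    induction h with
    | nil => simp
    | cons h _ ih => cases h with | mk s a b h => exact List.forall_mem_cons.2 ⟨h.1, ih⟩
  · rw [forceVal, forceFields_eq]
    congr 1
    induction h with
    | nil => rfl
    | cons h _ ih => cases h with | mk s a b h => rw [ih, h.2]; rfl

theorem forceV_record_inv {fs : List (String × RVal S)} {w : SynVal S} (h : ForceV (.record fs) w) :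
    ∃ gs, w = .record gs ∧ List.Forall₂ (PairRel ForceV) fs gs := by
  obtain ⟨h1, rfl⟩ := h
  rw [forceVal, forceFields_eq]
  refine ⟨_, rfl, ?_⟩
  cases h1 with
  | record _ h =>
    induction fs with
    | nil => exact .nil
    | cons p fs ih =>
      rw [List.forall_mem_cons] at h
      exact .cons (.mk _ _ _ (forceV_of h.1)) (ih h.2)

theorem forceV_isFn {v : RVal S} {w : SynVal S} (h : ForceV v w) : w.IsFn ↔ v.IsFn := by
  obtain ⟨_, rfl⟩ := h; cases v <;> simp [PVal.IsFn, forceVal]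

theorem forceV_isRecord {v : RVal S} {w : SynVal S} (h : ForceV v w) :
    w.IsRecord ↔ v.IsRecord := by
  obtain ⟨_, rfl⟩ := h; cases v <;> simp [PVal.IsRecord, forceVal]

theorem forceV_isStr {v : RVal S} {w : SynVal S} (h : ForceV v w) : w.IsStr ↔ v.IsStr := by
  obtain ⟨_, rfl⟩ := h; cases v <;> simp [PVal.IsStr, forceVal]

theorem forceV_isBool {v : RVal S} {w : SynVal S} (h : ForceV v w) : w.IsBool ↔ v.IsBool := by
  obtain ⟨_, rfl⟩ := h; cases v <;> simp [PVal.IsBool, forceVal]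

theorem forceV_isAddr {v : RVal S} {w : SynVal S} (h : ForceV v w) : w.IsAddr ↔ v.IsAddr := by
  obtain ⟨_, rfl⟩ := h; cases v <;> simp [PVal.IsAddr, forceVal]

theorem forceV_const (k : Const S) : ForceV (.const k) (.const k) := ⟨.const k, rfl⟩

theorem forceV_addr (a : S.Addr) : ForceV (.addr a : RVal S) (.addr a) := ⟨.addr a, rfl⟩

theorem forceV_errVal (msg : RuntimeError → String) (k : RuntimeError) :
    ForceV (errVal msg k : RVal S) (errVal msg k) := forceV_const _

theorem forceV_ofData (r : PVal S Empty) : ForceV (ofData r : RVal S) (ofData r) := by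
  induction r using PVal.ind with
  | const k => exact forceV_const k
  | addr a => exact forceV_addr a
  | fn f => exact f.elim
  | record fs ih =>
    simp only [ofData, PVal.map, PVal.mapFields_eq] at ih ⊢
    refine forceV_record ?_
    induction fs with
    | nil => exact .nil
    | cons q fs ihf =>
      rw [List.forall_mem_cons] at ih
      exact .cons (.mk _ _ _ ih.1) (ihf ih.2)

/-- Forcing alters only the inside of function values, which `δ` does not see. It renames nothing,
so equivariance plays no role on this side. -/
theorem skeleton_force (v : RVal S) : skeleton (forceVal v) = skeleton v := by
  induction v using PVal.ind with
  | const k => simp [skeleton, forceVal, PVal.map]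
  | addr a => simp [skeleton, forceVal, PVal.map]
  | fn f => obtain ⟨f, ρ⟩ := f; simp [skeleton, forceVal, PVal.map]
  | record fs ih =>
    simp only [skeleton, forceVal, PVal.map, PVal.mapFields_eq, forceFields_eq, List.map_map,
      PVal.record.injEq] at ih ⊢
    exact List.map_congr_left fun q hq => by simp [ih q hq]

theorem skeletons_force {vs : List (RVal S)} {ws : List (SynVal S)}
    (h : List.Forall₂ ForceV vs ws) : ws.map skeleton = vs.map skeleton := by
  induction h with
  | nil => rfl
  | cons h _ ih => rw [List.map_cons, List.map_cons, ih, h.2, skeleton_force]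

/-! Plugging. -/

theorem plugE_append (E E' : SCtx S) (u : Exp S) : plugE (E ++ E') u = plugE E' (plugE E u) := by
  induction E generalizing u with
  | nil => rfl
  | cons F E ih => exact ih _

theorem forceRel_plugClo {F : Frame S (RClo S) (RVal S)} {F' : Frame S (Exp S) (SynVal S)}
    {c : RClo S} {u : Exp S} (hF : ForceFrame p F F') (hc : ForceRel p c u) :
    ForceRel p (F.plugClo c) (F'.plugExp u) := by
  cases hF with
  | appArg _ _ _ _ _ _ hv hvs hds =>
    exact .app _ _ _ _ hv.rel (forall₂_append (forceRel_vals hvs) (.cons hc hds))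
  | recordF _ _ s _ _ hvs hds =>
    exact .record _ _ (forall₂_append (forceRel_fields hvs) (.cons (.mk _ _ _ hc) hds))
  | opF _ _ _ _ _ hvs hds =>
    exact .op _ _ _ (forall₂_append (forceRel_vals hvs) (.cons hc hds))
  | letF _ _ _ h => exact .letE _ _ _ _ _ hc h
  | catchF _ _ _ h => exact .tryCatch _ _ _ _ _ hc h
  | appFun _ _ h => exact .app _ _ _ _ hc h
  | getL _ _ h => exact .get _ _ _ _ hc h
  | getR _ _ h => exact .get _ _ _ _ h.rel hc
  | setL _ _ _ _ h h' => exact .set _ _ _ _ _ _ hc h h'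
  | setM _ _ _ _ h h' => exact .set _ _ _ _ _ _ h.rel hc h'
  | setR _ _ _ _ h h' => exact .set _ _ _ _ _ _ h.rel h'.rel hc
  | delL _ _ h => exact .del _ _ _ _ hc h
  | delR _ _ h => exact .del _ _ _ _ h.rel hc
  | refF => exact .ref _ _ hc
  | derefF => exact .deref _ _ hc
  | assignL _ _ h => exact .assign _ _ _ _ hc h
  | assignR _ _ h => exact .assign _ _ _ _ h.rel hc
  | iteF _ _ _ _ h h' => exact .ite _ _ _ _ _ _ hc h h'
  | seqF _ _ h => exact .seq _ _ _ _ hc h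
  | throwF => exact .throw _ _ hc
  | brkF l => exact .brk _ _ _ hc
  | finallyF _ _ h => exact .tryFinally _ _ _ _ hc h
  | labelF l => exact .label _ _ _ hc

theorem forceRel_plug {E : RCtx S} {E' : SCtx S} {c : RClo S} {u : Exp S} (hE : ForceCtx p E E')
    (hc : ForceRel p c u) : ForceRel p (plug E c) (plugE E' u) := by
  induction hE generalizing c u with
  | nil => exact hc
  | cons hF _ ih => exact ih (forceRel_plugClo hF hc)

def Clo.IsVal {R : Type} (c : Clo S R) : Prop := ∃ v, c = .val v

theorem not_isVal_plugClo (F : Frame S (RClo S) (RVal S)) (c : RClo S) : ¬ (F.plugClo c).IsVal := by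
  rintro ⟨v, h⟩
  cases F <;> simp [Frame.plugClo] at h

/-- The exclusion of values is needed for `throw` and `brk`. With a value in the hole such a closure
may be related to a pending jump, whose expression can have other frames on its outside and then
offers no frame of the same shape. -/
theorem forceRel_plugClo_left {F : Frame S (RClo S) (RVal S)} {c : RClo S} {u : Exp S}
    (hn : ¬ c.IsVal) (h : ForceRel p (F.plugClo c) u) :
    ∃ F' u', u = F'.plugExp u' ∧ ForceFrame p F F' ∧ ForceRel p c u' := by
  cases F with
  | letF => cases h with | letE _ _ _ _ _ h h' => exact ⟨.letF _ _, _, rfl, .letF _ _ _ h', h⟩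
  | appFun => cases h with | app _ _ _ _ h h' => exact ⟨.appFun _, _, rfl, .appFun _ _ h', h⟩
  | appArg v vs ds =>
    cases h with
    | app _ _ _ _ h h' =>
      cases h with
      | val _ w _ hv hu =>
        obtain ⟨_, _, rfl, h1, h2⟩ := forall₂_append_left h'
        obtain ⟨ws, rfl, hvs⟩ := forceRel_vals_left h1
        cases h2 with
        | cons hc hds =>
          exact ⟨.appArg w ws _, _, by rw [hu]; rfl, .appArg _ _ _ _ _ _ hv hvs hds, hc⟩
  | recordF vs s ds =>
    cases h with
    | record _ _ h' =>
      obtain ⟨_, _, rfl, h1, h2⟩ := forall₂_append_left h'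
      obtain ⟨ws, rfl, hvs⟩ := forceRel_fields_left h1
      cases h2 with
      | cons hc hds =>
        cases hc with
        | mk _ _ b hc => exact ⟨.recordF ws s _, _, rfl, .recordF _ _ _ _ _ hvs hds, hc⟩
  | opF o vs ds =>
    cases h with
    | op _ _ _ h' =>
      obtain ⟨_, _, rfl, h1, h2⟩ := forall₂_append_left h'
      obtain ⟨ws, rfl, hvs⟩ := forceRel_vals_left h1
      cases h2 with
      | cons hc hds => exact ⟨.opF o ws _, _, rfl, .opF _ _ _ _ _ hvs hds, hc⟩
  | getL => cases h with | get _ _ _ _ h h' => exact ⟨.getL _, _, rfl, .getL _ _ h', h⟩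
  | getR =>
    cases h with
    | get _ _ _ _ h h' =>
      cases h with | val _ _ _ h hu => exact ⟨.getR _, _, by rw [hu]; rfl, .getR _ _ h, h'⟩
  | setL =>
    cases h with
    | set _ _ _ _ _ _ h h' h'' => exact ⟨.setL _ _, _, rfl, .setL _ _ _ _ h' h'', h⟩
  | setM =>
    cases h with
    | set _ _ _ _ _ _ h h' h'' =>
      cases h with
      | val _ _ _ h hu => exact ⟨.setM _ _, _, by rw [hu]; rfl, .setM _ _ _ _ h h'', h'⟩
  | setR =>
    cases h with
    | set _ _ _ _ _ _ h h' h'' =>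
      cases h with
      | val _ _ _ h hu =>
        cases h' with
        | val _ _ _ h' hu' =>
          exact ⟨.setR _ _, _, by rw [hu, hu']; rfl, .setR _ _ _ _ h h', h''⟩
  | delL => cases h with | del _ _ _ _ h h' => exact ⟨.delL _, _, rfl, .delL _ _ h', h⟩
  | delR =>
    cases h with
    | del _ _ _ _ h h' =>
      cases h with | val _ _ _ h hu => exact ⟨.delR _, _, by rw [hu]; rfl, .delR _ _ h, h'⟩
  | refF => cases h with | ref _ _ h => exact ⟨.refF, _, rfl, .refF, h⟩
  | derefF => cases h with | deref _ _ h => exact ⟨.derefF, _, rfl, .derefF, h⟩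
  | assignL =>
    cases h with | assign _ _ _ _ h h' => exact ⟨.assignL _, _, rfl, .assignL _ _ h', h⟩
  | assignR =>
    cases h with
    | assign _ _ _ _ h h' =>
      cases h with
      | val _ _ _ h hu => exact ⟨.assignR _, _, by rw [hu]; rfl, .assignR _ _ h, h'⟩
  | iteF =>
    cases h with
    | ite _ _ _ _ _ _ h h' h'' => exact ⟨.iteF _ _, _, rfl, .iteF _ _ _ _ h' h'', h⟩
  | seqF => cases h with | seq _ _ _ _ h h' => exact ⟨.seqF _, _, rfl, .seqF _ _ h', h⟩
  | throwF =>
    cases h with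
    | throw _ _ h => exact ⟨.throwF, _, rfl, .throwF, h⟩
    | throwJump => exact absurd ⟨_, rfl⟩ hn
  | brkF l =>
    cases h with
    | brk _ _ _ h => exact ⟨.brkF l, _, rfl, .brkF l, h⟩
    | brkJump => exact absurd ⟨_, rfl⟩ hn
  | catchF =>
    cases h with | tryCatch _ _ _ _ _ h h' => exact ⟨.catchF _ _, _, rfl, .catchF _ _ _ h', h⟩
  | finallyF =>
    cases h with | tryFinally _ _ _ _ h h' => exact ⟨.finallyF _, _, rfl, .finallyF _ _ h', h⟩
  | labelF l => cases h with | label _ _ _ h => exact ⟨.labelF l, _, rfl, .labelF l, h⟩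

theorem forceRel_plug_left {E : RCtx S} {c : RClo S} {u : Exp S} (hn : ¬ c.IsVal)
    (h : ForceRel p (plug E c) u) :
    ∃ E' u', u = plugE E' u' ∧ ForceCtx p E E' ∧ ForceRel p c u' := by
  induction E generalizing c with
  | nil => exact ⟨[], u, rfl, .nil, h⟩
  | cons F E ih =>
    obtain ⟨E', u', rfl, hE, hc⟩ := ih (not_isVal_plugClo F c) h
    obtain ⟨F', u', rfl, hF, hc⟩ := forceRel_plugClo_left hn hc
    exact ⟨F' :: E', u', rfl, .cons hF hE, hc⟩

/-! Propagation and stores. -/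

theorem forceRel_clos_list {ρ : REnv S} (hρ : ∀ x v, ρ.lookup x = some v → VClosed v)
    {es : List (Exp S)} (h : ∀ x ∈ Exp.fvList es, x ∈ ([] : List S.Var) ∨ (ρ.lookup x).isSome) :
    List.Forall₂ (ForceRel p) (es.map fun e => .clos e ρ) (Exp.substList (envSub ρ) es) := by
  induction es with
  | nil => exact .nil
  | cons e es ih =>
    exact .cons (.clos _ _ _ ⟨hρ, fun x hx => h x (.inl hx)⟩ rfl) (ih fun x hx => h x (.inr hx))

theorem forceRel_clos_fields {ρ : REnv S} (hρ : ∀ x v, ρ.lookup x = some v → VClosed v)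
    {fs : List (String × Exp S)}
    (h : ∀ x ∈ Exp.fvFields fs, x ∈ ([] : List S.Var) ∨ (ρ.lookup x).isSome) :
    List.Forall₂ (PairRel (ForceRel p)) (fs.map fun q => (q.1, .clos q.2 ρ))
      (Exp.substFields (envSub ρ) fs) := by
  induction fs with
  | nil => exact .nil
  | cons q fs ih =>
    exact .cons (.mk _ _ _ (.clos _ _ _ ⟨hρ, fun x hx => h x (.inl hx)⟩ rfl))
      (ih fun x hx => h x (.inr hx))

theorem bindRel_clos {ρ : REnv S} (hρ : ∀ x v, ρ.lookup x = some v → VClosed v) {y : S.Var}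
    {e : Exp S} (h : ∀ x ∈ e.fv \ {y}, x ∈ ([] : List S.Var) ∨ (ρ.lookup x).isSome) :
    BindRel y (.clos e ρ) (e.subst ((envSub ρ).hide [y])) := by
  refine ⟨e, ρ, rfl, ⟨hρ, fun x hx => ?_⟩, rfl⟩
  by_cases hxy : x = y
  · simp [hxy]
  · exact .inr ((h x ⟨hx, hxy⟩).resolve_left (by simp))

/-- Substitution is defined by recursion through the constructors, so propagating an environment
does not change the forced expression. -/
theorem propagate_force {ρ : REnv S} {e : Exp S} {c : RClo S} (he : Scoped ρ [] e)
    (h : Propagate ρ e c) : ForceRel p c (e.subst (envSub ρ)) := by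
  obtain ⟨hρ, hx⟩ := he
  have clos : ∀ {f : Exp S}, (∀ x ∈ f.fv, x ∈ ([] : List S.Var) ∨ (ρ.lookup x).isSome) →
      ForceRel p (.clos f ρ) (f.subst (envSub ρ)) := fun h => .clos _ _ _ ⟨hρ, h⟩ rfl
  cases h with
  | const k => exact (forceV_const k).rel
  | addr a => exact (forceV_addr a).rel
  | func xs f =>
    refine .val _ _ _ (forceV_of (.fn _ _ (fun x hxf => ?_) hρ)) rfl
    by_cases hxs : x ∈ xs
    · exact .inl hxs
    · exact .inr ((hx x ⟨hxf, hxs⟩).resolve_left (by simp))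
  | record fs => exact .record _ _ (forceRel_clos_fields hρ hx)
  | letE x f g =>
    exact .letE _ _ _ _ _ (clos fun x h => hx x (.inl h)) (bindRel_clos hρ fun x h => hx x (.inr h))
  | tryCatch f x g =>
    exact .tryCatch _ _ _ _ _ (clos fun x h => hx x (.inl h))
      (bindRel_clos hρ fun x h => hx x (.inr h))
  | app f gs =>
    exact .app _ _ _ _ (clos fun x h => hx x (.inl h))
      (forceRel_clos_list hρ fun x h => hx x (.inr h))
  | op o fs => exact .op _ _ _ (forceRel_clos_list hρ hx)
  | _ =>
    constructor <;>
      first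
      | exact clos hx
      | exact clos fun x h => hx x (.inl h)
      | exact clos fun x h => hx x (.inr h)
      | exact clos fun x h => hx x (.inl (.inl h))
      | exact clos fun x h => hx x (.inl (.inr h))

/-- The substitution of the environment leaves `x` open under its binder, and the incoming value
fills exactly this gap. -/
theorem BindRel.subst {x : S.Var} {e : Exp S} {ρ : REnv S} {u : Exp S}
    (h : BindRel x (.clos e ρ) u) {v : RVal S} {w : SynVal S} (hv : ForceV v w) :
    ForceRel p (.clos e (ρ.extend [(x, v)])) (u.subst (Sub.ofList [(x, w)])) := by
  obtain ⟨e', ρ', he, hs, rfl⟩ := h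
  cases he
  obtain ⟨hv, rfl⟩ := hv
  exact .clos _ _ _ (hs.extend (vs := [v]) rfl (by simpa using hv))
    (hs.subst_extend (vs := [v]) rfl)

theorem fault_force {c : RClo S} {u : Exp S} {k : RuntimeError} (h : ForceRel p c u)
    (hf : Fault c k) : SubFault u k := by
  cases hf with
  | notFunction v vs hv =>
    cases h with
    | app _ _ _ _ h h' =>
      cases h with
      | val _ w _ h hu =>
        obtain ⟨ws, rfl, _⟩ := forceRel_vals_left h'
        subst hu
        exact .notFunction w ws (by rwa [forceV_isFn h])
  | arity xs e ρ vs hl =>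
    cases h with
    | app _ _ _ _ h h' =>
      cases h with
      | val _ w _ h hu =>
        obtain ⟨ws, rfl, hvs⟩ := forceRel_vals_left h'
        subst hu
        obtain ⟨_, rfl⟩ := h
        exact .arity _ _ _ (by rwa [← hvs.length_eq])
  | getRecord v u hv =>
    cases h with
    | get _ _ _ _ h h' =>
      cases h with
      | val _ w _ h hu =>
        cases h' with
        | val _ w' _ h' hu' =>
          subst hu hu'
          exact .getRecord _ _ (by rwa [forceV_isRecord h])
  | getString v u hv hs =>
    cases h with
    | get _ _ _ _ h h' =>
      cases h with
      | val _ w _ h hu =>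
        cases h' with
        | val _ w' _ h' hu' =>
          subst hu hu'
          exact .getString _ _ (by rwa [forceV_isRecord h]) (by rwa [forceV_isStr h'])
  | delRecord v u hv =>
    cases h with
    | del _ _ _ _ h h' =>
      cases h with
      | val _ w _ h hu =>
        cases h' with
        | val _ w' _ h' hu' =>
          subst hu hu'
          exact .delRecord _ _ (by rwa [forceV_isRecord h])
  | delString v u hv hs =>
    cases h with
    | del _ _ _ _ h h' =>
      cases h with
      | val _ w _ h hu =>
        cases h' with
        | val _ w' _ h' hu' =>
          subst hu hu'
          exact .delString _ _ (by rwa [forceV_isRecord h]) (by rwa [forceV_isStr h'])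
  | setRecord v u t hv =>
    cases h with
    | set _ _ _ _ _ _ h h' h'' =>
      cases h with
      | val _ w _ h hu =>
        cases h' with
        | val _ w' _ h' hu' =>
          cases h'' with
          | val _ w'' _ h'' hu'' =>
            subst hu hu' hu''
            exact .setRecord _ _ _ (by rwa [forceV_isRecord h])
  | setString v u t hv hs =>
    cases h with
    | set _ _ _ _ _ _ h h' h'' =>
      cases h with
      | val _ w _ h hu =>
        cases h' with
        | val _ w' _ h' hu' =>
          cases h'' with
          | val _ w'' _ h'' hu'' =>
            subst hu hu' hu''
            exact .setString _ _ _ (by rwa [forceV_isRecord h]) (by rwa [forceV_isStr h'])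
  | notBoolean v _ _ hv =>
    cases h with
    | ite _ _ _ _ _ _ h h' h'' =>
      cases h with
      | val _ w _ h hu => subst hu; exact .notBoolean _ _ _ (by rwa [forceV_isBool h])
  | deref v hv =>
    cases h with
    | deref _ _ h =>
      cases h with | val _ w _ h hu => subst hu; exact .deref _ (by rwa [forceV_isAddr h])
  | assign v u hv =>
    cases h with
    | assign _ _ _ _ h h' =>
      cases h with
      | val _ w _ h hu =>
        cases h' with
        | val _ w' _ h' hu' =>
          subst hu hu'
          exact .assign _ _ (by rwa [forceV_isAddr h])

/-- Stores related by forcing. -/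
structure ForceStore (σ : Store S (RVal S)) (τ : Store S (SynVal S)) : Prop where
  forces : ForcesStore σ τ
  closed : ∀ a v, σ.lookup a = some v → VClosed v

theorem ForceStore.empty : ForceStore (∅ : Store S (RVal S)) ∅ where
  forces a := by simp
  closed a v h := by simp at h

theorem ForceStore.mem_iff {σ : Store S (RVal S)} {τ : Store S (SynVal S)} (h : ForceStore σ τ)
    (a : S.Addr) : a ∈ τ ↔ a ∈ σ := by
  rw [← Finmap.lookup_isSome, ← Finmap.lookup_isSome, h.forces a, Option.isSome_map]

theorem ForceStore.insert {σ : Store S (RVal S)} {τ : Store S (SynVal S)} (h : ForceStore σ τ)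
    (a : S.Addr) {v : RVal S} {w : SynVal S} (hv : ForceV v w) :
    ForceStore (σ.insert a v) (τ.insert a w) := by
  obtain ⟨hv, rfl⟩ := hv
  constructor
  · intro b
    by_cases hb : b = a
    · subst hb; simp
    · rw [Finmap.lookup_insert_of_ne _ hb, Finmap.lookup_insert_of_ne _ hb]
      exact h.forces b
  · intro b u hu
    by_cases hb : b = a
    · subst hb
      rw [Finmap.lookup_insert] at hu
      cases hu
      exact hv
    · rw [Finmap.lookup_insert_of_ne _ hb] at hu
      exact h.closed b u hu

theorem ForceStore.lookup {σ : Store S (RVal S)} {τ : Store S (SynVal S)} (h : ForceStore σ τ)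
    {a : S.Addr} {v : RVal S} (hv : σ.lookup a = some v) :
    ∃ w, τ.lookup a = some w ∧ ForceV v w :=
  ⟨forceVal v, by rw [h.forces a, hv]; rfl, h.closed a v hv, rfl⟩

theorem ForceStore.lookup_right {σ : Store S (RVal S)} {τ : Store S (SynVal S)}
    (h : ForceStore σ τ) {a : S.Addr} {w : SynVal S} (hw : τ.lookup a = some w) :
    ∃ v, σ.lookup a = some v ∧ ForceV v w := by
  rw [h.forces a] at hw
  obtain ⟨v, hv, rfl⟩ := Option.map_eq_some_iff.1 hw
  exact ⟨v, hv, h.closed a v hv, rfl⟩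

end Forcing

/-! ### The substitution calculus simulates the calculus of explicit substitutions -/

section RhoToSub
variable {S : Sig} {δ : Delta S} {msg : RuntimeError → String} {p : Prop}

theorem forceFields_split {fs fs' : List (String × RVal S)} {s : String} {v : RVal S}
    {gs : List (String × SynVal S)}
    (h : List.Forall₂ (PairRel ForceV) (fs ++ (s, v) :: fs') gs) :
    ∃ hs w hs', gs = hs ++ (s, w) :: hs' ∧ List.Forall₂ (PairRel ForceV) fs hs ∧ ForceV v w ∧
      List.Forall₂ (PairRel ForceV) fs' hs' := by
  obtain ⟨hs, l, rfl, h1, h2⟩ := forall₂_append_left h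
  cases h2 with
  | cons h2 h3 => cases h2 with | mk _ _ w h2 => exact ⟨hs, w, _, rfl, h1, h2, h3⟩

theorem forceFields_cons {fs fs' : List (String × RVal S)} {s : String} {v : RVal S}
    {gs gs' : List (String × SynVal S)} {w : SynVal S} (h : List.Forall₂ (PairRel ForceV) fs gs)
    (hv : ForceV v w) (h' : List.Forall₂ (PairRel ForceV) fs' gs') :
    ForceV (.record (fs ++ (s, v) :: fs')) (.record (gs ++ (s, w) :: gs')) :=
  forceV_record (forall₂_append h (.cons (.mk s v w hv) h'))

theorem forceV_list {vs : List (RVal S)} {ws : List (SynVal S)} (h : List.Forall₂ ForceV vs ws) :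
    (∀ v ∈ vs, VClosed v) ∧ ws = vs.map forceVal := by
  induction h with
  | nil => simp
  | cons h _ ih => exact ⟨List.forall_mem_cons.2 ⟨h.1, ih.1⟩, by rw [h.2, ih.2]; rfl⟩

theorem forceRel_val_left {v : RVal S} {u : Exp S} (h : ForceRel p (.val v) u) :
    ∃ w, u = w.toExp ∧ ForceV v w := by
  cases h with
  | val _ w _ h hu => exact ⟨w, hu, h⟩

theorem forceRel_get_left {v : RVal S} {s : String} {u : Exp S}
    (h : ForceRel p (.get (.val v) (.val (.const (.str s)))) u) :
    ∃ w, u = .get w.toExp (.const (.str s)) ∧ ForceV v w := by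
  cases h with
  | get _ _ _ _ h h' =>
    obtain ⟨w, rfl, hw⟩ := forceRel_val_left h
    obtain ⟨_, rfl, _, rfl⟩ := forceRel_val_left h'
    exact ⟨w, rfl, hw⟩

theorem forceRel_del_left {v : RVal S} {s : String} {u : Exp S}
    (h : ForceRel p (.del (.val v) (.val (.const (.str s)))) u) :
    ∃ w, u = .del w.toExp (.const (.str s)) ∧ ForceV v w := by
  cases h with
  | del _ _ _ _ h h' =>
    obtain ⟨w, rfl, hw⟩ := forceRel_val_left h
    obtain ⟨_, rfl, _, rfl⟩ := forceRel_val_left h'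
    exact ⟨w, rfl, hw⟩

theorem forceRel_set_left {v v' : RVal S} {s : String} {u : Exp S}
    (h : ForceRel p (.set (.val v) (.val (.const (.str s))) (.val v')) u) :
    ∃ w w', u = .set w.toExp (.const (.str s)) w'.toExp ∧ ForceV v w ∧ ForceV v' w' := by
  cases h with
  | set _ _ _ _ _ _ h h' h'' =>
    obtain ⟨w, rfl, hw⟩ := forceRel_val_left h
    obtain ⟨_, rfl, _, rfl⟩ := forceRel_val_left h'
    obtain ⟨w', rfl, hw'⟩ := forceRel_val_left h''
    exact ⟨w, w', rfl, hw, hw'⟩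

/-- A contraction is simulated by at most one contraction. -/
theorem rhoRed_force {c d : RClo S} {u : Exp S} (h : ForceRel p c u) (hr : RhoRed δ msg c d) :
    ∃ u', (u' = u ∨ SubRed δ msg u u') ∧ ForceRel p d u' := by
  cases hr with
  -- In this case and the next two, propagation, completion of a record and variable lookup, the
  -- forced expression does not change.
  | propagate e ρ c hp =>
    cases h with
    | clos _ _ _ hs hu => exact ⟨u, .inl rfl, hu ▸ propagate_force hs hp⟩
  | record fs =>
    cases h with
    | record _ gs h =>
      obtain ⟨ws, rfl, hws⟩ := forceRel_fields_left h
      exact ⟨_, .inl rfl, (forceV_record hws).rel⟩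
  | var x ρ v hv =>
    cases h with
    | clos _ _ _ hs hu =>
      refine ⟨u, .inl rfl, .val _ _ _ (forceV_of (hs.closed x v hv)) ?_⟩
      rw [hu, Exp.subst, envSub_apply, hv]
      rfl
  | letE x v e ρ =>
    cases h with
    | letE _ _ _ _ _ h h' =>
      obtain ⟨w, rfl, hw⟩ := forceRel_val_left h
      exact ⟨_, .inr (.letE _ _ _), h'.subst hw⟩
  | app xs e ρ vs hl =>
    cases h with
    | app _ _ _ _ h h' =>
      obtain ⟨w, rfl, hw⟩ := forceRel_val_left h
      obtain ⟨ws, rfl, hws⟩ := forceRel_vals_left h'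
      obtain ⟨hc, rfl⟩ := hw
      refine ⟨_, .inr (.app _ _ _ (hl.trans hws.length_eq)), ?_⟩
      cases hc with
      | fn _ _ h1 h2 =>
        have hs : Scoped ρ xs e := ⟨h2, h1⟩
        obtain ⟨hvs, rfl⟩ := forceV_list hws
        exact .clos _ _ _ (hs.extend hl hvs) (hs.subst_extend hl)
  | get fs fs' s v =>
    obtain ⟨_, rfl, hw⟩ := forceRel_get_left h
    obtain ⟨_, rfl, hgs⟩ := forceV_record_inv hw
    obtain ⟨gs, w, gs', rfl, _, hv, _⟩ := forceFields_split hgs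
    exact ⟨_, .inr (.get _ _ _ _), hv.rel⟩
  | getNone fs s hn =>
    obtain ⟨_, rfl, hw⟩ := forceRel_get_left h
    obtain ⟨_, rfl, hgs⟩ := forceV_record_inv hw
    exact ⟨_, .inr (.getNone _ _ (by rwa [← fields_names hgs])), (forceV_const _).rel⟩
  | set fs fs' s u v =>
    obtain ⟨_, _, rfl, hw, hv⟩ := forceRel_set_left h
    obtain ⟨_, rfl, hgs⟩ := forceV_record_inv hw
    obtain ⟨gs, w, gs', rfl, h1, _, h2⟩ := forceFields_split hgs
    exact ⟨_, .inr (.set _ _ _ _ _), (forceFields_cons h1 hv h2).rel⟩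
  | setNew fs s v hn =>
    obtain ⟨_, _, rfl, hw, hv⟩ := forceRel_set_left h
    obtain ⟨_, rfl, hgs⟩ := forceV_record_inv hw
    exact ⟨_, .inr (.setNew _ _ _ (by rwa [← fields_names hgs])),
      (forceV_record (.cons (.mk s v _ hv) hgs)).rel⟩
  | del fs fs' s u =>
    obtain ⟨_, rfl, hw⟩ := forceRel_del_left h
    obtain ⟨_, rfl, hgs⟩ := forceV_record_inv hw
    obtain ⟨gs, w, gs', rfl, h1, _, h2⟩ := forceFields_split hgs
    exact ⟨_, .inr (.del _ _ _ _), (forceV_record (forall₂_append h1 h2)).rel⟩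
  | delNone fs s hn =>
    obtain ⟨_, rfl, hw⟩ := forceRel_del_left h
    obtain ⟨_, rfl, hgs⟩ := forceV_record_inv hw
    exact ⟨_, .inr (.delNone _ _ (by rwa [← fields_names hgs])), (forceV_record hgs).rel⟩
  | iteTrue c d =>
    cases h with
    | ite _ _ _ _ _ _ h h' h'' =>
      obtain ⟨_, rfl, _, rfl⟩ := forceRel_val_left h
      exact ⟨_, .inr (.iteTrue _ _), h'⟩
  | iteFalse c d =>
    cases h with
    | ite _ _ _ _ _ _ h h' h'' =>
      obtain ⟨_, rfl, _, rfl⟩ := forceRel_val_left h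
      exact ⟨_, .inr (.iteFalse _ _), h''⟩
  | seq v c =>
    cases h with
    | seq _ _ _ _ h h' =>
      obtain ⟨_, rfl, _⟩ := forceRel_val_left h
      exact ⟨_, .inr (.seq _ _), h'⟩
  | tryCatch v x c =>
    cases h with
    | tryCatch _ _ _ _ _ h h' =>
      obtain ⟨_, rfl, hw⟩ := forceRel_val_left h
      exact ⟨_, .inr (.tryCatch _ _ _), hw.rel⟩
  | tryFinally v c =>
    cases h with
    | tryFinally _ _ _ _ h h' =>
      obtain ⟨_, rfl, hw⟩ := forceRel_val_left h
      exact ⟨_, .inr (.tryFinally _ _), .seq _ _ _ _ h' hw.rel⟩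
  | label l v =>
    cases h with
    | label _ _ _ h =>
      obtain ⟨_, rfl, hw⟩ := forceRel_val_left h
      exact ⟨_, .inr (.label _ _), hw.rel⟩
  | op o vs r hr =>
    cases h with
    | op _ _ _ h =>
      obtain ⟨ws, rfl, hws⟩ := forceRel_vals_left h
      exact ⟨_, .inr (.op _ _ r (by rwa [skeletons_force hws])), (forceV_ofData r).rel⟩
  | opError o vs r hr =>
    cases h with
    | op _ _ _ h =>
      obtain ⟨ws, rfl, hws⟩ := forceRel_vals_left h
      exact ⟨_, .inr (.opError _ _ r (by rwa [skeletons_force hws])),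
        .throw _ _ (forceV_ofData r).rel⟩
  | fault c k hf =>
    exact ⟨_, .inr (.fault _ _ (fault_force h hf)), .throw _ _ (forceV_errVal msg k).rel⟩
  | _ =>
    cases h with
    | loop _ _ _ _ h h' =>
      exact ⟨_, .inr (.while _ _),
        .ite _ _ _ _ _ _ h (.seq _ _ _ _ h' (.loop _ _ _ _ h h')) (forceV_const _).rel⟩

/-- This allows a related expression to be decomposed at the hole of a contraction. -/
theorem rhoRed_not_isVal {c d : RClo S} (h : RhoRed δ msg c d) : ¬ c.IsVal := by
  rintro ⟨v, rfl⟩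
  cases h with
  | fault _ _ h => cases h

/-- Whether or not frames have been passed already, the expression is a throw below a context over
which it may jump. In the structural case that context is empty. -/
theorem forceRel_throw_left {v : RVal S} {u : Exp S} (h : ForceRel p (.throw (.val v)) u) :
    ∃ C w, IsThrowCtx C ∧ ForceV v w ∧ u = plugE C (.throw w.toExp) := by
  cases h with
  | throw _ _ h =>
    obtain ⟨w, rfl, hw⟩ := forceRel_val_left h
    exact ⟨[], w, by simp [IsThrowCtx], hw, rfl⟩
  | throwJump _ w C _ _ hw hC hu => exact ⟨C, w, hC, hw, hu⟩

theorem forceRel_brk_left {l : S.Lab} {v : RVal S} {u : Exp S}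
    (h : ForceRel p (.brk l (.val v)) u) :
    ∃ C w, IsBreakCtx C ∧ ForceV v w ∧ u = plugE C (.brk l w.toExp) := by
  cases h with
  | brk _ _ _ h =>
    obtain ⟨w, rfl, hw⟩ := forceRel_val_left h
    exact ⟨[], w, by simp [IsBreakCtx], hw, rfl⟩
  | brkJump _ _ w C _ _ hw hC hu => exact ⟨C, w, hC, hw, hu⟩

theorem IsThrowCtx.append {C C' : SCtx S} (h : IsThrowCtx C) (h' : IsThrowCtx C') :
    IsThrowCtx (C ++ C') := fun F hF => (List.mem_append.1 hF).elim (h F) (h' F)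

theorem IsBreakCtx.append {C C' : SCtx S} (h : IsBreakCtx C) (h' : IsBreakCtx C') :
    IsBreakCtx (C ++ C') := fun F hF => (List.mem_append.1 hF).elim (h F) (h' F)

theorem isThrowCtx_of_isLocal {C : SCtx S} (h : C.IsLocal) : IsThrowCtx C :=
  fun F hF => .inl (h F hF)

theorem isBreakCtx_of_isLocal {C : SCtx S} (h : C.IsLocal) : IsBreakCtx C :=
  fun F hF => .inl (h F hF)

/-- The frames kept by the lagging expression lie inside the local frames still present in the
closure; together they form one context for the jump. -/
theorem forceRel_throw_ctx {C : RCtx S} (hC : C.IsLocal) {v : RVal S} {u : Exp S}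
    (h : ForceRel p (plug C (.throw (.val v))) u) :
    ∃ C' w, IsThrowCtx C' ∧ ForceV v w ∧ u = plugE C' (.throw w.toExp) := by
  obtain ⟨C', _, rfl, hC', hc⟩ := forceRel_plug_left (by simp [Clo.IsVal]) h
  obtain ⟨C₀, w, hC₀, hw, rfl⟩ := forceRel_throw_left hc
  exact ⟨C₀ ++ C', w, hC₀.append (isThrowCtx_of_isLocal ((isLocal_of_forall₂ hC').1 hC)), hw,
    (plugE_append _ _ _).symm⟩

theorem forceRel_brk_ctx {C : RCtx S} (hC : C.IsLocal) {l : S.Lab} {v : RVal S} {u : Exp S}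
    (h : ForceRel p (plug C (.brk l (.val v))) u) :
    ∃ C' w, IsBreakCtx C' ∧ ForceV v w ∧ u = plugE C' (.brk l w.toExp) := by
  obtain ⟨C', _, rfl, hC', hc⟩ := forceRel_plug_left (by simp [Clo.IsVal]) h
  obtain ⟨C₀, w, hC₀, hw, rfl⟩ := forceRel_brk_left hc
  exact ⟨C₀ ++ C', w, hC₀.append (isBreakCtx_of_isLocal ((isLocal_of_forall₂ hC').1 hC)), hw,
    (plugE_append _ _ _).symm⟩

/-- Configurations related by forcing. -/
inductive ForceConf (p : Prop) : Conf S (RClo S) (RVal S) → Conf S (Exp S) (SynVal S) → Prop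
  | run (σ : Store S (RVal S)) (τ : Store S (SynVal S)) (c : RClo S) (u : Exp S) :
      ForceStore σ τ → ForceRel p c u → ForceConf p (.run σ c) (.run τ u)
  | err (σ : Store S (RVal S)) (τ : Store S (SynVal S)) (v : RVal S) (w : SynVal S) :
      ForceStore σ τ → ForceV v w → ForceConf p (.err σ v) (.err τ w)

abbrev SubStar (δ : Delta S) (msg : RuntimeError → String) :
    Conf S (Exp S) (SynVal S) → Conf S (Exp S) (SynVal S) → Prop :=
  Relation.ReflTransGen (SubStep δ msg)

/-- Most steps are answered by at most one step of the same kind. When an exception passes a label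
or a break passes a handler, the answer is no step: the frame stays in the expression and joins the
context of the pending jump until some rule consumes it. -/
theorem forceConf_step {x y : Conf S (RClo S) (RVal S)} {x' : Conf S (Exp S) (SynVal S)}
    (h : ForceConf True x x') (hxy : RhoStep δ msg x y) :
    ∃ y', SubStar δ msg x' y' ∧ ForceConf True y y' := by
  cases h with
  | err => cases hxy
  | run σ τ t u hs ht =>
    cases hxy with
    | red _ E c d hr =>
      obtain ⟨E', u, rfl, hE, hc⟩ := forceRel_plug_left (rhoRed_not_isVal hr) ht
      obtain ⟨u', rfl | hu, hd⟩ := rhoRed_force hc hr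
      · exact ⟨_, .refl, .run _ _ _ _ hs (forceRel_plug hE hd)⟩
      · exact ⟨_, .single (.red _ _ _ _ hu), .run _ _ _ _ hs (forceRel_plug hE hd)⟩
    | ref _ E v a ha =>
      obtain ⟨E', _, rfl, hE, hc⟩ := forceRel_plug_left (by simp [Clo.IsVal]) ht
      cases hc with
      | ref _ _ hc =>
        obtain ⟨w, rfl, hw⟩ := forceRel_val_left hc
        exact ⟨_, .single (.ref _ _ _ _ (by rwa [hs.mem_iff])),
          .run _ _ _ _ (hs.insert a hw) (forceRel_plug hE (forceV_addr a).rel)⟩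
    | deref _ E a v hv =>
      obtain ⟨E', _, rfl, hE, hc⟩ := forceRel_plug_left (by simp [Clo.IsVal]) ht
      cases hc with
      | deref _ _ hc =>
        obtain ⟨_, rfl, _, rfl⟩ := forceRel_val_left hc
        obtain ⟨w, hw, hvw⟩ := hs.lookup hv
        exact ⟨_, .single (.deref _ _ _ _ hw), .run _ _ _ _ hs (forceRel_plug hE hvw.rel)⟩
    | assign _ E a v =>
      obtain ⟨E', _, rfl, hE, hc⟩ := forceRel_plug_left (by simp [Clo.IsVal]) ht
      cases hc with
      | assign _ _ _ _ hc hv =>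
        obtain ⟨_, rfl, _, rfl⟩ := forceRel_val_left hc
        obtain ⟨w, rfl, hw⟩ := forceRel_val_left hv
        exact ⟨_, .single (.assign _ _ _ _),
          .run _ _ _ _ (hs.insert a hw) (forceRel_plug hE hw.rel)⟩
    | uncaught _ C v hC =>
      obtain ⟨C', w, hC', hw, rfl⟩ := forceRel_throw_ctx hC ht
      exact ⟨_, .single (.uncaught _ _ _ hC'), .err _ _ _ _ hs hw⟩
    | throwCatch _ E C v x e ρ hC =>
      obtain ⟨E', _, rfl, hE, hc⟩ := forceRel_plug_left (by simp [Clo.IsVal]) ht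
      cases hc with
      | tryCatch _ _ _ _ _ hc hd =>
        obtain ⟨C', w, hC', hw, rfl⟩ := forceRel_throw_ctx hC hc
        exact ⟨_, .single (.throwCatch _ _ _ _ _ _ hC'),
          .run _ _ _ _ hs (forceRel_plug hE (hd.subst hw))⟩
    | throwFinally _ E C v c hC =>
      obtain ⟨E', _, rfl, hE, hc⟩ := forceRel_plug_left (by simp [Clo.IsVal]) ht
      cases hc with
      | tryFinally _ _ _ _ hc hd =>
        obtain ⟨C', w, hC', hw, rfl⟩ := forceRel_throw_ctx hC hc
        exact ⟨_, .single (.throwFinally _ _ _ _ _ hC'),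
          .run _ _ _ _ hs (forceRel_plug hE (.seq _ _ _ _ hd (.throw _ _ hw.rel)))⟩
    | throwLabel _ E C v l hC =>
      obtain ⟨E', _, rfl, hE, hc⟩ := forceRel_plug_left (by simp [Clo.IsVal]) ht
      cases hc with
      | label _ _ _ hc =>
        obtain ⟨C', w, hC', hw, rfl⟩ := forceRel_throw_ctx hC hc
        refine ⟨_, .refl, .run _ _ _ _ hs (forceRel_plug hE
          (.throwJump v w (C' ++ [Frame.labelF l]) _ trivial hw (hC'.append ?_)
            (plugE_append C' [.labelF l] _).symm))⟩
        simp [IsThrowCtx, Frame.IsLabel]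
    | brkCatch _ E C l v x c hC =>
      obtain ⟨E', _, rfl, hE, hc⟩ := forceRel_plug_left (by simp [Clo.IsVal]) ht
      cases hc with
      | tryCatch _ _ _ _ d hc hd =>
        obtain ⟨C', w, hC', hw, rfl⟩ := forceRel_brk_ctx hC hc
        refine ⟨_, .refl, .run _ _ _ _ hs (forceRel_plug hE
          (.brkJump l v w (C' ++ [Frame.catchF x d]) _ trivial hw (hC'.append ?_)
            (plugE_append C' [.catchF x d] _).symm))⟩
        simp [IsBreakCtx, Frame.IsCatch]
    | brkFinally _ E C l v c hC =>
      obtain ⟨E', _, rfl, hE, hc⟩ := forceRel_plug_left (by simp [Clo.IsVal]) ht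
      cases hc with
      | tryFinally _ _ _ _ hc hd =>
        obtain ⟨C', w, hC', hw, rfl⟩ := forceRel_brk_ctx hC hc
        exact ⟨_, .single (.brkFinally _ _ _ _ _ _ hC'),
          .run _ _ _ _ hs (forceRel_plug hE (.seq _ _ _ _ hd (.brk _ _ _ hw.rel)))⟩
    | brkLabel _ E C l v hC =>
      obtain ⟨E', _, rfl, hE, hc⟩ := forceRel_plug_left (by simp [Clo.IsVal]) ht
      cases hc with
      | label _ _ _ hc =>
        obtain ⟨C', w, hC', hw, rfl⟩ := forceRel_brk_ctx hC hc
        exact ⟨_, .single (.brkLabel _ _ _ _ _ hC'),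
          .run _ _ _ _ hs (forceRel_plug hE hw.rel)⟩
    | brkOther _ E C l l' v hC hne =>
      obtain ⟨E', _, rfl, hE, hc⟩ := forceRel_plug_left (by simp [Clo.IsVal]) ht
      cases hc with
      | label _ _ _ hc =>
        obtain ⟨C', w, hC', hw, rfl⟩ := forceRel_brk_ctx hC hc
        exact ⟨_, .single (.brkOther _ _ _ _ _ _ hC' hne),
          .run _ _ _ _ hs (forceRel_plug hE (.brk _ _ _ hw.rel))⟩
    | brkUnmatched _ C l v hC =>
      obtain ⟨C', w, hC', hw, rfl⟩ := forceRel_brk_ctx hC ht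
      exact ⟨_, .single (.brkUnmatched _ _ _ _ hC'),
        .run _ _ _ _ hs (.throw _ _ (forceV_errVal msg _).rel)⟩

theorem envSub_empty : envSub (.empty : REnv S) = Sub.none := by
  funext x
  rw [envSub_apply]
  rfl

theorem forceConf_injJS {e : Exp S} (he : e.fv = ∅) :
    ForceConf p (injJS e) (.run ∅ e) := by
  refine .run _ _ _ _ .empty (.clos _ _ _ ⟨fun x v h => ?_, by simp [he]⟩ ?_)
  · cases h
  · rw [envSub_empty, Exp.subst_none]

theorem subEval_of_rhoEval {e : Exp S} (he : e.fv = ∅) {B : Answer S (RVal S)}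
    (h : RhoEval δ msg e B) : ∃ A, SubEval δ msg e A ∧ Forces B A := by
  have key : ∀ y, RhoStar δ msg (injJS e) y →
      ∃ y', SubStar δ msg (.run ∅ e) y' ∧ ForceConf True y y' := by
    intro y hy
    induction hy with
    | refl => exact ⟨_, .refl, forceConf_injJS he⟩
    | tail _ hxy ih =>
      obtain ⟨s, h1, h2⟩ := ih
      obtain ⟨s', h3, h4⟩ := forceConf_step h2 hxy
      exact ⟨s', h1.trans h3, h4⟩
  obtain ⟨y', h1, h2⟩ := key _ h
  cases B with
  | value σ v =>
    simp only [Answer.toRho] at h2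
    cases h2 with
    | run _ τ _ u hs hc =>
      obtain ⟨w, rfl, _, rfl⟩ := forceRel_val_left hc
      exact ⟨.value τ (forceVal v), h1, .value _ _ _ hs.forces⟩
  | error σ v =>
    simp only [Answer.toRho] at h2
    cases h2 with
    | err _ τ _ w hs hw =>
      obtain ⟨_, rfl⟩ := hw
      exact ⟨.error τ (forceVal v), h1, .error _ _ _ hs.forces⟩

end RhoToSub

/-! ### The calculus of explicit substitutions simulates the substitution calculus -/

section SubToRho
variable {S : Sig} {δ : Delta S} {msg : RuntimeError → String}

/-- Reduction of closures in every context and store. -/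
def CStar (δ : Delta S) (msg : RuntimeError → String) (c d : RClo S) : Prop :=
  ∀ σ E, RhoStar δ msg (.run σ (plug E c)) (.run σ (plug E d))

theorem CStar.refl (c : RClo S) : CStar δ msg c c := fun _ _ => .refl

theorem CStar.trans {c d e : RClo S} (h : CStar δ msg c d) (h' : CStar δ msg d e) :
    CStar δ msg c e := fun σ E => (h σ E).trans (h' σ E)

theorem CStar.of_red {c d : RClo S} (h : RhoRed δ msg c d) : CStar δ msg c d :=
  fun σ E => .single (.red σ E c d h)

theorem CStar.frame (F : Frame S (RClo S) (RVal S)) {c d : RClo S} (h : CStar δ msg c d) :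
    CStar δ msg (F.plugClo c) (F.plugClo d) := fun σ E => h σ (F :: E)

theorem CStar.plug (E : RCtx S) {c d : RClo S} (h : CStar δ msg c d) :
    CStar δ msg (plug E c) (plug E d) := fun σ E' => by
  rw [← plug_append, ← plug_append]
  exact h σ (E ++ E')

/-- A value closure is related to an expression only; injectivity recovers the value which that
expression stands for. -/
theorem PVal.toExp_injective : ∀ {v w : SynVal S}, v.toExp = w.toExp → v = w := by
  intro v
  induction v using PVal.ind with
  | const k => intro w h; cases w <;> simp_all [PVal.toExp]
  | addr a => intro w h; cases w <;> simp_all [PVal.toExp]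
  | fn f =>
    intro w h
    cases w with
    | fn g =>
      cases f; cases g
      simpa [PVal.toExp] using h
    | _ => simp [PVal.toExp] at h
  | record fs ih =>
    intro w h
    cases w with
    | record gs =>
      simp only [PVal.toExp, PVal.toExpFields_eq, Exp.record.injEq] at h
      congr 1
      induction fs generalizing gs with
      | nil => cases gs <;> simp_all
      | cons q fs ihf =>
        cases gs with
        | nil => simp at h
        | cons r gs =>
          rw [List.forall_mem_cons] at ih
          simp only [List.map_cons, List.cons.injEq, Prod.mk.injEq] at h
          rw [ihf ih.2 gs h.2, Prod.ext h.1.1 (ih.1 h.1.2)]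
    | _ => simp [PVal.toExp] at h

def Clo.IsClos {R : Type} (c : Clo S R) : Prop := ∃ e ρ, c = .clos e ρ

/-- Variables are the only expressions without a propagation rule, and a single propagation exposes
the outermost constructor. -/
theorem exists_propagate (ρ : REnv S) {e : Exp S} (he : ∀ x, e ≠ .var x) :
    ∃ c, Propagate ρ e c ∧ ¬ c.IsClos := by
  cases e with
  | var x => exact absurd rfl (he x)
  | _ => exact ⟨_, by constructor, by simp [Clo.IsClos]⟩

/-- One administrative step suffices: lookup, which cannot fail because the environment covers the
free variables, or propagation. Neither changes the related expression. -/
theorem exists_cstar_not_isClos {t : RClo S} {u : Exp S} (h : ForceRel False t u) :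
    ∃ c, CStar δ msg t c ∧ ForceRel False c u ∧ ¬ c.IsClos := by
  by_cases ht : t.IsClos
  · obtain ⟨e, ρ, rfl⟩ := ht
    cases h with
    | clos _ _ _ hs hu =>
      by_cases hv : ∃ x, e = .var x
      · obtain ⟨x, rfl⟩ := hv
        obtain ⟨v, hv⟩ := Option.isSome_iff_exists.1 ((hs.covers x rfl).resolve_left (by simp))
        refine ⟨.val v, .of_red (.var x ρ v hv), .val _ _ _ (forceV_of (hs.closed x v hv)) ?_,
          by simp [Clo.IsClos]⟩
        rw [hu, Exp.subst, envSub_apply, hv]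
        rfl
      · obtain ⟨c, hp, hc⟩ := exists_propagate ρ (not_exists.1 hv)
        exact ⟨c, .of_red (.propagate _ _ _ hp), hu ▸ propagate_force hs hp, hc⟩
  · exact ⟨t, .refl t, h, ht⟩

/-! Evaluation of terms that are values. -/

/-- A closure that is related to the value `w` evaluates to a value. -/
def EvalsTo (δ : Delta S) (msg : RuntimeError → String) (t : RClo S) (w : SynVal S) : Prop :=
  ∃ v, CStar δ msg t (.val v) ∧ ForceV v w

/-- Fields are evaluated from left to right. The evaluated prefix `us` and the remainder `ds` are
arbitrary, the former because it grows in the induction, the latter to allow for a hole further to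
the right. -/
theorem cstar_fields {cs : List (String × RClo S)} {ws : List (String × SynVal S)}
    (h : List.Forall₂ (PairRel (EvalsTo δ msg)) cs ws) :
    ∃ vs, List.Forall₂ (PairRel ForceV) vs ws ∧ ∀ (us : List (String × RVal S)) ds,
      CStar δ msg (.record (us.map (fun q => (q.1, .val q.2)) ++ (cs ++ ds)))
        (.record ((us ++ vs).map (fun q => (q.1, .val q.2)) ++ ds)) := by
  induction h with
  | nil => exact ⟨[], .nil, fun us ds => by simpa using .refl _⟩
  | cons h _ ih =>
    cases h with
    | mk s c w h =>
      obtain ⟨v, hv, hw⟩ := h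
      obtain ⟨vs, hvs, hs⟩ := ih
      refine ⟨(s, v) :: vs, .cons (.mk _ _ _ hw) hvs, fun us ds => ?_⟩
      refine (hv.frame (.recordF us s _)).trans ?_
      simpa [Frame.plugClo] using hs (us ++ [(s, v)]) ds

/-- The parameter `K` covers applications and operators at once; `hK` says that the next component
of the list is evaluated in a frame. -/
theorem cstar_list {cs : List (RClo S)} {ws : List (SynVal S)}
    (h : List.Forall₂ (EvalsTo δ msg) cs ws) {K : List (RClo S) → RClo S}
    (hK : ∀ (us : List (RVal S)) ds,
      ∃ F : Frame S (RClo S) (RVal S), ∀ c, K (us.map .val ++ c :: ds) = F.plugClo c) :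
    ∃ vs, List.Forall₂ ForceV vs ws ∧ ∀ (us : List (RVal S)) ds,
      CStar δ msg (K (us.map .val ++ (cs ++ ds))) (K ((us ++ vs).map .val ++ ds)) := by
  induction h with
  | nil => exact ⟨[], .nil, fun us ds => by simpa using .refl _⟩
  | @cons c _ cs _ h _ ih =>
    obtain ⟨v, hv, hw⟩ := h
    obtain ⟨vs, hvs, hs⟩ := ih
    refine ⟨v :: vs, .cons hw hvs, fun us ds => ?_⟩
    obtain ⟨F, hF⟩ := hK us (cs ++ ds)
    have h1 := hv.frame F
    rw [← hF, ← hF] at h1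
    refine h1.trans ?_
    simpa using hs (us ++ [v]) ds

theorem forceRel_toExp_val {v : RVal S} {w : SynVal S} (h : ForceRel False (.val v) w.toExp) :
    ForceV v w := by
  obtain ⟨w', hw, hv⟩ := forceRel_val_left h
  rwa [PVal.toExp_injective hw]

/-- A closure related to a value may still be a suspended pair or a record with unfinished fields,
nested to any depth. Propagation, lookup and completion of records finish it, and none of these
depends on the context or the store. -/
theorem evalsTo_of_forceRel {w : SynVal S} :
    ∀ {t : RClo S}, ForceRel False t w.toExp → EvalsTo δ msg t w := by
  induction w using PVal.ind with
  | record gs ih =>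
    intro t h
    obtain ⟨c, hs, hc, hn⟩ := exists_cstar_not_isClos (δ := δ) (msg := msg) h
    rw [PVal.toExp] at hc
    cases hc with
    | record fs _ hr =>
      have hf : List.Forall₂ (PairRel (EvalsTo δ msg)) fs gs := by
        clear hs hn h
        induction gs generalizing fs with
        | nil => cases hr; exact .nil
        | cons q gs ihg =>
          rw [List.forall_mem_cons] at ih
          cases hr with
          | cons h h' =>
            cases h with
            | mk s c _ h => exact .cons (.mk _ _ _ (ih.1 h)) (ihg ih.2 _ h')
      obtain ⟨vs, hvs, hr⟩ := cstar_fields hf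
      have := hr [] []
      simp only [List.map_nil, List.nil_append, List.append_nil] at this
      exact ⟨.record vs, (hs.trans this).trans (.of_red (.record vs)), forceV_record hvs⟩
    | val v w' _ hv hu => exact ⟨v, hs, forceRel_toExp_val (.val _ _ _ hv hu)⟩
    | clos => exact absurd ⟨_, _, rfl⟩ hn
    | throwJump => contradiction
    | brkJump => contradiction
  | _ =>
    intro t h
    obtain ⟨c, hs, hc, hn⟩ := exists_cstar_not_isClos (δ := δ) (msg := msg) h
    rw [PVal.toExp] at hc
    cases hc with
    | val v w' _ hv hu => exact ⟨v, hs, forceRel_toExp_val (.val _ _ _ hv hu)⟩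
    | clos => exact absurd ⟨_, _, rfl⟩ hn
    | throwJump => contradiction
    | brkJump => contradiction

theorem evalsTo_list {cs : List (RClo S)} {ws : List (SynVal S)}
    (h : List.Forall₂ (ForceRel False) cs (ws.map PVal.toExp)) :
    List.Forall₂ (EvalsTo δ msg) cs ws := by
  induction ws generalizing cs with
  | nil => cases h; exact .nil
  | cons w ws ih => cases h with | cons h h' => exact .cons (evalsTo_of_forceRel h) (ih h')

theorem evalsTo_fields {cs : List (String × RClo S)} {ws : List (String × SynVal S)}
    (h : List.Forall₂ (PairRel (ForceRel False)) cs (PVal.toExpFields ws)) :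
    List.Forall₂ (PairRel (EvalsTo δ msg)) cs ws := by
  induction ws generalizing cs with
  | nil => cases h; exact .nil
  | cons w ws ih =>
    cases h with
    | cons h h' =>
      cases h with | mk s c _ h => exact .cons (.mk _ _ _ (evalsTo_of_forceRel h)) (ih h')

theorem cstar_args (v : RVal S) {cs : List (RClo S)} {ws : List (SynVal S)}
    (h : List.Forall₂ (ForceRel False) cs (ws.map PVal.toExp)) :
    ∃ vs, List.Forall₂ ForceV vs ws ∧
      ∀ ds, CStar δ msg (.app (.val v) (cs ++ ds)) (.app (.val v) (vs.map .val ++ ds)) := by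
  obtain ⟨vs, hvs, hs⟩ := cstar_list (δ := δ) (msg := msg) (K := .app (.val v)) (evalsTo_list h)
    fun us ds => ⟨.appArg v us ds, fun c => rfl⟩
  exact ⟨vs, hvs, hs []⟩

theorem cstar_operands (o : S.Op) {cs : List (RClo S)} {ws : List (SynVal S)}
    (h : List.Forall₂ (ForceRel False) cs (ws.map PVal.toExp)) :
    ∃ vs, List.Forall₂ ForceV vs ws ∧
      ∀ ds, CStar δ msg (.op o (cs ++ ds)) (.op o (vs.map .val ++ ds)) := by
  obtain ⟨vs, hvs, hs⟩ := cstar_list (δ := δ) (msg := msg) (K := .op o) (evalsTo_list h)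
    fun us ds => ⟨.opF o us ds, fun c => rfl⟩
  exact ⟨vs, hvs, hs []⟩

/-! Compound terms. -/

def Exp.IsValue (u : Exp S) : Prop := ∃ w : SynVal S, u = w.toExp

/-- Only a record frame can produce a value, and only when the component in the hole is a value too.
-/
theorem not_isValue_plugExp (F : Frame S (Exp S) (SynVal S)) {u : Exp S} (hu : ¬ u.IsValue) :
    ¬ (F.plugExp u).IsValue := by
  rintro ⟨w, h⟩
  cases F with
  | recordF vs s ds =>
    cases w with
    | record gs =>
      simp only [Frame.plugExp, PVal.toExp, PVal.toExpFields_eq gs, Exp.record.injEq] at h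
      have : (s, u) ∈ gs.map fun q => (q.1, q.2.toExp) := by rw [← h]; simp
      obtain ⟨q, _, hq⟩ := List.mem_map.1 this
      exact hu ⟨q.2, (Prod.mk.inj hq).2.symm⟩
    | _ => simp [Frame.plugExp, PVal.toExp] at h
  | _ => cases w <;> simp [Frame.plugExp, PVal.toExp] at h

/-- Neither a pair of an expression and an environment nor a value. -/
def Clo.IsCompound {R : Type} : Clo S R → Prop
  | .clos _ _ => False
  | .val _ => False
  | _ => True

theorem exists_cstar_isCompound {t : RClo S} {u : Exp S} (h : ForceRel False t u)
    (hu : ¬ u.IsValue) : ∃ c, CStar δ msg t c ∧ ForceRel False c u ∧ c.IsCompound := by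
  obtain ⟨c, hs, hc, hn⟩ := exists_cstar_not_isClos (δ := δ) (msg := msg) h
  refine ⟨c, hs, hc, ?_⟩
  cases c with
  | clos => exact absurd ⟨_, _, rfl⟩ hn
  | val v =>
    obtain ⟨w, rfl, _⟩ := forceRel_val_left hc
    exact absurd ⟨w, rfl⟩ hu
  | _ => trivial

/-- Once the outermost constructor is exposed, the components before the hole are related to values
and are evaluated, which yields a proper frame. If the expression in the hole were a value, it might
be buried in a completed record and there would be no frame to exhibit. -/
theorem exists_cstar_plugClo {t : RClo S} {F' : Frame S (Exp S) (SynVal S)} {u : Exp S}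
    (h : ForceRel False t (F'.plugExp u)) (hu : ¬ u.IsValue) :
    ∃ F c, CStar δ msg t (F.plugClo c) ∧ ForceFrame False F F' ∧ ForceRel False c u := by
  obtain ⟨c, hs, hc, hn⟩ := exists_cstar_isCompound (δ := δ) (msg := msg) h
    (not_isValue_plugExp F' hu)
  cases F' with
  | letF =>
    cases hc with
    | letE _ _ _ _ _ h h' => exact ⟨.letF _ _, _, hs, .letF _ _ _ h', h⟩
    -- The other forms of relatedness are impossible: the closure is compound, and jumps are
    -- switched off.
    | _ => first | exact False.elim hn | contradiction
  | appFun =>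
    cases hc with
    | app _ _ _ _ h h' => exact ⟨.appFun _, _, hs, .appFun _ _ h', h⟩
    | _ => first | exact False.elim hn | contradiction
  | appArg =>
    cases hc with
    | app _ _ _ _ h h' =>
      obtain ⟨v, hv, hw⟩ := evalsTo_of_forceRel (δ := δ) (msg := msg) h
      obtain ⟨cs, _, rfl, h1, h2⟩ := forall₂_append_right h'
      obtain ⟨vs, hvs, hr⟩ := cstar_args (δ := δ) (msg := msg) v h1
      cases h2 with
      | cons h2 h3 =>
        exact ⟨.appArg v vs _, _, (hs.trans (hv.frame (.appFun _))).trans (hr _),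
          .appArg _ _ _ _ _ _ hw hvs h3, h2⟩
    | _ => first | exact False.elim hn | contradiction
  | recordF _ s _ =>
    cases hc with
    | record _ _ h' =>
      obtain ⟨cs, _, rfl, h1, h2⟩ := forall₂_append_right h'
      obtain ⟨vs, hvs, hr⟩ := cstar_fields (evalsTo_fields (δ := δ) (msg := msg) h1)
      cases h2 with
      | cons h2 h3 =>
        cases h2 with
        | mk _ _ _ h2 =>
          exact ⟨.recordF vs s _, _, hs.trans (hr [] _), .recordF _ _ _ _ _ hvs h3, h2⟩
    | _ => first | exact False.elim hn | contradiction
  | opF o =>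
    cases hc with
    | op _ _ _ h' =>
      obtain ⟨cs, _, rfl, h1, h2⟩ := forall₂_append_right h'
      obtain ⟨vs, hvs, hr⟩ := cstar_operands (δ := δ) (msg := msg) o h1
      cases h2 with
      | cons h2 h3 => exact ⟨.opF o vs _, _, hs.trans (hr _), .opF _ _ _ _ _ hvs h3, h2⟩
    | _ => first | exact False.elim hn | contradiction
  | getL =>
    cases hc with
    | get _ _ _ _ h h' => exact ⟨.getL _, _, hs, .getL _ _ h', h⟩
    | _ => first | exact False.elim hn | contradiction
  | getR =>
    cases hc with
    | get _ _ _ _ h h' =>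
      obtain ⟨v, hv, hw⟩ := evalsTo_of_forceRel (δ := δ) (msg := msg) h
      exact ⟨.getR v, _, hs.trans (hv.frame (.getL _)), .getR _ _ hw, h'⟩
    | _ => first | exact False.elim hn | contradiction
  | setL =>
    cases hc with
    | set _ _ _ _ _ _ h h' h'' => exact ⟨.setL _ _, _, hs, .setL _ _ _ _ h' h'', h⟩
    | _ => first | exact False.elim hn | contradiction
  | setM =>
    cases hc with
    | set _ _ _ _ _ _ h h' h'' =>
      obtain ⟨v, hv, hw⟩ := evalsTo_of_forceRel (δ := δ) (msg := msg) h
      exact ⟨.setM v _, _, hs.trans (hv.frame (.setL _ _)), .setM _ _ _ _ hw h'', h'⟩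
    | _ => first | exact False.elim hn | contradiction
  | setR =>
    cases hc with
    | set _ _ _ _ _ _ h h' h'' =>
      obtain ⟨v, hv, hw⟩ := evalsTo_of_forceRel (δ := δ) (msg := msg) h
      obtain ⟨v', hv', hw'⟩ := evalsTo_of_forceRel (δ := δ) (msg := msg) h'
      exact ⟨.setR v v', _, (hs.trans (hv.frame (.setL _ _))).trans (hv'.frame (.setM _ _)),
        .setR _ _ _ _ hw hw', h''⟩
    | _ => first | exact False.elim hn | contradiction
  | delL =>
    cases hc with
    | del _ _ _ _ h h' => exact ⟨.delL _, _, hs, .delL _ _ h', h⟩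
    | _ => first | exact False.elim hn | contradiction
  | delR =>
    cases hc with
    | del _ _ _ _ h h' =>
      obtain ⟨v, hv, hw⟩ := evalsTo_of_forceRel (δ := δ) (msg := msg) h
      exact ⟨.delR v, _, hs.trans (hv.frame (.delL _)), .delR _ _ hw, h'⟩
    | _ => first | exact False.elim hn | contradiction
  | refF =>
    cases hc with
    | ref _ _ h => exact ⟨.refF, _, hs, .refF, h⟩
    | _ => first | exact False.elim hn | contradiction
  | derefF =>
    cases hc with
    | deref _ _ h => exact ⟨.derefF, _, hs, .derefF, h⟩
    | _ => first | exact False.elim hn | contradiction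
  | assignL =>
    cases hc with
    | assign _ _ _ _ h h' => exact ⟨.assignL _, _, hs, .assignL _ _ h', h⟩
    | _ => first | exact False.elim hn | contradiction
  | assignR =>
    cases hc with
    | assign _ _ _ _ h h' =>
      obtain ⟨v, hv, hw⟩ := evalsTo_of_forceRel (δ := δ) (msg := msg) h
      exact ⟨.assignR v, _, hs.trans (hv.frame (.assignL _)), .assignR _ _ hw, h'⟩
    | _ => first | exact False.elim hn | contradiction
  | iteF =>
    cases hc with
    | ite _ _ _ _ _ _ h h' h'' => exact ⟨.iteF _ _, _, hs, .iteF _ _ _ _ h' h'', h⟩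
    | _ => first | exact False.elim hn | contradiction
  | seqF =>
    cases hc with
    | seq _ _ _ _ h h' => exact ⟨.seqF _, _, hs, .seqF _ _ h', h⟩
    | _ => first | exact False.elim hn | contradiction
  | throwF =>
    cases hc with
    | throw _ _ h => exact ⟨.throwF, _, hs, .throwF, h⟩
    | _ => first | exact False.elim hn | contradiction
  | brkF =>
    cases hc with
    | brk _ _ _ h => exact ⟨.brkF _, _, hs, .brkF _, h⟩
    | _ => first | exact False.elim hn | contradiction
  | catchF =>
    cases hc with
    | tryCatch _ _ _ _ _ h h' => exact ⟨.catchF _ _, _, hs, .catchF _ _ _ h', h⟩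
    | _ => first | exact False.elim hn | contradiction
  | finallyF =>
    cases hc with
    | tryFinally _ _ _ _ h h' => exact ⟨.finallyF _, _, hs, .finallyF _ _ h', h⟩
    | _ => first | exact False.elim hn | contradiction
  | labelF =>
    cases hc with
    | label _ _ _ h => exact ⟨.labelF _, _, hs, .labelF _, h⟩
    | _ => first | exact False.elim hn | contradiction

/-- Frames are exposed from the outermost inwards, each by reductions in the context found so far.
-/
theorem exists_cstar_plug {t : RClo S} {E : SCtx S} {u : Exp S}
    (h : ForceRel False t (plugE E u)) (hu : ¬ u.IsValue) :
    ∃ E' c, CStar δ msg t (plug E' c) ∧ ForceCtx False E' E ∧ ForceRel False c u := by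
  induction E generalizing u with
  | nil => exact ⟨[], t, .refl t, .nil, h⟩
  | cons F E ih =>
    obtain ⟨E', c, hs, hE, hc⟩ := ih h (not_isValue_plugExp F hu)
    obtain ⟨F', c', hs', hF, hc'⟩ := exists_cstar_plugClo (δ := δ) (msg := msg) hc hu
    exact ⟨F' :: E', c', hs.trans (hs'.plug E'), .cons hF hE, hc'⟩

end SubToRho

-- Redexes and jumps of the substitution calculus, simulated on closures.

section SubToRhoRedex
variable {S : Sig} {δ : Delta S} {msg : RuntimeError → String}

theorem forceV_const_right {v : RVal S} {k : Const S} (h : ForceV v (.const k)) :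
    v = .const k := by
  obtain ⟨_, h⟩ := h
  cases v <;> simp_all [forceVal]

theorem forceV_addr_right {v : RVal S} {a : S.Addr} (h : ForceV v (.addr a)) : v = .addr a := by
  obtain ⟨_, h⟩ := h
  cases v <;> simp_all [forceVal]

theorem forceV_record_right {v : RVal S} {gs : List (String × SynVal S)}
    (h : ForceV v (.record gs)) :
    ∃ fs, v = .record fs ∧ List.Forall₂ (PairRel ForceV) fs gs := by
  cases v with
  | record fs =>
    obtain ⟨gs', hg, hf⟩ := forceV_record_inv h
    cases hg
    exact ⟨fs, rfl, hf⟩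
  | _ => exact absurd h.2 (by simp [forceVal])

theorem forceV_fn_right {v : RVal S} {xs : List S.Var} {u : Exp S} (h : ForceV v (.fn ⟨xs, u⟩)) :
    ∃ e ρ, v = .fn (⟨xs, e⟩, ρ) ∧ Scoped ρ xs e ∧ u = e.subst ((envSub ρ).hide xs) := by
  obtain ⟨hc, h⟩ := h
  cases v with
  | fn f =>
    obtain ⟨⟨ys, e⟩, ρ⟩ := f
    rw [forceVal] at h
    cases h
    cases hc with
    | fn _ _ h1 h2 => exact ⟨e, ρ, rfl, ⟨h2, h1⟩, rfl⟩
  | _ => simp [forceVal] at h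

theorem forceFields_split_right {fs : List (String × RVal S)} {s : String} {w : SynVal S}
    {gs gs' : List (String × SynVal S)}
    (h : List.Forall₂ (PairRel ForceV) fs (gs ++ (s, w) :: gs')) :
    ∃ hs v hs', fs = hs ++ (s, v) :: hs' ∧ List.Forall₂ (PairRel ForceV) hs gs ∧ ForceV v w ∧
      List.Forall₂ (PairRel ForceV) hs' gs' := by
  obtain ⟨hs, l, rfl, h1, h2⟩ := forall₂_append_right h
  cases h2 with
  | cons h2 h3 => cases h2 with | mk _ v _ h2 => exact ⟨hs, v, _, rfl, h1, h2, h3⟩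

/-! Closures related to a redex evaluate to one. -/

theorem exists_cstar_let {t : RClo S} {x : S.Var} {w : SynVal S} {u : Exp S}
    (h : ForceRel False t (.letE x w.toExp u)) :
    ∃ v d, CStar δ msg t (.letE x (.val v) d) ∧ ForceV v w ∧ BindRel x d u := by
  obtain ⟨c, hs, hc, hn⟩ := exists_cstar_isCompound (δ := δ) (msg := msg) h
    (by rintro ⟨w, h⟩; cases w <;> simp [PVal.toExp] at h)
  cases hc with
  | letE _ _ _ _ _ h h' =>
    obtain ⟨v, hv, hw⟩ := evalsTo_of_forceRel (δ := δ) (msg := msg) h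
    exact ⟨v, _, hs.trans (hv.frame (.letF _ _)), hw, h'⟩
  | _ => first | exact False.elim hn | contradiction

theorem exists_cstar_app {t : RClo S} {w : SynVal S} {ws : List (SynVal S)}
    (h : ForceRel False t (.app w.toExp (ws.map PVal.toExp))) :
    ∃ v vs, CStar δ msg t (.app (.val v) (vs.map .val)) ∧ ForceV v w ∧
      List.Forall₂ ForceV vs ws := by
  obtain ⟨c, hs, hc, hn⟩ := exists_cstar_isCompound (δ := δ) (msg := msg) h
    (by rintro ⟨w, h⟩; cases w <;> simp [PVal.toExp] at h)
  cases hc with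
  | app _ ds _ _ h h' =>
    obtain ⟨v, hv, hw⟩ := evalsTo_of_forceRel (δ := δ) (msg := msg) h
    obtain ⟨vs, hvs, hr⟩ := cstar_args (δ := δ) (msg := msg) v h'
    have := hr []
    rw [List.append_nil, List.append_nil] at this
    exact ⟨v, vs, (hs.trans (hv.frame (.appFun _))).trans this, hw, hvs⟩
  | _ => first | exact False.elim hn | contradiction

theorem exists_cstar_op {t : RClo S} {o : S.Op} {ws : List (SynVal S)}
    (h : ForceRel False t (.op o (ws.map PVal.toExp))) :
    ∃ vs, CStar δ msg t (.op o (vs.map .val)) ∧ List.Forall₂ ForceV vs ws := by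
  obtain ⟨c, hs, hc, hn⟩ := exists_cstar_isCompound (δ := δ) (msg := msg) h
    (by rintro ⟨w, h⟩; cases w <;> simp [PVal.toExp] at h)
  cases hc with
  | op _ _ _ h =>
    obtain ⟨vs, hvs, hr⟩ := cstar_operands (δ := δ) (msg := msg) o h
    have := hr []
    rw [List.append_nil, List.append_nil] at this
    exact ⟨vs, hs.trans this, hvs⟩
  | _ => first | exact False.elim hn | contradiction

theorem exists_cstar_get {t : RClo S} {w w' : SynVal S}
    (h : ForceRel False t (.get w.toExp w'.toExp)) :
    ∃ v v', CStar δ msg t (.get (.val v) (.val v')) ∧ ForceV v w ∧ ForceV v' w' := by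
  obtain ⟨c, hs, hc, hn⟩ := exists_cstar_isCompound (δ := δ) (msg := msg) h
    (by rintro ⟨w, h⟩; cases w <;> simp [PVal.toExp] at h)
  cases hc with
  | get _ _ _ _ h h' =>
    obtain ⟨v, hv, hw⟩ := evalsTo_of_forceRel (δ := δ) (msg := msg) h
    obtain ⟨v', hv', hw'⟩ := evalsTo_of_forceRel (δ := δ) (msg := msg) h'
    exact ⟨v, v', (hs.trans (hv.frame (.getL _))).trans (hv'.frame (.getR _)), hw, hw'⟩
  | _ => first | exact False.elim hn | contradiction

theorem exists_cstar_del {t : RClo S} {w w' : SynVal S}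
    (h : ForceRel False t (.del w.toExp w'.toExp)) :
    ∃ v v', CStar δ msg t (.del (.val v) (.val v')) ∧ ForceV v w ∧ ForceV v' w' := by
  obtain ⟨c, hs, hc, hn⟩ := exists_cstar_isCompound (δ := δ) (msg := msg) h
    (by rintro ⟨w, h⟩; cases w <;> simp [PVal.toExp] at h)
  cases hc with
  | del _ _ _ _ h h' =>
    obtain ⟨v, hv, hw⟩ := evalsTo_of_forceRel (δ := δ) (msg := msg) h
    obtain ⟨v', hv', hw'⟩ := evalsTo_of_forceRel (δ := δ) (msg := msg) h'
    exact ⟨v, v', (hs.trans (hv.frame (.delL _))).trans (hv'.frame (.delR _)), hw, hw'⟩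
  | _ => first | exact False.elim hn | contradiction

theorem exists_cstar_assign {t : RClo S} {w w' : SynVal S}
    (h : ForceRel False t (.assign w.toExp w'.toExp)) :
    ∃ v v', CStar δ msg t (.assign (.val v) (.val v')) ∧ ForceV v w ∧ ForceV v' w' := by
  obtain ⟨c, hs, hc, hn⟩ := exists_cstar_isCompound (δ := δ) (msg := msg) h
    (by rintro ⟨w, h⟩; cases w <;> simp [PVal.toExp] at h)
  cases hc with
  | assign _ _ _ _ h h' =>
    obtain ⟨v, hv, hw⟩ := evalsTo_of_forceRel (δ := δ) (msg := msg) h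
    obtain ⟨v', hv', hw'⟩ := evalsTo_of_forceRel (δ := δ) (msg := msg) h'
    exact ⟨v, v', (hs.trans (hv.frame (.assignL _))).trans (hv'.frame (.assignR _)), hw, hw'⟩
  | _ => first | exact False.elim hn | contradiction

theorem exists_cstar_set {t : RClo S} {w w' w'' : SynVal S}
    (h : ForceRel False t (.set w.toExp w'.toExp w''.toExp)) :
    ∃ v v' v'', CStar δ msg t (.set (.val v) (.val v') (.val v'')) ∧ ForceV v w ∧ ForceV v' w' ∧
      ForceV v'' w'' := by
  obtain ⟨c, hs, hc, hn⟩ := exists_cstar_isCompound (δ := δ) (msg := msg) h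
    (by rintro ⟨w, h⟩; cases w <;> simp [PVal.toExp] at h)
  cases hc with
  | set _ _ _ _ _ _ h h' h'' =>
    obtain ⟨v, hv, hw⟩ := evalsTo_of_forceRel (δ := δ) (msg := msg) h
    obtain ⟨v', hv', hw'⟩ := evalsTo_of_forceRel (δ := δ) (msg := msg) h'
    obtain ⟨v'', hv'', hw''⟩ := evalsTo_of_forceRel (δ := δ) (msg := msg) h''
    exact ⟨v, v', v'', ((hs.trans (hv.frame (.setL _ _))).trans (hv'.frame (.setM _ _))).trans
      (hv''.frame (.setR _ _)), hw, hw', hw''⟩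
  | _ => first | exact False.elim hn | contradiction

theorem exists_cstar_ite {t : RClo S} {w : SynVal S} {e f : Exp S}
    (h : ForceRel False t (.ite w.toExp e f)) :
    ∃ v c d, CStar δ msg t (.ite (.val v) c d) ∧ ForceV v w ∧ ForceRel False c e ∧
      ForceRel False d f := by
  obtain ⟨c, hs, hc, hn⟩ := exists_cstar_isCompound (δ := δ) (msg := msg) h
    (by rintro ⟨w, h⟩; cases w <;> simp [PVal.toExp] at h)
  cases hc with
  | ite _ _ _ _ _ _ h h' h'' =>
    obtain ⟨v, hv, hw⟩ := evalsTo_of_forceRel (δ := δ) (msg := msg) h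
    exact ⟨v, _, _, hs.trans (hv.frame (.iteF _ _)), hw, h', h''⟩
  | _ => first | exact False.elim hn | contradiction

theorem exists_cstar_seq {t : RClo S} {w : SynVal S} {e : Exp S}
    (h : ForceRel False t (.seq w.toExp e)) :
    ∃ v c, CStar δ msg t (.seq (.val v) c) ∧ ForceRel False c e := by
  obtain ⟨c, hs, hc, hn⟩ := exists_cstar_isCompound (δ := δ) (msg := msg) h
    (by rintro ⟨w, h⟩; cases w <;> simp [PVal.toExp] at h)
  cases hc with
  | seq _ _ _ _ h h' =>
    obtain ⟨v, hv, _⟩ := evalsTo_of_forceRel (δ := δ) (msg := msg) h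
    exact ⟨v, _, hs.trans (hv.frame (.seqF _)), h'⟩
  | _ => first | exact False.elim hn | contradiction

theorem exists_cstar_while {t : RClo S} {e f : Exp S} (h : ForceRel False t (.while e f)) :
    ∃ c d, CStar δ msg t (.while c d) ∧ ForceRel False c e ∧ ForceRel False d f := by
  obtain ⟨c, hs, hc, hn⟩ := exists_cstar_isCompound (δ := δ) (msg := msg) h
    (by rintro ⟨w, h⟩; cases w <;> simp [PVal.toExp] at h)
  cases hc with
  | loop _ _ _ _ h h' => exact ⟨_, _, hs, h, h'⟩
  | _ => first | exact False.elim hn | contradiction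

theorem exists_cstar_label {t : RClo S} {l : S.Lab} {u : Exp S}
    (h : ForceRel False t (.label l u)) :
    ∃ c, CStar δ msg t (.label l c) ∧ ForceRel False c u := by
  obtain ⟨c, hs, hc, hn⟩ := exists_cstar_isCompound (δ := δ) (msg := msg) h
    (by rintro ⟨w, h⟩; cases w <;> simp [PVal.toExp] at h)
  cases hc with
  | label _ _ _ h => exact ⟨_, hs, h⟩
  | _ => first | exact False.elim hn | contradiction

theorem exists_cstar_tryCatch {t : RClo S} {x : S.Var} {u e : Exp S}
    (h : ForceRel False t (.tryCatch u x e)) :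
    ∃ c d, CStar δ msg t (.tryCatch c x d) ∧ ForceRel False c u ∧ BindRel x d e := by
  obtain ⟨c, hs, hc, hn⟩ := exists_cstar_isCompound (δ := δ) (msg := msg) h
    (by rintro ⟨w, h⟩; cases w <;> simp [PVal.toExp] at h)
  cases hc with
  | tryCatch _ _ _ _ _ h h' => exact ⟨_, _, hs, h, h'⟩
  | _ => first | exact False.elim hn | contradiction

theorem exists_cstar_tryFinally {t : RClo S} {u e : Exp S}
    (h : ForceRel False t (.tryFinally u e)) :
    ∃ c d, CStar δ msg t (.tryFinally c d) ∧ ForceRel False c u ∧ ForceRel False d e := by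
  obtain ⟨c, hs, hc, hn⟩ := exists_cstar_isCompound (δ := δ) (msg := msg) h
    (by rintro ⟨w, h⟩; cases w <;> simp [PVal.toExp] at h)
  cases hc with
  | tryFinally _ _ _ _ h h' => exact ⟨_, _, hs, h, h'⟩
  | _ => first | exact False.elim hn | contradiction

theorem exists_cstar_ref {t : RClo S} {w : SynVal S} (h : ForceRel False t (.ref w.toExp)) :
    ∃ v, CStar δ msg t (.ref (.val v)) ∧ ForceV v w := by
  obtain ⟨c, hs, hc, hn⟩ := exists_cstar_isCompound (δ := δ) (msg := msg) h
    (by rintro ⟨w, h⟩; cases w <;> simp [PVal.toExp] at h)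
  cases hc with
  | ref _ _ h =>
    obtain ⟨v, hv, hw⟩ := evalsTo_of_forceRel (δ := δ) (msg := msg) h
    exact ⟨v, hs.trans (hv.frame .refF), hw⟩
  | _ => first | exact False.elim hn | contradiction

theorem exists_cstar_deref {t : RClo S} {w : SynVal S} (h : ForceRel False t (.deref w.toExp)) :
    ∃ v, CStar δ msg t (.deref (.val v)) ∧ ForceV v w := by
  obtain ⟨c, hs, hc, hn⟩ := exists_cstar_isCompound (δ := δ) (msg := msg) h
    (by rintro ⟨w, h⟩; cases w <;> simp [PVal.toExp] at h)
  cases hc with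
  | deref _ _ h =>
    obtain ⟨v, hv, hw⟩ := evalsTo_of_forceRel (δ := δ) (msg := msg) h
    exact ⟨v, hs.trans (hv.frame .derefF), hw⟩
  | _ => first | exact False.elim hn | contradiction

theorem exists_cstar_throw {t : RClo S} {w : SynVal S} (h : ForceRel False t (.throw w.toExp)) :
    ∃ v, CStar δ msg t (.throw (.val v)) ∧ ForceV v w := by
  obtain ⟨c, hs, hc, hn⟩ := exists_cstar_isCompound (δ := δ) (msg := msg) h
    (by rintro ⟨w, h⟩; cases w <;> simp [PVal.toExp] at h)
  cases hc with
  | throw _ _ h =>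
    obtain ⟨v, hv, hw⟩ := evalsTo_of_forceRel (δ := δ) (msg := msg) h
    exact ⟨v, hs.trans (hv.frame .throwF), hw⟩
  | _ => first | exact False.elim hn | contradiction

theorem exists_cstar_brk {t : RClo S} {l : S.Lab} {w : SynVal S}
    (h : ForceRel False t (.brk l w.toExp)) :
    ∃ v, CStar δ msg t (.brk l (.val v)) ∧ ForceV v w := by
  obtain ⟨c, hs, hc, hn⟩ := exists_cstar_isCompound (δ := δ) (msg := msg) h
    (by rintro ⟨w, h⟩; cases w <;> simp [PVal.toExp] at h)
  cases hc with
  | brk _ _ _ h =>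
    obtain ⟨v, hv, hw⟩ := evalsTo_of_forceRel (δ := δ) (msg := msg) h
    exact ⟨v, hs.trans (hv.frame (.brkF l)), hw⟩
  | _ => first | exact False.elim hn | contradiction

theorem cstar_of_subFault {t : RClo S} {u : Exp S} {k : RuntimeError} (h : ForceRel False t u)
    (hf : SubFault u k) : CStar δ msg t (.throw (.val (errVal msg k))) := by
  -- Any faulty redex with the same kind of error will do, since the exception thrown depends on the
  -- kind alone.
  suffices ∃ c, CStar δ msg t c ∧ Fault c k by
    obtain ⟨c, hs, hc⟩ := this
    exact hs.trans (.of_red (.fault _ _ hc))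
  cases hf with
  | notFunction w ws hw =>
    obtain ⟨v, vs, hs, hv, _⟩ := exists_cstar_app (δ := δ) (msg := msg) h
    exact ⟨_, hs, .notFunction _ _ (by rwa [← forceV_isFn hv])⟩
  | arity xs e ws hl =>
    obtain ⟨v, vs, hs, hv, hvs⟩ := exists_cstar_app (δ := δ) (msg := msg) (w := .fn ⟨xs, e⟩) h
    obtain ⟨e, ρ, rfl, _, _⟩ := forceV_fn_right hv
    exact ⟨_, hs, .arity _ _ _ _ (by rwa [hvs.length_eq])⟩
  | getRecord w w' hw =>
    obtain ⟨v, v', hs, hv, hv'⟩ := exists_cstar_get (δ := δ) (msg := msg) h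
    exact ⟨_, hs, .getRecord _ _ (by rwa [← forceV_isRecord hv])⟩
  | getString w w' hw hw' =>
    obtain ⟨v, v', hs, hv, hv'⟩ := exists_cstar_get (δ := δ) (msg := msg) h
    exact ⟨_, hs, .getString _ _ (by rwa [← forceV_isRecord hv]) (by rwa [← forceV_isStr hv'])⟩
  | delRecord w w' hw =>
    obtain ⟨v, v', hs, hv, hv'⟩ := exists_cstar_del (δ := δ) (msg := msg) h
    exact ⟨_, hs, .delRecord _ _ (by rwa [← forceV_isRecord hv])⟩
  | delString w w' hw hw' =>
    obtain ⟨v, v', hs, hv, hv'⟩ := exists_cstar_del (δ := δ) (msg := msg) h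
    exact ⟨_, hs, .delString _ _ (by rwa [← forceV_isRecord hv]) (by rwa [← forceV_isStr hv'])⟩
  | setRecord w w' w'' hw =>
    obtain ⟨v, v', v'', hs, hv, hv', _⟩ := exists_cstar_set (δ := δ) (msg := msg) h
    exact ⟨_, hs, .setRecord _ _ _ (by rwa [← forceV_isRecord hv])⟩
  | setString w w' w'' hw hw' =>
    obtain ⟨v, v', v'', hs, hv, hv', _⟩ := exists_cstar_set (δ := δ) (msg := msg) h
    exact ⟨_, hs, .setString _ _ _ (by rwa [← forceV_isRecord hv]) (by rwa [← forceV_isStr hv'])⟩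
  | notBoolean w _ _ hw =>
    obtain ⟨v, _, _, hs, hv, _⟩ := exists_cstar_ite (δ := δ) (msg := msg) h
    exact ⟨_, hs, .notBoolean _ _ _ (by rwa [← forceV_isBool hv])⟩
  | deref w hw =>
    obtain ⟨v, hs, hv⟩ := exists_cstar_deref (δ := δ) (msg := msg) h
    exact ⟨_, hs, .deref _ (by rwa [← forceV_isAddr hv])⟩
  | assign w w' hw =>
    obtain ⟨v, v', hs, hv, _⟩ := exists_cstar_assign (δ := δ) (msg := msg) h
    exact ⟨_, hs, .assign _ _ (by rwa [← forceV_isAddr hv])⟩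

/-- With this a context around a redex can be exposed by `exists_cstar_plug`. -/
theorem not_isValue_of_subRed {u u' : Exp S} (h : SubRed δ msg u u') : ¬ u.IsValue := by
  rintro ⟨w, rfl⟩
  generalize hu : w.toExp = u at h
  cases h with
  | fault _ _ hf => cases hf <;> cases w <;> simp [PVal.toExp] at hu
  | _ => cases w <;> simp [PVal.toExp] at hu

/-- A contraction of the substitution calculus is simulated. -/
theorem subRed_force {t : RClo S} {u u' : Exp S} (h : ForceRel False t u)
    (hr : SubRed δ msg u u') : ∃ d, CStar δ msg t d ∧ ForceRel False d u' := by
  -- The alternative `c = d` is for run-time errors, where `cstar_of_subFault` already includes the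
  -- contraction.
  suffices ∃ c d, CStar δ msg t c ∧ (RhoRed δ msg c d ∨ c = d) ∧ ForceRel False d u' by
    obtain ⟨c, d, hs, hr | rfl, hd⟩ := this
    · exact ⟨d, hs.trans (.of_red hr), hd⟩
    · exact ⟨c, hs, hd⟩
  cases hr with
  | letE x w e =>
    obtain ⟨v, d, hs, hv, hd⟩ := exists_cstar_let (δ := δ) (msg := msg) h
    -- The rule for `let` asks for a pair of an expression and an environment under the binder.
    -- Taking a copy apart provides this and keeps `hd` for later.
    obtain ⟨f, ρ, rfl, _⟩ := id hd
    exact ⟨_, _, hs, .inl (.letE _ _ _ _), hd.subst hv⟩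
  | app xs e ws hl =>
    obtain ⟨v, vs, hs, hv, hvs⟩ := exists_cstar_app (δ := δ) (msg := msg) (w := .fn ⟨xs, e⟩) h
    obtain ⟨e, ρ, rfl, he, rfl⟩ := forceV_fn_right hv
    have hl' : xs.length = vs.length := hl.trans hvs.length_eq.symm
    obtain ⟨hcl, rfl⟩ := forceV_list hvs
    exact ⟨_, _, hs, .inl (.app _ _ _ _ hl'), .clos _ _ _ (he.extend hl' hcl)
      (he.subst_extend hl')⟩
  | get gs gs' s w =>
    obtain ⟨v, v', hs, hv, hv'⟩ := exists_cstar_get (δ := δ) (msg := msg) (w' := .const (.str s)) h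
    cases forceV_const_right hv'
    obtain ⟨fs, rfl, hf⟩ := forceV_record_right hv
    obtain ⟨_, v, _, rfl, _, hw, _⟩ := forceFields_split_right hf
    exact ⟨_, _, hs, .inl (.get _ _ _ _), hw.rel⟩
  | getNone gs s hn =>
    obtain ⟨v, v', hs, hv, hv'⟩ := exists_cstar_get (δ := δ) (msg := msg) (w' := .const (.str s)) h
    cases forceV_const_right hv'
    obtain ⟨fs, rfl, hf⟩ := forceV_record_right hv
    exact ⟨_, _, hs, .inl (.getNone _ _ (by rwa [fields_names hf])), (forceV_const _).rel⟩
  | set gs gs' s w₀ w =>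
    obtain ⟨v, v', v'', hs, hv, hv', hv''⟩ :=
      exists_cstar_set (δ := δ) (msg := msg) (w' := .const (.str s)) h
    cases forceV_const_right hv'
    obtain ⟨fs, rfl, hf⟩ := forceV_record_right hv
    obtain ⟨_, v, _, rfl, h1, _, h2⟩ := forceFields_split_right hf
    exact ⟨_, _, hs, .inl (.set _ _ _ _ _), (forceFields_cons h1 hv'' h2).rel⟩
  | setNew gs s w hn =>
    obtain ⟨v, v', v'', hs, hv, hv', hv''⟩ :=
      exists_cstar_set (δ := δ) (msg := msg) (w' := .const (.str s)) h
    cases forceV_const_right hv'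
    obtain ⟨fs, rfl, hf⟩ := forceV_record_right hv
    exact ⟨_, _, hs, .inl (.setNew _ _ _ (by rwa [fields_names hf])),
      (forceV_record (.cons (.mk s _ _ hv'') hf)).rel⟩
  | del gs gs' s w =>
    obtain ⟨v, v', hs, hv, hv'⟩ := exists_cstar_del (δ := δ) (msg := msg) (w' := .const (.str s)) h
    cases forceV_const_right hv'
    obtain ⟨fs, rfl, hf⟩ := forceV_record_right hv
    obtain ⟨_, v, _, rfl, h1, _, h2⟩ := forceFields_split_right hf
    exact ⟨_, _, hs, .inl (.del _ _ _ _), (forceV_record (forall₂_append h1 h2)).rel⟩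
  | delNone gs s hn =>
    obtain ⟨v, v', hs, hv, hv'⟩ := exists_cstar_del (δ := δ) (msg := msg) (w' := .const (.str s)) h
    cases forceV_const_right hv'
    obtain ⟨fs, rfl, hf⟩ := forceV_record_right hv
    exact ⟨_, _, hs, .inl (.delNone _ _ (by rwa [fields_names hf])), (forceV_record hf).rel⟩
  | iteTrue e f =>
    obtain ⟨v, c, d, hs, hv, hc, hd⟩ :=
      exists_cstar_ite (δ := δ) (msg := msg) (w := .const (.bool true)) h
    cases forceV_const_right hv
    exact ⟨_, _, hs, .inl (.iteTrue _ _), hc⟩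
  | iteFalse e f =>
    obtain ⟨v, c, d, hs, hv, hc, hd⟩ :=
      exists_cstar_ite (δ := δ) (msg := msg) (w := .const (.bool false)) h
    cases forceV_const_right hv
    exact ⟨_, _, hs, .inl (.iteFalse _ _), hd⟩
  | seq w e =>
    obtain ⟨v, c, hs, hc⟩ := exists_cstar_seq (δ := δ) (msg := msg) h
    exact ⟨_, _, hs, .inl (.seq _ _), hc⟩
  | tryCatch w x e =>
    obtain ⟨c, d, hs, hc, hd⟩ := exists_cstar_tryCatch (δ := δ) (msg := msg) h
    obtain ⟨v, hv, hw⟩ := evalsTo_of_forceRel (δ := δ) (msg := msg) hc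
    exact ⟨_, _, hs.trans (hv.frame (.catchF x d)), .inl (.tryCatch _ _ _), hw.rel⟩
  | tryFinally w e =>
    obtain ⟨c, d, hs, hc, hd⟩ := exists_cstar_tryFinally (δ := δ) (msg := msg) h
    obtain ⟨v, hv, hw⟩ := evalsTo_of_forceRel (δ := δ) (msg := msg) hc
    exact ⟨_, _, hs.trans (hv.frame (.finallyF d)), .inl (.tryFinally _ _),
      .seq _ _ _ _ hd hw.rel⟩
  | label l w =>
    obtain ⟨c, hs, hc⟩ := exists_cstar_label (δ := δ) (msg := msg) h
    obtain ⟨v, hv, hw⟩ := evalsTo_of_forceRel (δ := δ) (msg := msg) hc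
    exact ⟨_, _, hs.trans (hv.frame (.labelF l)), .inl (.label _ _), hw.rel⟩
  | op o ws r hr =>
    obtain ⟨vs, hs, hvs⟩ := exists_cstar_op (δ := δ) (msg := msg) h
    exact ⟨_, _, hs, .inl (.op _ _ r (by rwa [← skeletons_force hvs])), (forceV_ofData r).rel⟩
  | opError o ws r hr =>
    obtain ⟨vs, hs, hvs⟩ := exists_cstar_op (δ := δ) (msg := msg) h
    exact ⟨_, _, hs, .inl (.opError _ _ r (by rwa [← skeletons_force hvs])),
      .throw _ _ (forceV_ofData r).rel⟩
  | fault _ k hf =>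
    exact ⟨_, _, cstar_of_subFault h hf, .inr rfl, .throw _ _ (forceV_errVal msg k).rel⟩
  | _ =>
    obtain ⟨c, d, hs, hc, hd⟩ := exists_cstar_while (δ := δ) (msg := msg) h
    exact ⟨_, _, hs, .inl (.while _ _),
      .ite _ _ _ _ _ _ hc (.seq _ _ _ _ hd (.loop _ _ _ _ hc hd)) (forceV_const _).rel⟩

/-! Control effects pass one control frame at a time. -/

/-- The context `C₁` collects local frames around `r`. A further local frame extends it; a frame
that `r` can pass discards all that was collected, and collecting restarts from the empty context.
What is left at the end is local. -/
theorem exists_cstar_local {r : RClo S} {C : RCtx S}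
    (hC : ∀ F ∈ C, F.IsLocal ∨ ∀ C₁ : RCtx S, C₁.IsLocal → CStar δ msg (F.plugClo (plug C₁ r)) r)
    {C₁ : RCtx S} (h₁ : C₁.IsLocal) :
    ∃ C₀ : RCtx S, C₀.IsLocal ∧ CStar δ msg (plug C (plug C₁ r)) (plug C₀ r) := by
  induction C generalizing C₁ with
  | nil => exact ⟨C₁, h₁, .refl _⟩
  | cons F C ih =>
    rw [List.forall_mem_cons] at hC
    rcases hC.1 with hF | hF
    · have h₂ : Ctx.IsLocal (C₁ ++ [F]) := fun G hG => by
        rcases List.mem_append.1 hG with hG | hG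
        · exact h₁ G hG
        · rwa [List.mem_singleton.1 hG]
      obtain ⟨C₀, h₀, hs⟩ := ih hC.2 h₂
      rw [plug_append] at hs
      exact ⟨C₀, h₀, hs⟩
    · obtain ⟨C₀, h₀, hs⟩ := ih hC.2 (C₁ := []) (by simp [Ctx.IsLocal])
      exact ⟨C₀, h₀, ((hF C₁ h₁).plug C).trans hs⟩

/-- The jump is unrolled: each label of the exposed context is passed by a step of its own, until
only local frames remain, which is the situation that the rules for exceptions on closures require.
-/
theorem exists_cstar_throw_ctx {t : RClo S} {C : SCtx S} {w : SynVal S} (hC : IsThrowCtx C)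
    (h : ForceRel False t (plugE C (.throw w.toExp))) :
    ∃ (C₀ : RCtx S) (v : RVal S), C₀.IsLocal ∧ CStar δ msg t (plug C₀ (.throw (.val v))) ∧
      ForceV v w := by
  obtain ⟨C', c, hs, hC', hc⟩ := exists_cstar_plug (δ := δ) (msg := msg) h
    (by rintro ⟨w, h⟩; cases w <;> simp [PVal.toExp] at h)
  obtain ⟨v, hv, hw⟩ := exists_cstar_throw (δ := δ) (msg := msg) hc
  have hj : ∀ F ∈ C', F.IsLocal ∨ ∀ C₁ : RCtx S, C₁.IsLocal →
      CStar δ msg (F.plugClo (plug C₁ (.throw (.val v)))) (.throw (.val v)) := by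
    clear hs h
    induction hC' with
    | nil => simp
    | @cons F _ _ _ hF _ ih =>
      unfold IsThrowCtx at hC ih
      rw [List.forall_mem_cons] at hC ⊢
      refine ⟨?_, ih hC.2⟩
      rw [← hF.isLocal_iff, ← hF.isLabel_iff] at hC
      refine hC.1.imp id fun hl C₁ h₁ => ?_
      cases F with
      | labelF l => exact fun σ E => .single (.throwLabel σ E C₁ v l h₁)
      | _ => exact False.elim hl
  obtain ⟨C₀, h₀, hs₀⟩ := exists_cstar_local hj (C₁ := []) (by simp [Ctx.IsLocal])
  exact ⟨C₀, v, h₀, (hs.trans (hv.plug C')).trans hs₀, hw⟩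

theorem exists_cstar_brk_ctx {t : RClo S} {C : SCtx S} {l : S.Lab} {w : SynVal S}
    (hC : IsBreakCtx C) (h : ForceRel False t (plugE C (.brk l w.toExp))) :
    ∃ (C₀ : RCtx S) (v : RVal S), C₀.IsLocal ∧ CStar δ msg t (plug C₀ (.brk l (.val v))) ∧
      ForceV v w := by
  obtain ⟨C', c, hs, hC', hc⟩ := exists_cstar_plug (δ := δ) (msg := msg) h
    (by rintro ⟨w, h⟩; cases w <;> simp [PVal.toExp] at h)
  obtain ⟨v, hv, hw⟩ := exists_cstar_brk (δ := δ) (msg := msg) hc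
  have hj : ∀ F ∈ C', F.IsLocal ∨ ∀ C₁ : RCtx S, C₁.IsLocal →
      CStar δ msg (F.plugClo (plug C₁ (.brk l (.val v)))) (.brk l (.val v)) := by
    clear hs h
    induction hC' with
    | nil => simp
    | @cons F _ _ _ hF _ ih =>
      unfold IsBreakCtx at hC ih
      rw [List.forall_mem_cons] at hC ⊢
      refine ⟨?_, ih hC.2⟩
      rw [← hF.isLocal_iff, ← hF.isCatch_iff] at hC
      refine hC.1.imp id fun hl C₁ h₁ => ?_
      cases F with
      | catchF x d => exact fun σ E => .single (.brkCatch σ E C₁ l v x d h₁)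
      | _ => exact False.elim hl
  obtain ⟨C₀, h₀, hs₀⟩ := exists_cstar_local hj (C₁ := []) (by simp [Ctx.IsLocal])
  exact ⟨C₀, v, h₀, (hs.trans (hv.plug C')).trans hs₀, hw⟩

/-- The answer exposes the context, then exposes the redex or unrolls the jump, and finally takes
the matching step. Both stores have the same domain, so `ref` can reuse the very address chosen by
the substitution calculus. -/
theorem rho_simulates_step {x : Conf S (RClo S) (RVal S)} {x' y' : Conf S (Exp S) (SynVal S)}
    (h : ForceConf False x x') (hxy : SubStep δ msg x' y') :
    ∃ y, RhoStar δ msg x y ∧ ForceConf False y y' := by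
  cases h with
  | err => cases hxy
  | run σ τ t u hs ht =>
    cases hxy with
    | red _ E e e' hr =>
      obtain ⟨E', c, hp, hE, hc⟩ := exists_cstar_plug (δ := δ) (msg := msg) ht
        (not_isValue_of_subRed hr)
      obtain ⟨d, hd, hde⟩ := subRed_force hc hr
      exact ⟨.run σ (plug E' d), hp.trans (hd.plug E') σ [], .run _ _ _ _ hs (forceRel_plug hE hde)⟩
    | ref _ E w a ha =>
      obtain ⟨E', c, hp, hE, hc⟩ := exists_cstar_plug (δ := δ) (msg := msg) ht
        (by rintro ⟨w, h⟩; cases w <;> simp [PVal.toExp] at h)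
      obtain ⟨v, hv, hw⟩ := exists_cstar_ref (δ := δ) (msg := msg) hc
      exact ⟨_, (hp.trans (hv.plug E') σ []).tail (.ref σ E' v a (by rwa [← hs.mem_iff])),
        .run _ _ _ _ (hs.insert a hw) (forceRel_plug hE (forceV_addr a).rel)⟩
    | deref _ E a w ha =>
      obtain ⟨E', c, hp, hE, hc⟩ := exists_cstar_plug (δ := δ) (msg := msg) ht
        (by rintro ⟨w, h⟩; cases w <;> simp [PVal.toExp] at h)
      obtain ⟨v, hv, hw⟩ := exists_cstar_deref (δ := δ) (msg := msg) (w := .addr a) hc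
      cases forceV_addr_right hw
      obtain ⟨v, hl, hvw⟩ := hs.lookup_right ha
      exact ⟨_, (hp.trans (hv.plug E') σ []).tail (.deref σ E' a v hl),
        .run _ _ _ _ hs (forceRel_plug hE hvw.rel)⟩
    | assign _ E a w =>
      obtain ⟨E', c, hp, hE, hc⟩ := exists_cstar_plug (δ := δ) (msg := msg) ht
        (by rintro ⟨w, h⟩; cases w <;> simp [PVal.toExp] at h)
      obtain ⟨v', v, hv, hw', hw⟩ := exists_cstar_assign (δ := δ) (msg := msg) (w := .addr a) hc
      cases forceV_addr_right hw'
      exact ⟨_, (hp.trans (hv.plug E') σ []).tail (.assign σ E' a v),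
        .run _ _ _ _ (hs.insert a hw) (forceRel_plug hE hw.rel)⟩
    | uncaught _ C w hC =>
      obtain ⟨C₀, v, h₀, hp, hw⟩ := exists_cstar_throw_ctx (δ := δ) (msg := msg) hC ht
      exact ⟨_, (hp σ []).tail (.uncaught σ C₀ v h₀), .err _ _ _ _ hs hw⟩
    | throwCatch _ E C w x e hC =>
      obtain ⟨E', c, hp, hE, hc⟩ := exists_cstar_plug (δ := δ) (msg := msg) ht
        (by rintro ⟨w, h⟩; cases w <;> simp [PVal.toExp] at h)
      obtain ⟨c, d, hq, hc, hd⟩ := exists_cstar_tryCatch (δ := δ) (msg := msg) hc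
      obtain ⟨C₀, v, h₀, hv, hw⟩ := exists_cstar_throw_ctx (δ := δ) (msg := msg) hC hc
      obtain ⟨f, ρ, rfl, _⟩ := id hd
      exact ⟨_, (hp.trans ((hq.trans (hv.frame (.catchF x _))).plug E') σ []).tail
        (.throwCatch σ E' C₀ v x f ρ h₀), .run _ _ _ _ hs (forceRel_plug hE (hd.subst hw))⟩
    | throwFinally _ E C w e hC =>
      obtain ⟨E', c, hp, hE, hc⟩ := exists_cstar_plug (δ := δ) (msg := msg) ht
        (by rintro ⟨w, h⟩; cases w <;> simp [PVal.toExp] at h)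
      obtain ⟨c, d, hq, hc, hd⟩ := exists_cstar_tryFinally (δ := δ) (msg := msg) hc
      obtain ⟨C₀, v, h₀, hv, hw⟩ := exists_cstar_throw_ctx (δ := δ) (msg := msg) hC hc
      exact ⟨_, (hp.trans ((hq.trans (hv.frame (.finallyF _))).plug E') σ []).tail
        (.throwFinally σ E' C₀ v d h₀),
        .run _ _ _ _ hs (forceRel_plug hE (.seq _ _ _ _ hd (.throw _ _ hw.rel)))⟩
    | brkFinally _ E C l w e hC =>
      obtain ⟨E', c, hp, hE, hc⟩ := exists_cstar_plug (δ := δ) (msg := msg) ht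
        (by rintro ⟨w, h⟩; cases w <;> simp [PVal.toExp] at h)
      obtain ⟨c, d, hq, hc, hd⟩ := exists_cstar_tryFinally (δ := δ) (msg := msg) hc
      obtain ⟨C₀, v, h₀, hv, hw⟩ := exists_cstar_brk_ctx (δ := δ) (msg := msg) hC hc
      exact ⟨_, (hp.trans ((hq.trans (hv.frame (.finallyF _))).plug E') σ []).tail
        (.brkFinally σ E' C₀ l v d h₀),
        .run _ _ _ _ hs (forceRel_plug hE (.seq _ _ _ _ hd (.brk _ _ _ hw.rel)))⟩
    | brkLabel _ E C l w hC =>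
      obtain ⟨E', c, hp, hE, hc⟩ := exists_cstar_plug (δ := δ) (msg := msg) ht
        (by rintro ⟨w, h⟩; cases w <;> simp [PVal.toExp] at h)
      obtain ⟨c, hq, hc⟩ := exists_cstar_label (δ := δ) (msg := msg) hc
      obtain ⟨C₀, v, h₀, hv, hw⟩ := exists_cstar_brk_ctx (δ := δ) (msg := msg) hC hc
      exact ⟨_, (hp.trans ((hq.trans (hv.frame (.labelF _))).plug E') σ []).tail
        (.brkLabel σ E' C₀ l v h₀), .run _ _ _ _ hs (forceRel_plug hE hw.rel)⟩
    | brkOther _ E C l l' w hC hne =>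
      obtain ⟨E', c, hp, hE, hc⟩ := exists_cstar_plug (δ := δ) (msg := msg) ht
        (by rintro ⟨w, h⟩; cases w <;> simp [PVal.toExp] at h)
      obtain ⟨c, hq, hc⟩ := exists_cstar_label (δ := δ) (msg := msg) hc
      obtain ⟨C₀, v, h₀, hv, hw⟩ := exists_cstar_brk_ctx (δ := δ) (msg := msg) hC hc
      exact ⟨_, (hp.trans ((hq.trans (hv.frame (.labelF _))).plug E') σ []).tail
        (.brkOther σ E' C₀ l l' v h₀ hne),
        .run _ _ _ _ hs (forceRel_plug hE (.brk _ _ _ hw.rel))⟩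
    | brkUnmatched _ C l w hC =>
      obtain ⟨C₀, v, h₀, hp, hw⟩ := exists_cstar_brk_ctx (δ := δ) (msg := msg) hC ht
      exact ⟨_, (hp σ []).tail (.brkUnmatched σ C₀ l v h₀),
        .run _ _ _ _ hs (.throw _ _ (forceV_errVal msg _).rel)⟩

theorem rhoEval_of_subEval {e : Exp S} (he : e.fv = ∅) {A : Answer S (SynVal S)}
    (h : SubEval δ msg e A) : ∃ B, RhoEval δ msg e B ∧ Forces B A := by
  have key : ∀ y', SubStar δ msg (.run ∅ e) y' →
      ∃ y, RhoStar δ msg (injJS e) y ∧ ForceConf False y y' := by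
    intro y hy
    induction hy with
    | refl => exact ⟨_, .refl, forceConf_injJS he⟩
    | tail _ hxy ih =>
      obtain ⟨s, h1, h2⟩ := ih
      obtain ⟨s', h3, h4⟩ := rho_simulates_step h2 hxy
      exact ⟨s', h1.trans h3, h4⟩
  obtain ⟨y, h1, h2⟩ := key _ h
  cases A with
  | value τ w =>
    simp only [Answer.toSub] at h2
    cases h2 with
    | run σ _ t _ hs ht =>
      -- The substitution calculus has reached a value, but the closure may still be a suspension of
      -- it; its evaluation leaves the store alone.
      obtain ⟨v, hv, _, rfl⟩ := evalsTo_of_forceRel (δ := δ) (msg := msg) ht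
      exact ⟨.value σ v, h1.trans (hv σ []), .value _ _ _ hs.forces⟩
  | error τ w =>
    simp only [Answer.toSub] at h2
    cases h2 with
    | err σ _ v _ hs hw =>
      obtain ⟨_, rfl⟩ := hw
      exact ⟨.error σ v, h1, .error _ _ _ hs.forces⟩

end SubToRhoRedex

end JSCalc

-- Correctness, by composition through the calculus of explicit substitutions.

theorem mainTheorem3 (S : JSCalc.Sig)
    (δ : JSCalc.Delta S) (hδ : δ.Equivariant)
    (msg : JSCalc.RuntimeError → String)
    (alloc : JSCalc.Alloc S) (halloc : alloc.Valid)
    (e : JSCalc.Exp S) (he : JSCalc.IsProgram e) :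
    ((∀ A, JSCalc.SubEval δ msg e A →
        ∃ C, JSCalc.JAMEval δ msg alloc e C ∧ JSCalc.SameSubAnswer A C) ∧
      (∀ C, JSCalc.JAMEval δ msg alloc e C →
        ∃ A, JSCalc.SubEval δ msg e A ∧ JSCalc.SameSubAnswer A C)) ∧
    ((∀ B, JSCalc.RhoEval δ msg e B →
        ∃ C, JSCalc.JAMEval δ msg alloc e C ∧ JSCalc.SameAnswer B C) ∧
      (∀ C, JSCalc.JAMEval δ msg alloc e C →
        ∃ B, JSCalc.RhoEval δ msg e B ∧ JSCalc.SameAnswer B C)) := by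
  refine ⟨⟨fun A hA => ?_, fun C hC => ?_⟩,
    fun B hB => JSCalc.jamEval_of_rhoEval hδ halloc he.2 hB,
    fun C hC => JSCalc.rhoEval_of_jamEval hδ halloc he.2 hC⟩
  · obtain ⟨B, hB, hf⟩ := JSCalc.rhoEval_of_subEval he.1 hA
    obtain ⟨C, hC, hs⟩ := JSCalc.jamEval_of_rhoEval hδ halloc he.2 hB
    -- The intermediate answer `B` is the witness that `SameSubAnswer` asks for.
    exact ⟨C, hC, B, hf, hs⟩
  · obtain ⟨B, hB, hs⟩ := JSCalc.rhoEval_of_jamEval hδ halloc he.2 hC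
    obtain ⟨A, hA, hf⟩ := JSCalc.subEval_of_rhoEval he.1 hB
    exact ⟨A, hA, B, hf, hs⟩
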